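/- Conventions. A $2$-complex is a combinatorial $2$-dimensional CW-complex: each $2$-cell is a polygon with at least one side whose boundary is attached along a closed edge path that is an immersion (no backtracking). All cells are closed cells, $\partial F$ denotes the boundary of a $2$-cell $F$ (a subcomplex of the $1$-skeleton), and the degree $\delta(v)$ of a vertex $v$ is the number of ends of edges incident to it. The link of $v$ is the graph whose vertices are the ends of edges at $v$ and which has one edge, joining two such ends, for each corner of a $2$-cell at $v$. A piece is a nontrivial edge path $P$ that factors as $P\to\partial R_1\to X$ and $P\to\partial R_2\to X$ for $2$-cells $R_1,R_2$ such that no homeomorphism $\partial R_1\to\partial R_2$ is compatible with both factorizations and with the attaching maps. $X$ is $C(4)$ if no attaching map of a $2$-cell is a concatenation of fewer than four pieces. A disc diagram is a finite contractible $2$-complex $D$ with an embedding in the plane; a combinatorial map $D\to X$ is reduced if it sends pieces to pieces (through the images of the $2$-cells in which they are pieces); $X$ is $T(4)$ if no disc diagram with a reduced map to $X$ has an internal vertex $v$ with $2<\delta(v)<4$. Octagonal model. Let $\mathfrak X'$ be the $2$-complex whose $1$-skeleton is the union of the lines $\mathbb R\times\mathbb Z\times\{0\}$, $\mathbb Z\times\mathbb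 R\times\{1\}$ and the segments $\mathbb Z\times\mathbb Z\times[0,1]$, with vertex set $\mathbb Z\times\mathbb Z\times\{0,1\}$, and which has for all $i,j\in\mathbb Z$ one $2$-cell attached along the $8$-cycle $(i,j,0),(i+1,j,0),(i+1,j,1),(i+1,j+1,1),(i+1,j+1,0),(i,j+1,0),(i,j+1,1),(i,j,1)$. A quasi-flat plane is a $C(4)$–$T(4)$ complex homeomorphic to a space obtained from $\mathfrak X'$ by collapsing each edge of some set of vertical edges $[(i,j,0),(i,j,1)]$ to a vertex. Proposition. Let $X$ be a simply connected $C(4)$–$T(4)$ complex with at least one $2$-cell, in which every edge is contained in at least two $2$-cells. Suppose that for every $2$-cell $F$ of $X$ there are $2$-cells $F_1,\dots,F_8$ (indices modulo $8$) such that: 1. $F_1,\dots,F_8$ are distinct and are exactly the $2$-cells other than $F$ that have non-empty intersection with $F$; 2. $F\cap(F_1\cup F_3\cup F_5\cup F_7)=\partial F$; 3. $F\cap F_i=F_{i-1}\cap F_{i+1}$ for $i=2,4,6,8$; 4. $F\cap F_i\cap F_j\cap F_k\cap F_l=\emptyset$ for any distinct $i,j,k,l$; 5. for each vertex $v\in\partial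 F$ with $\delta(v)\ge 3$ one of the following holds: - $\delta(v)=4$, and for some $i\in\{2,4,6,8\}$ one has $F\cap F_i=\{v\}$ and the link of $v$ is an embedded cycle of length $4$ whose successive edges are corners of $F_{i-1},F_i,F_{i+1},F$; - $\delta(v)=3$, and there are a vertex $v'$ with $\delta(v')=3$ and an $i\in\{2,4,6,8\}$ such that $F\cap F_i$ is an arc (embedded edge path of positive length) with ends $v$ and $v'$, and such that the link of each of $v$, $v'$ is the union of two embedded cycles of length $2$: for one of $v,v'$ one cycle consists of corners of $F,F_{i-1}$ and the other of corners of $F_i,F_{i+1}$, and for the other of $v,v'$ one cycle consists of corners of $F,F_{i+1}$ and the other of corners of $F_i,F_{i-1}$. Then $X$ is a quasi-flat plane. -/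

import Mathlib

universe u

/-! ### Combinatorial 2-complexes -/

/-- A 1-dimensional cell complex: vertices, edges, and for each edge (with an arbitrary reference
orientation) its two end points. Loops and multiple edges are allowed. -/
structure OneComplex where
  V : Type u
  E : Type u
  src : E → V
  tgt : E → V

namespace OneComplex

variable (X : OneComplex.{u})

/-- Oriented edges; `(e, true)` is `e` with its reference orientation. An oriented edge is also
used for the end of its edge at its initial vertex. -/
abbrev Dart : Type u := X.E × Bool

variable {X}

/-- The oppositely oriented edge. -/
def rev (d : X.Dart) : X.Dart := (d.1, !d.2)

/-- Initial vertex of an oriented edge. -/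
def dsrc (d : X.Dart) : X.V := if d.2 then X.src d.1 else X.tgt d.1

/-- Terminal vertex of an oriented edge. -/
def dtgt (d : X.Dart) : X.V := if d.2 then X.tgt d.1 else X.src d.1

/-- The list of oriented edges `P` is an edge path from `v` to `w`. -/
def IsWalk : X.V → List X.Dart → X.V → Prop
  | v, [], w => v = w
  | v, d :: P, w => dsrc d = v ∧ IsWalk (dtgt d) P w

end OneComplex

/-- A combinatorial 2-complex: a 1-complex together with 2-cells, each of which is a polygon with
`len c ≥ 1` sides, indexed cyclically, attached along a closed edge path that is an immersion
(it does not backtrack, not even cyclically). -/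
structure TwoComplex extends OneComplex.{u} where
  C : Type u
  len : C → ℕ
  len_pos : ∀ c, 0 < len c
  att : (c : C) → ZMod (len c) → toOneComplex.Dart
  att_chain : ∀ c k, OneComplex.dtgt (att c k) = OneComplex.dsrc (att c (k + 1))
  att_imm : ∀ c k, att c (k + 1) ≠ OneComplex.rev (att c k)

/-! ### The boundary circle of a polygon -/

namespace Polygon

/-- Oriented sides of the `n`-gon; `(k, true)` runs from vertex `k` to vertex `k + 1`. -/
abbrev Side (n : ℕ) : Type := ZMod n × Bool

variable {n : ℕ}

def rev (p : Side n) : Side n := (p.1, !p.2)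

/-- The next oriented side in the same sense of rotation. -/
def next (p : Side n) : Side n := if p.2 then (p.1 + 1, true) else (p.1 - 1, false)

def src (p : Side n) : ZMod n := if p.2 then p.1 else p.1 + 1

def tgt (p : Side n) : ZMod n := if p.2 then p.1 + 1 else p.1

/-- A list of oriented sides that forms an edge path in the boundary of the polygon. -/
def IsPath (P : List (Side n)) : Prop := P.IsChain (fun p q => tgt p = src q)

/-- A combinatorial homeomorphism between the boundary circles of an `m`-gon and an `n`-gon:
a rotation or a reflection. -/
structure Iso (m n : ℕ) where
  toEquiv : Side m ≃ Side n
  map_rev : ∀ p, toEquiv (rev p) = rev (toEquiv p)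
  map_next : ∀ p, toEquiv (next p) = next (toEquiv p)

end Polygon

namespace TwoComplex

open OneComplex

variable (X : TwoComplex.{u})

/-! ### Geometric realization -/

/-- The closed unit disc. -/
abbrev Disc : Type := Metric.closedBall (0 : ℂ) 1

/-- The point of angle `θ` on the boundary of the disc. -/
noncomputable def discPt (θ : ℝ) : Disc := ⟨(Circle.exp θ : ℂ), by simp⟩

/-- Disjoint union of a point for each vertex, an interval for each edge and a disc for each
2-cell. -/
abbrev PreRealization : Type u :=
  (Σ _ : X.V, Unit) ⊕ ((Σ _ : X.E, unitInterval) ⊕ (Σ _ : X.C, Disc))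

/-- The gluing relation. The boundary circle of the disc of an `n`-gon is divided into `n` equal
arcs, the `k`-th of which is glued to the `k`-th oriented edge of the attaching path. -/
inductive Glue : X.PreRealization → X.PreRealization → Prop
  | src (e : X.E) : Glue (.inr (.inl ⟨e, 0⟩)) (.inl ⟨X.src e, ()⟩)
  | tgt (e : X.E) : Glue (.inr (.inl ⟨e, 1⟩)) (.inl ⟨X.tgt e, ()⟩)
  | att (c : X.C) (k : ZMod (X.len c)) (t : unitInterval) :
      Glue (.inr (.inr ⟨c, discPt (2 * Real.pi * ((k.val : ℝ) + t) / X.len c)⟩))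
        (.inr (.inl ⟨(X.att c k).1, if (X.att c k).2 then t else unitInterval.symm t⟩))

/-- The topological space underlying the complex, with the quotient (CW) topology. -/
abbrev Realization : Type u := Quot X.Glue

variable {X}

def vertexPt (v : X.V) : X.Realization := Quot.mk _ (.inl ⟨v, ()⟩)

def edgePt (e : X.E) (t : unitInterval) : X.Realization := Quot.mk _ (.inr (.inl ⟨e, t⟩))

/-! ### Closed cells as subcomplexes -/

variable (X) in
/-- The cells of the complex. A subcomplex is represented by the set of its cells, so that unions
and intersections of subcomplexes are unions and intersections of sets. -/
inductive Cell : Type u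
  | vert (v : X.V) : Cell
  | edge (e : X.E) : Cell
  | face (c : X.C) : Cell

/-- The boundary `∂c` of a 2-cell. -/
def bdry (c : X.C) : Set X.Cell :=
  {x | ∃ k, x = .vert (dsrc (X.att c k)) ∨ x = .edge (X.att c k).1}

/-- The closed 2-cell `c`. -/
def closedCell (c : X.C) : Set X.Cell := insert (.face c) (bdry c)

/-- The subcomplex `K` is an arc (an embedded edge path of positive length) with ends `v`, `w`. -/
def IsArc (K : Set X.Cell) (v w : X.V) : Prop :=
  ∃ P : List X.Dart, P ≠ [] ∧ IsWalk v P w ∧ (v :: P.map dtgt).Nodup ∧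
    K = {x | (∃ a ∈ v :: P.map dtgt, x = .vert a) ∨ ∃ d ∈ P, x = .edge d.1}

/-! ### Valence and links -/

/-- The valence of a vertex: the number of ends of edges incident to it. -/
noncomputable def valence (v : X.V) : ℕ∞ := {d : X.Dart | dsrc d = v}.encard

variable (X) in
/-- A corner of a 2-cell: the 2-cell and a vertex of its polygon. -/
abbrev Corner : Type u := Σ c : X.C, ZMod (X.len c)

/-- The vertices of the link of `v`: ends of edges at `v`. -/
def linkVertices (v : X.V) : Set X.Dart := {d | dsrc d = v}

/-- The edges of the link of `v`: corners of 2-cells at `v`. -/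
def linkEdges (v : X.V) : Set X.Corner := {x | dsrc (X.att x.1 x.2) = v}

/-- The two ends of edges that form the corner. -/
def cornerEnds (x : X.Corner) : Sym2 X.Dart :=
  s(rev (X.att x.1 (x.2 - 1)), X.att x.1 x.2)

/-- `d` and `x` are the successive vertices and edges of an embedded cycle of length `n` in the
link of `v`, and the edges are corners of the 2-cells `G 0, …, G (n - 1)`. -/
structure IsLinkCycle (v : X.V) {n : ℕ} [NeZero n] (G : Fin n → X.C)
    (d : Fin n → X.Dart) (x : Fin n → X.Corner) : Prop where
  vertices_inj : Function.Injective d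
  edges_inj : Function.Injective x
  vertices_mem : ∀ j, d j ∈ linkVertices v
  edges_mem : ∀ j, x j ∈ linkEdges v
  ends : ∀ j, cornerEnds (x j) = s(d j, d (j + 1))
  cells : ∀ j, (x j).1 = G j

/-- The link of `v` is an embedded cycle whose successive edges are corners of
`G 0, …, G (n - 1)`. -/
def LinkIsCycle (v : X.V) {n : ℕ} [NeZero n] (G : Fin n → X.C) : Prop :=
  ∃ d x, IsLinkCycle v G d x ∧ Set.range d = linkVertices v ∧ Set.range x = linkEdges v

/-- The link of `v` is the union of two embedded cycles of length two, one formed by corners of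
`A` and `A'` and the other by corners of `B` and `B'`. -/
def LinkIsTwoBigons (v : X.V) (A A' B B' : X.C) : Prop :=
  ∃ d x d' x', IsLinkCycle v ![A, A'] d x ∧ IsLinkCycle v ![B, B'] d' x' ∧
    Set.range d ∪ Set.range d' = linkVertices v ∧ Set.range x ∪ Set.range x' = linkEdges v

/-! ### Pieces and the condition `C(p)` -/

/-- The map from the boundary of the polygon of `c` to the complex, on oriented sides. -/
def bdDart (c : X.C) (p : Polygon.Side (X.len c)) : X.Dart :=
  if p.2 then X.att c p.1 else rev (X.att c p.1)

/-- The paths `p₁` in `∂R₁` and `p₂` in `∂R₂` are two factorizations of the same nontrivial path,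
which is a piece because there is no homeomorphism `∂R₁ → ∂R₂` compatible with `p₁`, `p₂` and the
attaching maps. -/
def IsPieceVia (R₁ R₂ : X.C) (p₁ : List (Polygon.Side (X.len R₁)))
    (p₂ : List (Polygon.Side (X.len R₂))) : Prop :=
  p₁ ≠ [] ∧ Polygon.IsPath p₁ ∧ Polygon.IsPath p₂ ∧
    p₁.map (bdDart R₁) = p₂.map (bdDart R₂) ∧
    ¬ ∃ φ : Polygon.Iso (X.len R₁) (X.len R₂),
      p₁.map φ.toEquiv = p₂ ∧ ∀ q, bdDart R₂ (φ.toEquiv q) = bdDart R₁ q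

/-- A piece: a nontrivial path occurring in the boundaries of 2-cells in two distinct ways. -/
def IsPiece (P : List X.Dart) : Prop :=
  ∃ R₁ R₂ p₁ p₂, IsPieceVia R₁ R₂ p₁ p₂ ∧ p₁.map (bdDart R₁) = P

/-- The boundary path of `c`, read once around from the vertex `k`. -/
def bdPath (c : X.C) (k : ZMod (X.len c)) : List X.Dart :=
  List.ofFn fun j : Fin (X.len c) => X.att c (k + ((j : ℕ) : ZMod (X.len c)))

variable (X) in
/-- The small cancellation condition `C(p)`: no attaching map is a concatenation of fewer than `p`
pieces. -/
def SatisfiesC (p : ℕ) : Prop :=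
  ∀ (c : X.C) (k : ZMod (X.len c)), ¬ ∃ L : List (List X.Dart),
    L.length < p ∧ (∀ P ∈ L, IsPiece P) ∧ L.flatten = bdPath c k

/-! ### Disc diagrams and the condition `T(q)` -/

/-- A combinatorial map of 2-complexes: open cells are mapped homeomorphically onto open cells. -/
structure CombMap (D : TwoComplex.{0}) (X : TwoComplex.{u}) where
  onV : D.V → X.V
  onD : D.Dart → X.Dart
  onC : D.C → X.C
  onD_rev : ∀ d, onD (rev d) = rev (onD d)
  onD_src : ∀ d, dsrc (onD d) = onV (dsrc d)
  poly : ∀ c, Polygon.Iso (D.len c) (X.len (onC c))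
  poly_bd : ∀ c q, bdDart (onC c) ((poly c).toEquiv q) = onD (bdDart c q)

/-- A map is reduced if all pieces are mapped to pieces (through the images of the 2-cells in
which they are pieces). -/
def CombMap.IsReduced {D : TwoComplex.{0}} (f : CombMap D X) : Prop :=
  ∀ (R₁ R₂ : D.C) (p₁ : List (Polygon.Side (D.len R₁))) (p₂ : List (Polygon.Side (D.len R₂))),
    IsPieceVia R₁ R₂ p₁ p₂ →
      IsPieceVia (f.onC R₁) (f.onC R₂) (p₁.map (f.poly R₁).toEquiv) (p₂.map (f.poly R₂).toEquiv)

/-- A disc diagram: a finite contractible 2-complex with a specified embedding in the plane. -/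
structure DiscDiagram where
  D : TwoComplex.{0}
  finite_V : Finite D.V
  finite_E : Finite D.E
  finite_C : Finite D.C
  contractible : ContractibleSpace D.Realization
  emb : D.Realization → ℂ
  isEmbedding : Topology.IsEmbedding emb

/-- A vertex of a disc diagram is internal if it lies in the interior of the diagram. -/
def DiscDiagram.IsInternal (Δ : DiscDiagram) (v : Δ.D.V) : Prop :=
  Δ.emb (vertexPt v) ∈ interior (Set.range Δ.emb)

variable (X) in
/-- The small cancellation condition `T(q)`: no reduced disc diagram has an internal vertex of
valence strictly between `2` and `q`. -/
def SatisfiesT (q : ℕ) : Prop :=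
  ¬ ∃ (Δ : DiscDiagram) (f : CombMap Δ.D X) (v : Δ.D.V),
    f.IsReduced ∧ Δ.IsInternal v ∧ 2 < valence v ∧ valence v < q

end TwoComplex

/-! ### Quasi-flat planes -/

namespace Octagonal

/-- The lines `ℝ × ℤ × {0}`, `ℤ × ℝ × {1}`, `ℤ × ℤ × [0, 1]`, divided at the points of
`ℤ × ℤ × {0, 1}`. -/
inductive Edge : Type
  | x (i j : ℤ) : Edge
  | y (i j : ℤ) : Edge
  | z (i j : ℤ) : Edge

/-- The edge `x i j` joins `(i, j, 0)` to `(i + 1, j, 0)`, the edge `y i j` joins `(i, j, 1)` to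
`(i, j + 1, 1)`, and the vertical edge `z i j` joins `(i, j, 0)` to `(i, j, 1)`; the third
coordinate `0`, `1` of a vertex is written `false`, `true`. -/
def skeleton : OneComplex.{0} where
  V := ℤ × ℤ × Bool
  E := Edge
  src
    | .x i j => (i, j, false)
    | .y i j => (i, j, true)
    | .z i j => (i, j, false)
  tgt
    | .x i j => (i + 1, j, false)
    | .y i j => (i, j + 1, true)
    | .z i j => (i, j, true)

/-- The 8-cycle `(i,j,0), (i+1,j,0), (i+1,j,1), (i+1,j+1,1), (i+1,j+1,0), (i,j+1,0), (i,j+1,1),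
(i,j,1)`. -/
def octagon (i j : ℤ) : Fin 8 → skeleton.Dart :=
  ![(.x i j, true), (.z (i + 1) j, true), (.y (i + 1) j, true), (.z (i + 1) (j + 1), false),
    (.x i (j + 1), false), (.z i (j + 1), true), (.y i j, false), (.z i j, false)]

/-- The octagonal model: every 8-cycle `octagon i j` is filled by a 2-cell. -/
def model : TwoComplex.{0} where
  toOneComplex := skeleton
  C := ℤ × ℤ
  len _ := 8
  len_pos _ := by norm_num
  att c := octagon c.1 c.2
  att_chain c k := by
    change Fin 8 at k
    change OneComplex.dtgt (octagon c.1 c.2 k) = OneComplex.dsrc (octagon c.1 c.2 (k + 1))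
    fin_cases k <;> simp [octagon, OneComplex.dtgt, OneComplex.dsrc, skeleton]
  att_imm c k := by
    change Fin 8 at k
    change octagon c.1 c.2 (k + 1) ≠ OneComplex.rev (octagon c.1 c.2 k)
    fin_cases k <;> exact nofun

/-- The closed vertical edge from `(i, j, 0)` to `(i, j, 1)` in the model. -/
def verticalEdge (p : ℤ × ℤ) : Set model.Realization :=
  Set.range (TwoComplex.edgePt (X := model) (Edge.z p.1 p.2))

/-- The space obtained from the octagonal model by collapsing each of the vertical edges in `S`
to a vertex. -/
abbrev Collapse (S : Set (ℤ × ℤ)) : Type :=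
  Quot fun a b : model.Realization => ∃ p ∈ S, a ∈ verticalEdge p ∧ b ∈ verticalEdge p

end Octagonal

namespace TwoComplex

/-- A quasi-flat plane: a `C(4)`–`T(4)` complex homeomorphic to the octagonal model with some set
of vertical edges collapsed. -/
def IsQuasiFlatPlane (X : TwoComplex.{u}) : Prop :=
  X.SatisfiesC 4 ∧ X.SatisfiesT 4 ∧
    ∃ S : Set (ℤ × ℤ), Nonempty (X.Realization ≃ₜ Octagonal.Collapse S)

/-- The local conditions of a quasi-flat plane at the 2-cell `F`, with its neighbours labelled
`N 1, …, N 8` (the indices are taken modulo `8`). That the labels follow the cyclic order around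
`∂F` is not assumed separately. -/
structure QuasiFlatAt {X : TwoComplex.{u}} (F : X.C) (N : ZMod 8 → X.C) : Prop where
  /-- The `N i` are distinct, and are exactly the 2-cells other than `F` that meet `F`. -/
  injective : Function.Injective N
  neighbours : ∀ G, (∃ i, N i = G) ↔ G ≠ F ∧ (closedCell F ∩ closedCell G).Nonempty
  /-- The neighbours with odd label cover `∂F`. -/
  cover : closedCell F ∩
    (closedCell (N 1) ∪ closedCell (N 3) ∪ closedCell (N 5) ∪ closedCell (N 7)) = bdry F
  /-- The intersection with a neighbour with even label. -/
  diagonal : ∀ i ∈ ({2, 4, 6, 8} : Set (ZMod 8)),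
    closedCell F ∩ closedCell (N i) = closedCell (N (i - 1)) ∩ closedCell (N (i + 1))
  /-- No point of `F` lies in four of its neighbours. -/
  fivefold : ∀ i j k l : ZMod 8, i ≠ j → i ≠ k → i ≠ l → j ≠ k → j ≠ l → k ≠ l →
    closedCell F ∩ closedCell (N i) ∩ closedCell (N j) ∩ closedCell (N k) ∩ closedCell (N l) = ∅
  /-- The links of the vertices of valence at least three on `∂F`. -/
  links : ∀ v : X.V, .vert v ∈ bdry F → 3 ≤ valence v →
    (valence v = 4 ∧ ∃ i ∈ ({2, 4, 6, 8} : Set (ZMod 8)),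
      closedCell F ∩ closedCell (N i) = {.vert v} ∧
      LinkIsCycle v ![N (i - 1), N i, N (i + 1), F]) ∨
    (valence v = 3 ∧ ∃ v' : X.V, valence v' = 3 ∧ ∃ i ∈ ({2, 4, 6, 8} : Set (ZMod 8)),
      IsArc (closedCell F ∩ closedCell (N i)) v v' ∧
      ((LinkIsTwoBigons v F (N (i - 1)) (N i) (N (i + 1)) ∧
          LinkIsTwoBigons v' F (N (i + 1)) (N i) (N (i - 1))) ∨
        (LinkIsTwoBigons v F (N (i + 1)) (N i) (N (i - 1)) ∧
          LinkIsTwoBigons v' F (N (i - 1)) (N i) (N (i + 1)))))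

end TwoComplex

/-!
Dually, the 2-cells of `X` are the vertices of a complex of squares, with one square
`Crossing v A B C D` for every constellation of four 2-cells around a branch vertex `v`, that is,
a vertex of valence at least three. The local conditions say that the link of every vertex of this
square complex is a cycle of length four (`isSquareComplex_dualSquare`): the eight neighbours of a
2-cell `F` form a frame, which looks like the eight neighbours of a point of `ℤ × ℤ`.

A frame at a 2-cell can be moved to the neighbouring 2-cells. A frame is determined by two
consecutive members, and so opposite moves cancel and the moves to the east and to the north
commute: `ℤ × ℤ` acts on frames, and the complex of squares has a flat structure. The frames with a
position in `ℤ × ℤ` are the fibres of a covering of `X`, the cocycle condition being needed only at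
the vertices (`exists_face_section`). Since `X` is simply connected, this covering has a section,
which makes developing maps single-valued: the 2-cells of `X` are `ρ w` for a bijection `ρ` from
`ℤ × ℤ` under which adjacency and position correspond (`exists_development`).

It remains to compare the 1-skeletons. For every `c` in `ℤ × ℤ` the branch vertices in the 2-cells
with labels in `around c` are either one vertex of valence four, or two vertices of valence three
that are joined by an arc (`exists_cornerData`). The set `S` of vertical edges to be collapsed
consists of those `c` for which there is one vertex only. This labels the branch vertices of `X` and
the edge ends at them by those of the collapsed model (`exists_isLabelling`). An edge of the model
becomes a line: an edge path of `X` between branch vertices through vertices of valence two, of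
length zero if the edge is collapsed. As each vertex of valence two leaves only one way to go on,
the boundary path of `ρ (i, j)`, which is embedded (`QuasiFlatAt.dsrc_injective`), is the
concatenation of the eight lines that correspond to the sides of `octagon i j`
(`IsLabelling.exists_reading`), and different lines are disjoint apart from their ends
(`IsLabelling.eq_of_linePt_eq`). The homeomorphism sends the edges of the model to the lines, and
the disc of an octagon to that of the 2-cell with the same label, by a map that is injective inside
and shrinks the collapsed sides of the octagon to points (`exists_disc_map`).
-/

open Topology

/-! ### Sections of locally constant cocycles -/

section Cocycle

variable {B : Type*} [TopologicalSpace B] {ι : Type*} {U : ι → Set B}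

/-- The case of a constant fibre of `exists_section_of_cocycle`. The sections `s i` are those of the
covering space with fibre `T` that is glued from the sets `U i × T`, in the trivialization over
`U i`; they are meaningful on `U i` only. -/
theorem exists_section_of_constant_cocycle [SimplyConnectedSpace B] [LocallyPathConnectedSpace B]
    {T : Type*} (hU : ∀ i, IsOpen (U i)) (hcov : ∀ x, ∃ i, x ∈ U i) (g : ι → ι → T → T)
    (hself : ∀ i t, g i i t = t)
    (hcomp : ∀ i j k x, x ∈ U i → x ∈ U j → x ∈ U k → ∀ t, g j k (g i j t) = g i k t)
    {i₀ : ι} {x₀ : B} (hx₀ : x₀ ∈ U i₀) (t₀ : T) :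
    ∃ s : ι → B → T, (∀ i K, K ⊆ U i → IsPreconnected K → ∀ x ∈ K, ∀ y ∈ K, s i x = s i y) ∧
      (∀ i j x, x ∈ U i → x ∈ U j → s j x = g i j (s i x)) ∧ s i₀ x₀ = t₀ := by
  let _ : TopologicalSpace T := ⊥
  have : DiscreteTopology T := ⟨rfl⟩
  choose idx hidx using hcov
  let Z : FiberBundleCore ι B T :=
    { baseSet := U
      isOpen_baseSet := hU
      indexAt := idx
      mem_baseSet_at := hidx
      coordChange := fun i j _ t => g i j t
      coordChange_self := fun i _ _ v => hself i v
      continuousOn_coordChange := fun i j =>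
        ((continuous_of_discreteTopology (f := g i j)).comp continuous_snd).continuousOn
      coordChange_comp := fun i j k x hx v => hcomp i j k x hx.1.1 hx.1.2 hx.2 v }
  have cov : IsCoveringMap Z.proj := FiberBundle.isCoveringMap (F := T) (E := Z.Fiber)
  let e₀ : Z.TotalSpace := ⟨x₀, g i₀ (idx x₀) t₀⟩
  obtain ⟨F, ⟨hF0, hF⟩, -⟩ := cov.existsUnique_continuousMap_lifts (ContinuousMap.id B) x₀ e₀ rfl
  have hproj : ∀ x, (F x).1 = x := fun x => congrFun hF x
  have hs : ∀ i x, ((Z.localTriv i) (F x)).2 = g (idx x) i (F x).2 := by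
    intro i x
    have h := congrArg Prod.snd (Z.localTriv_apply i (F x))
    rw [h]
    change g (idx (F x).1) i (F x).2 = _
    rw [hproj x]
  refine ⟨fun i x => ((Z.localTriv i) (F x)).2, ?_, ?_, ?_⟩
  · intro i K hK hKc x hx y hy
    refine hKc.constant (f := fun x => ((Z.localTriv i) (F x)).2) ?_ hx hy
    refine continuous_snd.comp_continuousOn ?_
    refine (Z.localTriv i).continuousOn.comp F.continuous.continuousOn ?_
    intro x hx
    rw [Z.mem_localTriv_source, ← Z.baseSet_at, hproj]
    exact hK hx
  · intro i j x hi hj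
    simp only [hs]
    exact (hcomp _ _ _ x (hidx x) hi hj _).symm
  · simp only [hF0]
    exact (hcomp _ _ _ x₀ hx₀ (hidx x₀) hx₀ _).trans (hself _ _)

/-- An equivalence relation that holds between overlapping members of a cover of a connected space
by non-empty open sets holds between any two members. -/
theorem rel_of_open_cover [PreconnectedSpace B] (hU : ∀ i, IsOpen (U i))
    (hcov : ∀ x, ∃ i, x ∈ U i) (hne : ∀ i, (U i).Nonempty) {r : ι → ι → Prop}
    (hr : Equivalence r) (hover : ∀ i j, (U i ∩ U j).Nonempty → r i j) (i j : ι) : r i j := by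
  let A : Set B := ⋃ k ∈ {k | r i k}, U k
  have hA : IsOpen A := isOpen_biUnion fun k _ => hU k
  have hAc : IsOpen Aᶜ := by
    have : Aᶜ = ⋃ k ∈ {k | ¬ r i k}, U k := by
      ext x
      simp only [A, Set.mem_compl_iff, Set.mem_iUnion, Set.mem_ofPred_eq, exists_prop, not_exists,
        not_and]
      constructor
      · intro h
        obtain ⟨k, hk⟩ := hcov x
        exact ⟨k, fun hik => h k hik hk, hk⟩
      · rintro ⟨k, hik, hk⟩ l hil hl
        exact hik (hr.trans hil (hover l k ⟨x, hl, hk⟩))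
    rw [this]
    exact isOpen_biUnion fun k _ => hU k
  have hcl : IsClopen A := ⟨⟨hAc⟩, hA⟩
  have huniv : A = Set.univ := by
    refine hcl.eq_univ ?_
    obtain ⟨x, hx⟩ := hne i
    exact ⟨x, Set.mem_biUnion (show r i i from hr.refl i) hx⟩
  obtain ⟨x, hx⟩ := hne j
  have hxA : x ∈ A := huniv ▸ Set.mem_univ x
  simp only [A, Set.mem_iUnion, Set.mem_ofPred_eq, exists_prop] at hxA
  obtain ⟨k, hik, hk⟩ := hxA
  exact hr.trans hik (hover k j ⟨x, hk, hx⟩)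

/-- A family of bijections between discrete fibres that satisfies the cocycle condition on triple
overlaps of an open cover of a simply connected space is a coboundary: it glues the fibres to a
covering space, which has a section through each of its points. -/
theorem exists_section_of_cocycle [SimplyConnectedSpace B] [LocallyPathConnectedSpace B]
    {T : ι → Type*} (hU : ∀ i, IsOpen (U i)) (hcov : ∀ x, ∃ i, x ∈ U i)
    (hne : ∀ i, (U i).Nonempty)
    (g : ∀ i j, T i → T j) (hself : ∀ i t, g i i t = t)
    (hcomp : ∀ i j k x, x ∈ U i → x ∈ U j → x ∈ U k → ∀ t, g j k (g i j t) = g i k t)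
    {i₀ : ι} {x₀ : B} (hx₀ : x₀ ∈ U i₀) (t₀ : T i₀) :
    ∃ s : ∀ i, B → T i, (∀ i K, K ⊆ U i → IsPreconnected K → ∀ x ∈ K, ∀ y ∈ K, s i x = s i y) ∧
      (∀ i j x, x ∈ U i → x ∈ U j → s j x = g i j (s i x)) ∧ s i₀ x₀ = t₀ := by
  have hequiv : ∀ i, Nonempty (T i ≃ T i₀) := by
    intro i
    refine rel_of_open_cover hU hcov hne (r := fun i j => Nonempty (T i ≃ T j)) ?_ ?_ i i₀
    · exact ⟨fun _ => ⟨Equiv.refl _⟩, fun ⟨e⟩ => ⟨e.symm⟩, fun ⟨e⟩ ⟨f⟩ => ⟨e.trans f⟩⟩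
    · rintro i j ⟨x, hi, hj⟩
      exact ⟨⟨g i j, g j i, fun t => by rw [hcomp i j i x hi hj hi, hself],
        fun t => by rw [hcomp j i j x hj hi hj, hself]⟩⟩
  let e := fun i => Classical.choice (hequiv i)
  obtain ⟨s, h1, h2, h3⟩ := exists_section_of_constant_cocycle hU hcov
    (fun i j t => e j (g i j ((e i).symm t))) (by simp [hself])
    (by intro i j k x hi hj hk t; simp [hcomp i j k x hi hj hk]) hx₀ (e i₀ t₀)
  refine ⟨fun i x => (e i).symm (s i x), ?_, ?_, ?_⟩
  · intro i K hK hKc x hx y hy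
    simp [h1 i K hK hKc x hx y hy]
  · intro i j x hi hj
    simp [h2 i j x hi hj]
  · simp [h3]

end Cocycle

/-! ### Polar coordinates on the disc -/

namespace TwoComplex

/-- The point of the disc at distance `r` from the centre in direction `2 * π * t`. -/
noncomputable def polar (r : unitInterval) (t : ℝ) : Disc :=
  ⟨(r : ℝ) * (Circle.exp (2 * Real.pi * t) : ℂ), by
    rw [mem_closedBall_zero_iff, norm_mul, Circle.norm_coe, mul_one, Complex.norm_real,
      Real.norm_of_nonneg r.2.1]
    exact r.2.2⟩

theorem polar_coe (r : unitInterval) (t : ℝ) :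
    (polar r t : ℂ) = (r : ℝ) * (Circle.exp (2 * Real.pi * t) : ℂ) := rfl

theorem norm_polar (r : unitInterval) (t : ℝ) : ‖(polar r t : ℂ)‖ = r := by
  rw [polar_coe, norm_mul, Circle.norm_coe, mul_one, Complex.norm_real, Real.norm_of_nonneg r.2.1]

theorem continuous_polar : Continuous fun p : unitInterval × ℝ => polar p.1 p.2 := by
  unfold polar
  fun_prop

theorem polar_one_eq_discPt (t : ℝ) : polar 1 t = discPt (2 * Real.pi * t) := by
  apply Subtype.ext; simp [discPt, polar]

theorem circle_exp_two_pi_mul_eq_iff {s t : ℝ} :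
    Circle.exp (2 * Real.pi * s) = Circle.exp (2 * Real.pi * t) ↔ ∃ m : ℤ, s = t + m := by
  rw [Circle.exp_eq_exp]
  have hpi := Real.pi_pos
  constructor
  · rintro ⟨m, hm⟩
    refine ⟨m, ?_⟩
    have : 2 * Real.pi * s = 2 * Real.pi * (t + m) := by linarith
    exact mul_left_cancel₀ (by positivity) this
  · rintro ⟨m, rfl⟩
    exact ⟨m, by ring⟩

theorem polar_add_int (r : unitInterval) (t : ℝ) (m : ℤ) : polar r (t + m) = polar r t := by
  apply Subtype.ext
  rw [polar_coe, polar_coe, circle_exp_two_pi_mul_eq_iff.2 ⟨m, rfl⟩]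

theorem polar_eq_iff {r r' : unitInterval} {s t : ℝ} :
    polar r s = polar r' t ↔ r = r' ∧ (r = 0 ∨ ∃ m : ℤ, s = t + m) := by
  constructor
  · intro h
    have hr : r = r' := Subtype.ext (by rw [← norm_polar r s, h, norm_polar])
    subst hr
    refine ⟨rfl, ?_⟩
    by_cases h0 : r = 0
    · exact Or.inl h0
    · right
      have h1 : (polar r s : ℂ) = polar r t := congrArg Subtype.val h
      rw [polar_coe, polar_coe] at h1
      have hr0 : ((r : ℝ) : ℂ) ≠ 0 := by
        exact_mod_cast fun h => h0 (Subtype.ext h)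
      exact circle_exp_two_pi_mul_eq_iff.1 (Circle.ext (mul_left_cancel₀ hr0 h1))
  · rintro ⟨rfl, rfl | ⟨m, rfl⟩⟩
    · apply Subtype.ext; simp [polar_coe]
    · exact polar_add_int _ _ _

theorem exists_polar (z : Disc) : ∃ (r : unitInterval) (t : ℝ), 0 ≤ t ∧ t < 1 ∧ polar r t = z := by
  have hz : ‖(z : ℂ)‖ ≤ 1 := mem_closedBall_zero_iff.1 z.2
  refine ⟨⟨‖(z : ℂ)‖, norm_nonneg _, hz⟩, Int.fract (Complex.arg z / (2 * Real.pi)),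
    Int.fract_nonneg _, Int.fract_lt_one _, ?_⟩
  have h := polar_add_int ⟨‖(z : ℂ)‖, norm_nonneg _, hz⟩ (Int.fract (Complex.arg z / (2 * Real.pi)))
    ⌊Complex.arg z / (2 * Real.pi)⌋
  rw [Int.fract_add_floor] at h
  rw [← h]
  apply Subtype.ext
  rw [polar_coe]
  have : 2 * Real.pi * (Complex.arg z / (2 * Real.pi)) = Complex.arg z := by field_simp
  rw [this, Circle.coe_exp]
  exact Complex.norm_mul_exp_arg_mul_I z

theorem isQuotientMap_polar :
    IsQuotientMap fun p : unitInterval × unitInterval => polar p.1 (p.2 : ℝ) := by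
  have hc : Continuous fun p : unitInterval × unitInterval => polar p.1 (p.2 : ℝ) :=
    continuous_polar.comp
      (continuous_fst.prodMk (continuous_subtype_val.comp continuous_snd))
  refine IsQuotientMap.of_surjective_continuous ?_ hc
  intro z
  obtain ⟨r, t, h0, h1, h⟩ := exists_polar z
  exact ⟨(r, ⟨t, h0, h1.le⟩), h⟩

/-- A monotone reparametrization of the boundary circle, possibly with intervals of constancy, is
the boundary value of a map of the disc onto itself that is injective inside: at radius `r` it is
interpolated with the identity, and so it is strictly monotone there for `r < 1`. -/
theorem exists_disc_map {l : ℝ → ℝ} (hl : Continuous l) (hm : Monotone l) (h0 : l 0 = 0)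
    (h1 : l 1 = 1) :
    ∃ h : Disc → Disc, Continuous h ∧ (∀ z, ‖(h z : ℂ)‖ = ‖(z : ℂ)‖) ∧
      (∀ z w : Disc, ‖(z : ℂ)‖ < 1 → h z = h w → z = w) ∧ Function.Surjective h ∧
      ∀ t, 0 ≤ t → t ≤ 1 → h (polar 1 t) = polar 1 (l t) := by
  let φ : ℝ → ℝ → ℝ := fun r t => (1 - r) * t + r * l t
  have hφ0 : ∀ r, φ r 0 = 0 := fun r => by simp [φ, h0]
  have hφ1 : ∀ r, φ r 1 = 1 := fun r => by simp [φ, h1]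
  have hφm : ∀ r : ℝ, 0 ≤ r → r < 1 → StrictMono (φ r) := by
    intro r hr hr1 s t hst
    have h2 : r * l s ≤ r * l t := mul_le_mul_of_nonneg_left (hm hst.le) hr
    have h3 : (1 - r) * s < (1 - r) * t := mul_lt_mul_of_pos_left hst (by linarith)
    simp only [φ]; linarith
  let G : C(unitInterval × unitInterval, Disc) :=
    ⟨fun p => polar p.1 (φ p.1 p.2), continuous_polar.comp
      (continuous_fst.prodMk (by fun_prop))⟩
  -- Two angles in `[0, 1]` give the same direction only if they are equal or the two end points.
  have key : ∀ (r : unitInterval) (s t : unitInterval) (m : ℤ), (s : ℝ) = t + m →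
      polar r (φ r s) = polar r (φ r t) := by
    intro r s t m hm'
    have hs0 := s.2.1; have hs1 := s.2.2; have ht0 := t.2.1; have ht1 := t.2.2
    have hm1 : m ≤ 1 := by exact_mod_cast (show (m : ℝ) ≤ 1 by linarith)
    have hm2 : -1 ≤ m := by exact_mod_cast (show (-1 : ℝ) ≤ m by linarith)
    have : m = -1 ∨ m = 0 ∨ m = 1 := by omega
    rcases this with rfl | rfl | rfl
    · have hs : (s : ℝ) = 0 := by push_cast at hm'; linarith
      have ht : (t : ℝ) = 1 := by push_cast at hm'; linarith
      rw [hs, ht, hφ0, hφ1]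
      exact polar_eq_iff.2 ⟨rfl, Or.inr ⟨-1, by norm_num⟩⟩
    · rw [hm']; simp
    · have hs : (s : ℝ) = 1 := by push_cast at hm'; linarith
      have ht : (t : ℝ) = 0 := by push_cast at hm'; linarith
      rw [hs, ht, hφ0, hφ1]
      exact polar_eq_iff.2 ⟨rfl, Or.inr ⟨1, by norm_num⟩⟩
  have hfac : Function.FactorsThrough G
      (ContinuousMap.mk _ isQuotientMap_polar.continuous) := by
    rintro ⟨r, s⟩ ⟨r', t⟩ h
    obtain ⟨hr, h⟩ := polar_eq_iff.1 h
    change r = r' at hr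
    change r = 0 ∨ _ at h
    subst hr
    change polar r _ = polar r _
    rcases h with h | ⟨m, hm'⟩
    · exact polar_eq_iff.2 ⟨rfl, Or.inl h⟩
    · exact key r s t m hm'
  have hq : IsQuotientMap (ContinuousMap.mk _ isQuotientMap_polar.continuous) :=
    isQuotientMap_polar
  let h := hq.lift G hfac
  have hh : ∀ (r t : unitInterval), h (polar r t) = polar r (φ r t) := fun r t =>
    congrArg (fun f => f (r, t)) (hq.lift_comp G hfac)
  have hn : ∀ z, ‖(h z : ℂ)‖ = ‖(z : ℂ)‖ := by
    intro z
    obtain ⟨r, t, ht0, ht1, rfl⟩ := exists_polar z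
    have := hh r ⟨t, ht0, ht1.le⟩
    dsimp only at this
    rw [this, norm_polar, norm_polar]
  refine ⟨h, h.continuous, hn, ?_, ?_, ?_⟩
  · intro z w hz hzw
    obtain ⟨r, t, ht0, ht1, rfl⟩ := exists_polar z
    obtain ⟨r', t', ht0', ht1', rfl⟩ := exists_polar w
    have e1 := hh r ⟨t, ht0, ht1.le⟩
    have e2 := hh r' ⟨t', ht0', ht1'.le⟩
    dsimp only at e1 e2
    rw [e1, e2] at hzw
    obtain ⟨rfl, hzw⟩ := polar_eq_iff.1 hzw
    rw [norm_polar] at hz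
    rcases hzw with h0 | ⟨m, hm'⟩
    · exact polar_eq_iff.2 ⟨rfl, Or.inl h0⟩
    · have hmono := hφm r r.2.1 hz
      have a1 : 0 ≤ φ r t := by rw [← hφ0 r]; exact hmono.monotone ht0
      have a2 : φ r t < 1 := by rw [← hφ1 r]; exact hmono ht1
      have a3 : 0 ≤ φ r t' := by rw [← hφ0 r]; exact hmono.monotone ht0'
      have a4 : φ r t' < 1 := by rw [← hφ1 r]; exact hmono ht1'
      have b1 : m < 1 := by exact_mod_cast (show (m : ℝ) < 1 by linarith)
      have b2 : -1 < m := by exact_mod_cast (show (-1 : ℝ) < m by linarith)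
      obtain rfl : m = 0 := by omega
      have : t = t' := hmono.injective (by simpa using hm')
      rw [this]
  · intro z
    obtain ⟨r, t, ht0, ht1, rfl⟩ := exists_polar z
    have hcont : ContinuousOn (φ r) (Set.Icc 0 1) := by
      apply Continuous.continuousOn; simp only [φ]; fun_prop
    obtain ⟨s, hs, hst⟩ := intermediate_value_Icc zero_le_one hcont
      (show t ∈ Set.Icc (φ r 0) (φ r 1) by rw [hφ0, hφ1]; exact ⟨ht0, ht1.le⟩)
    exact ⟨polar r s, by rw [← hst]; exact hh r ⟨s, hs⟩⟩
  · intro t ht0 ht1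
    have := hh 1 ⟨t, ht0, ht1⟩
    simpa [φ] using this

end TwoComplex

namespace OneComplex

variable {X : OneComplex.{u}}

@[simp] theorem rev_rev (d : X.Dart) : rev (rev d) = d := by simp [rev]
@[simp] theorem rev_fst (d : X.Dart) : (rev d).1 = d.1 := rfl
@[simp] theorem dsrc_rev (d : X.Dart) : dsrc (rev d) = dtgt d := by
  rcases d with ⟨e, _ | _⟩ <;> simp [rev, dsrc, dtgt]
@[simp] theorem dtgt_rev (d : X.Dart) : dtgt (rev d) = dsrc d := by
  rcases d with ⟨e, _ | _⟩ <;> simp [rev, dsrc, dtgt]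

theorem eq_or_eq_rev_of_fst_eq {d d' : X.Dart} (h : d.1 = d'.1) : d = d' ∨ d = rev d' := by
  rcases d with ⟨e, b⟩
  rcases d' with ⟨e', b'⟩
  obtain rfl : e = e' := h
  cases b <;> cases b' <;> simp [rev]

end OneComplex

namespace TwoComplex

open OneComplex

variable {X : TwoComplex.{u}}

instance len_neZero (c : X.C) : NeZero (X.len c) := ⟨(X.len_pos c).ne'⟩

/-! ### Points of the realization -/

/-- The point with parameter `t` on an oriented edge. -/
def dartPt (d : X.Dart) (t : unitInterval) : X.Realization :=
  edgePt d.1 (if d.2 then t else unitInterval.symm t)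

/-- The point of the closed 2-cell `c` given by a point of the disc. -/
def facePt (c : X.C) (z : Disc) : X.Realization := Quot.mk _ (.inr (.inr ⟨c, z⟩))

/-- The point at parameter `s` on a biinfinite edge path whose sides have length one. -/
noncomputable def readPt (R : ℤ → X.Dart) (s : ℝ) : X.Realization :=
  dartPt (R ⌊s⌋) ⟨Int.fract s, Int.fract_nonneg s, (Int.fract_lt_one s).le⟩

/-- The boundary path of a 2-cell, read periodically. -/
def bdRead (c : X.C) (k : ℤ) : X.Dart := X.att c (k : ZMod (X.len c))

theorem dartPt_zero (d : X.Dart) : dartPt d 0 = vertexPt (dsrc d) := by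
  rcases d with ⟨e, _ | _⟩
  · change edgePt e (unitInterval.symm 0) = vertexPt (X.tgt e)
    rw [unitInterval.symm_zero]
    exact Quot.sound (Glue.tgt (X := X) e)
  · exact Quot.sound (Glue.src (X := X) e)

theorem dartPt_rev (d : X.Dart) (t : unitInterval) :
    dartPt (rev d) t = dartPt d (unitInterval.symm t) := by
  rcases d with ⟨e, _ | _⟩ <;> simp [dartPt, rev]

theorem dartPt_one (d : X.Dart) : dartPt d 1 = vertexPt (dtgt d) := by
  rw [← dsrc_rev, ← dartPt_zero, dartPt_rev, unitInterval.symm_zero]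

theorem readPt_intCast (R : ℤ → X.Dart) (k : ℤ) : readPt R k = vertexPt (dsrc (R k)) := by
  rw [← dartPt_zero]
  simp only [readPt, Int.floor_intCast]
  congr 1
  exact Subtype.ext (Int.fract_intCast k)

theorem readPt_add (R : ℤ → X.Dart) (s : ℝ) (k : ℤ) :
    readPt R (s + k) = readPt (fun j => R (j + k)) s := by
  simp [readPt]

theorem bdRead_add_len (c : X.C) (k m : ℤ) : bdRead c (k + m * X.len c) = bdRead c k := by
  simp [bdRead]

theorem bdRead_chain (c : X.C) (k : ℤ) : dtgt (bdRead c k) = dsrc (bdRead c (k + 1)) := by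
  simpa [bdRead] using X.att_chain c (k : ZMod (X.len c))

theorem bdRead_imm (c : X.C) (k : ℤ) : bdRead c (k + 1) ≠ rev (bdRead c k) := by
  simpa [bdRead] using X.att_imm c (k : ZMod (X.len c))

theorem exists_bdRead_eq (c : X.C) (k : ZMod (X.len c)) : ∃ m : ℤ, bdRead c m = X.att c k :=
  ⟨k.val, by simp [bdRead]⟩

theorem facePt_polar_one (c : X.C) (s : ℝ) :
    facePt c (polar 1 (s / X.len c)) = readPt (bdRead c) s := by
  have hn : (X.len c : ℝ) ≠ 0 := by exact_mod_cast (X.len_pos c).ne'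
  let k : ZMod (X.len c) := (⌊s⌋ : ℤ)
  have hk : (k.val : ℤ) = ⌊s⌋ % X.len c := ZMod.val_intCast _
  have h := Quot.sound (Glue.att (X := X) c k
    ⟨Int.fract s, Int.fract_nonneg s, (Int.fract_lt_one s).le⟩)
  refine Eq.trans ?_ h
  change facePt c _ = facePt c _
  congr 1
  have e : (2 * Real.pi * ((k.val : ℝ) + Int.fract s) / X.len c) =
      2 * Real.pi * (((k.val : ℝ) + Int.fract s) / X.len c) := by ring
  simp only [e]
  rw [← polar_one_eq_discPt]
  refine polar_eq_iff.2 ⟨rfl, Or.inr ⟨⌊s⌋ / X.len c, ?_⟩⟩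
  have h1 : (k.val : ℝ) = ⌊s⌋ - X.len c * (⌊s⌋ / (X.len c : ℤ) : ℤ) := by
    have := Int.emod_def ⌊s⌋ (X.len c)
    rw [← hk] at this
    exact_mod_cast this
  have h2 := Int.floor_add_fract s
  rw [h1]
  field_simp
  linarith

/-! ### Normal forms -/

/-- The points of the realization, each written in a unique way: as a vertex, a point of an open
edge or a point of an open disc. -/
abbrev NormalForm (X : TwoComplex.{u}) : Type u := X.V ⊕ (X.E × unitInterval) ⊕ (X.C × Disc)

open scoped Classical in
/-- The normal form of the point at parameter `t` of the edge `e`. -/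
noncomputable def nfEdge (e : X.E) (t : unitInterval) : X.NormalForm :=
  if t = 0 then .inl (X.src e) else if t = 1 then .inl (X.tgt e) else .inr (.inl (e, t))

/-- The normal form of `dartPt d t`. -/
noncomputable def nfDart (d : X.Dart) (t : unitInterval) : X.NormalForm :=
  nfEdge d.1 (if d.2 then t else unitInterval.symm t)

/-- The normal form of `readPt R s`. -/
noncomputable def nfRead (R : ℤ → X.Dart) (s : ℝ) : X.NormalForm :=
  nfDart (R ⌊s⌋) ⟨Int.fract s, Int.fract_nonneg s, (Int.fract_lt_one s).le⟩

theorem nfDart_zero (d : X.Dart) : nfDart d 0 = .inl (dsrc d) := by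
  rcases d with ⟨e, _ | _⟩ <;> simp [nfDart, nfEdge, dsrc]

theorem nfDart_one (d : X.Dart) : nfDart d 1 = .inl (dtgt d) := by
  rcases d with ⟨e, _ | _⟩ <;> simp [nfDart, nfEdge, dtgt]

theorem nfDart_of_ne {d : X.Dart} {t : unitInterval} (h0 : t ≠ 0) (h1 : t ≠ 1) :
    nfDart d t = .inr (.inl (d.1, if d.2 then t else unitInterval.symm t)) := by
  rcases d with ⟨e, _ | _⟩ <;> simp [nfDart, nfEdge, h0, h1]

theorem nfRead_add (R : ℤ → X.Dart) (s : ℝ) (k : ℤ) :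
    nfRead R (s + k) = nfRead (fun j => R (j + k)) s := by
  simp [nfRead]

theorem nfRead_bdRead_periodic (c : X.C) (t : ℝ) (m : ℤ) :
    nfRead (bdRead c) (X.len c * (t + m)) = nfRead (bdRead c) (X.len c * t) := by
  have : (X.len c : ℝ) * (t + m) = X.len c * t + ((m * X.len c : ℤ) : ℝ) := by push_cast; ring
  rw [this, nfRead_add]
  simp only [bdRead_add_len]

theorem nfRead_ne_face (R : ℤ → X.Dart) (s : ℝ) (p : X.C × Disc) :
    nfRead R s ≠ .inr (.inr p) := by
  unfold nfRead nfDart nfEdge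
  split_ifs <;> simp

/-- The direction, as a fraction of a full turn, of a point of the disc; an arbitrary direction at
the centre. -/
noncomputable def turn (z : Disc) : ℝ := (exists_polar z).choose_spec.choose

theorem polar_turn {z : Disc} (hz : ‖(z : ℂ)‖ = 1) : polar 1 (turn z) = z := by
  have key : ∀ (r : unitInterval) (t : ℝ), polar r t = z → polar 1 t = z := by
    intro r t h
    have h1 : r = 1 := by
      apply Subtype.ext
      have := congrArg (fun w : Disc => ‖(w : ℂ)‖) h
      simp only [norm_polar, hz] at this
      exact this
    rwa [h1] at h
  exact key _ _ (exists_polar z).choose_spec.choose_spec.2.2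

open scoped Classical in
/-- The normal form of `facePt c z`. On the boundary circle, where `‖z‖ = 1`, it is computed from
the attaching path. -/
noncomputable def nfFace (c : X.C) (z : Disc) : X.NormalForm :=
  if ‖(z : ℂ)‖ < 1 then .inr (.inr (c, z)) else nfRead (bdRead c) (X.len c * turn z)

theorem nfFace_of_lt (c : X.C) {z : Disc} (h : ‖(z : ℂ)‖ < 1) :
    nfFace c z = .inr (.inr (c, z)) := by simp [nfFace, h]

theorem nfFace_polar_one (c : X.C) (t : ℝ) :
    nfFace c (polar 1 t) = nfRead (bdRead c) (X.len c * t) := by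
  have h1 : ‖(polar 1 t : ℂ)‖ = 1 := by rw [norm_polar]; rfl
  rw [nfFace, if_neg (by rw [h1]; norm_num)]
  obtain ⟨-, h | ⟨m, hm⟩⟩ := polar_eq_iff.1 (polar_turn h1)
  · exact absurd h one_ne_zero
  · rw [hm, nfRead_bdRead_periodic]

/-- The normal form as a function on the disjoint union of the cells. -/
noncomputable def preNf : X.PreRealization → X.NormalForm
  | .inl v => .inl v.1
  | .inr (.inl p) => nfEdge p.1 p.2
  | .inr (.inr p) => nfFace p.1 p.2

theorem preNf_glue (a b : X.PreRealization) (h : X.Glue a b) : preNf a = preNf b := by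
  rcases h with e | e | ⟨c, k, t⟩
  · simp [preNf, nfEdge]
  · simp [preNf, nfEdge]
  · have hn : (X.len c : ℝ) ≠ 0 := by exact_mod_cast (X.len_pos c).ne'
    change nfFace c _ = nfDart (X.att c k) t
    have e : (2 * Real.pi * ((k.val : ℝ) + t) / X.len c) =
      2 * Real.pi * (((k.val : ℝ) + t) / X.len c) := by ring
    rw [e, ← polar_one_eq_discPt, nfFace_polar_one, mul_div_cancel₀ _ hn]
    rcases eq_or_ne t 1 with rfl | ht
    · rw [nfDart_one]
      have : (k.val : ℝ) + ((1 : unitInterval) : ℝ) = 0 + ((k.val + 1 : ℤ) : ℝ) := by simp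
      rw [this, nfRead_add, nfRead]
      have : (⟨Int.fract (0 : ℝ), Int.fract_nonneg _, (Int.fract_lt_one _).le⟩ : unitInterval) = 0 :=
        Subtype.ext (by simp)
      rw [this, nfDart_zero, X.att_chain]
      simp [bdRead]
    · have ht1 : (t : ℝ) < 1 := lt_of_le_of_ne t.2.2 fun h => ht (Subtype.ext h)
      have : (k.val : ℝ) + (t : ℝ) = t + ((k.val : ℤ) : ℝ) := by push_cast; ring
      rw [this, nfRead_add, nfRead]
      have h0 : ⌊(t : ℝ)⌋ = 0 := Int.floor_eq_zero_iff.2 ⟨t.2.1, ht1⟩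
      have h1 : (⟨Int.fract (t : ℝ), Int.fract_nonneg _, (Int.fract_lt_one _).le⟩ : unitInterval) =
        t := Subtype.ext (Int.fract_eq_self.2 ⟨t.2.1, ht1⟩)
      rw [h1, h0]
      simp [bdRead]

/-- The normal form of a point of the realization. -/
noncomputable def nf : X.Realization → X.NormalForm := Quot.lift preNf preNf_glue

theorem nf_edgePt (e : X.E) (t : unitInterval) : nf (edgePt e t) = nfEdge e t := rfl
theorem nf_facePt (c : X.C) (z : Disc) : nf (facePt c z) = nfFace c z := rfl

/-- Interior points of the discs are not identified with any other points. -/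
theorem facePt_eq_facePt {c c' : X.C} {z z' : Disc} (hz : ‖(z : ℂ)‖ < 1)
    (h : facePt c z = facePt c' z') : c = c' ∧ z = z' := by
  have h := congrArg nf h
  rw [nf_facePt, nf_facePt, nfFace_of_lt c hz] at h
  by_cases hz' : ‖(z' : ℂ)‖ < 1
  · rw [nfFace_of_lt c' hz'] at h
    simpa using h
  · rw [nfFace, if_neg hz'] at h
    exact absurd h.symm (nfRead_ne_face _ _ _)

theorem nfDart_eq_nfDart {d d' : X.Dart} {a b : unitInterval} (ha : a ≠ 1) (hb : b ≠ 1)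
    (h : nfDart d a = nfDart d' b) :
    (a = 0 ∧ b = 0 ∧ dsrc d = dsrc d') ∨
    (a ≠ 0 ∧ b ≠ 0 ∧ ((d = d' ∧ (a : ℝ) = b) ∨ (d = rev d' ∧ (a : ℝ) = 1 - b))) := by
  by_cases ha0 : a = 0 <;> by_cases hb0 : b = 0
  · subst ha0 hb0
    rw [nfDart_zero, nfDart_zero] at h
    exact Or.inl ⟨rfl, rfl, Sum.inl_injective h⟩
  · rw [ha0, nfDart_zero, nfDart_of_ne hb0 hb] at h
    simp at h
  · rw [hb0, nfDart_zero, nfDart_of_ne ha0 ha] at h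
    simp at h
  · rw [nfDart_of_ne ha0 ha, nfDart_of_ne hb0 hb] at h
    refine Or.inr ⟨ha0, hb0, ?_⟩
    rcases d with ⟨e, _ | _⟩ <;> rcases d' with ⟨e', _ | _⟩ <;>
      simp [unitInterval.symm, rev, Subtype.ext_iff] at h ⊢
    · exact h
    · exact ⟨h.1, by linarith⟩
    · exact h
    · exact h

/-- Points on two edge paths coincide only for a trivial reason: they are the same vertex, or the
same interior point of an edge, which the two paths traverse in the same or in opposite senses. -/
theorem readPt_eq_readPt {R R' : ℤ → X.Dart} {s s' : ℝ} (h : readPt R s = readPt R' s') :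
    (Int.fract s = 0 ∧ Int.fract s' = 0 ∧ dsrc (R ⌊s⌋) = dsrc (R' ⌊s'⌋)) ∨
    (Int.fract s ≠ 0 ∧ Int.fract s' ≠ 0 ∧
      ((R ⌊s⌋ = R' ⌊s'⌋ ∧ Int.fract s = Int.fract s') ∨
        (R ⌊s⌋ = rev (R' ⌊s'⌋) ∧ Int.fract s = 1 - Int.fract s'))) := by
  have h := nfDart_eq_nfDart (fun e => (Int.fract_lt_one s).ne (congrArg Subtype.val e))
    (fun e => (Int.fract_lt_one s').ne (congrArg Subtype.val e)) (congrArg nf h)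
  simp only [Subtype.ext_iff, ne_eq] at h ⊢
  exact h

/-! ### The realization as a quotient of the disjoint union of its discs -/

/-- The complex is covered by its closed 2-cells. -/
structure FaceCovered (X : TwoComplex.{u}) : Prop where
  vert : ∀ v : X.V, ∃ c k, dsrc (bdRead c k) = v
  edge : ∀ e : X.E, ∃ c k, (bdRead c k).1 = e

theorem continuous_facePt (c : X.C) : Continuous (facePt c) :=
  continuous_quot_mk.comp (continuous_inr.comp (continuous_inr.comp continuous_sigmaMk))

/-- The vertices and the edges may be left out of the construction of the realization because each
edge is, up to a continuous parametrization, an arc on the boundary of one of the discs. -/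
theorem isQuotientMap_facePt (hX : X.FaceCovered) :
    IsQuotientMap fun p : Σ _ : X.C, Disc => facePt p.1 p.2 := by
  have hcont : Continuous fun p : Σ _ : X.C, Disc => facePt p.1 p.2 :=
    continuous_quot_mk.comp (continuous_inr.comp continuous_inr)
  have hedge : ∀ (e : X.E), ∃ (c : X.C) (γ : unitInterval → Disc), Continuous γ ∧
      ∀ t, facePt c (γ t) = edgePt e t := by
    intro e
    obtain ⟨c, k, hk⟩ := hX.edge e
    have hn : (X.len c : ℝ) ≠ 0 := by exact_mod_cast (X.len_pos c).ne'
    have key : ∀ t : unitInterval,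
        facePt c (polar 1 ((k + t) / X.len c)) = dartPt (bdRead c k) t := by
      intro t
      rw [facePt_polar_one]
      rcases eq_or_ne t 1 with rfl | ht
      · have : (k : ℝ) + ((1 : unitInterval) : ℝ) = ((k + 1 : ℤ) : ℝ) := by simp
        rw [this, readPt_intCast, ← bdRead_chain, dartPt_one]
      · have ht1 : (t : ℝ) < 1 := lt_of_le_of_ne t.2.2 fun h => ht (Subtype.ext h)
        have : (k : ℝ) + t = t + k := add_comm _ _
        rw [this, readPt_add, readPt]
        have h0 : ⌊(t : ℝ)⌋ = 0 := Int.floor_eq_zero_iff.2 ⟨t.2.1, ht1⟩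
        have h1 : (⟨Int.fract (t : ℝ), Int.fract_nonneg _, (Int.fract_lt_one _).le⟩ :
          unitInterval) = t := Subtype.ext (Int.fract_eq_self.2 ⟨t.2.1, ht1⟩)
        rw [h1, h0, zero_add]
    have hc : Continuous fun t : unitInterval => polar 1 (((k : ℝ) + t) / X.len c) :=
      continuous_polar.comp (continuous_const.prodMk (by fun_prop))
    cases hb : (bdRead c k).2
    · refine ⟨c, fun t => polar 1 ((k + unitInterval.symm t) / X.len c),
        hc.comp unitInterval.continuous_symm, fun t => ?_⟩
      rw [key, dartPt, hk, hb]; simp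
    · refine ⟨c, _, hc, fun t => ?_⟩
      rw [key, dartPt, hk, hb]; simp
  refine (isQuotientMap_iff _).2 (And.symm ⟨?_, isCoinducing_iff.2 fun s =>
    ⟨fun hs => ?_, fun hs => hs.preimage hcont⟩⟩)
  · intro x
    obtain ⟨(⟨v, ⟨⟩⟩ | ⟨e, t⟩ | ⟨c, z⟩), rfl⟩ := Quot.exists_rep x
    · obtain ⟨c, k, hk⟩ := hX.vert v
      refine ⟨⟨c, polar 1 (k / X.len c)⟩, ?_⟩
      change facePt c _ = vertexPt v
      rw [facePt_polar_one, readPt_intCast, hk]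
    · obtain ⟨c, γ, -, hγ⟩ := hedge e
      exact ⟨⟨c, γ t⟩, hγ t⟩
    · exact ⟨⟨c, z⟩, rfl⟩
  · rw [isOpen_sigma_iff] at hs
    refine isOpen_coinduced.2 ?_
    refine isOpen_sum_iff.2 ⟨?_, isOpen_sum_iff.2 ⟨?_, ?_⟩⟩
    · exact isOpen_discrete _
    · refine isOpen_sigma_iff.2 fun e => ?_
      obtain ⟨c, γ, hγc, hγ⟩ := hedge e
      convert! (hs c).preimage hγc using 1
      ext t
      change edgePt e t ∈ s ↔ facePt c (γ t) ∈ s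
      rw [hγ]
    · refine isOpen_sigma_iff.2 fun c => ?_
      exact hs c

/-! ### Neighbourhoods of the closed 2-cells -/

/-- The 2-cells whose boundary contains the vertex `v`. -/
def facesV (v : X.V) : Set X.C := {F | Cell.vert v ∈ closedCell F}

/-- The 2-cells whose boundary contains the edge `e`. -/
def facesE (e : X.E) : Set X.C := {F | Cell.edge e ∈ closedCell F}

theorem mem_facesV {v : X.V} {F : X.C} : F ∈ facesV v ↔ ∃ k : ℤ, dsrc (bdRead F k) = v := by
  simp only [facesV, closedCell, bdry, Set.mem_ofPred_eq, Set.mem_insert_iff, reduceCtorEq, false_or,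
    Cell.vert.injEq, or_false]
  constructor
  · rintro ⟨k, rfl⟩
    obtain ⟨m, hm⟩ := exists_bdRead_eq F k
    exact ⟨m, by rw [hm]⟩
  · rintro ⟨m, rfl⟩
    exact ⟨_, rfl⟩

theorem mem_facesE {e : X.E} {F : X.C} : F ∈ facesE e ↔ ∃ k : ℤ, (bdRead F k).1 = e := by
  simp only [facesE, closedCell, bdry, Set.mem_ofPred_eq, Set.mem_insert_iff, reduceCtorEq, false_or,
    Cell.edge.injEq]
  constructor
  · rintro ⟨k, rfl⟩
    obtain ⟨m, hm⟩ := exists_bdRead_eq F k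
    exact ⟨m, by rw [hm]⟩
  · rintro ⟨m, rfl⟩
    exact ⟨_, rfl⟩

theorem mem_facesE_of_reads (F : X.C) (k : ℤ) : F ∈ facesE (bdRead F k).1 := mem_facesE.2 ⟨k, rfl⟩

theorem mem_facesV_of_reads (F : X.C) (k : ℤ) : F ∈ facesV (dsrc (bdRead F k)) :=
  mem_facesV.2 ⟨k, rfl⟩

theorem facesE_subset_dsrc (d : X.Dart) : facesE d.1 ⊆ facesV (dsrc d) := by
  intro F hF
  obtain ⟨k, hk⟩ := mem_facesE.1 hF
  rcases eq_or_eq_rev_of_fst_eq hk with h | h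
  · exact mem_facesV.2 ⟨k, by rw [h]⟩
  · exact mem_facesV.2 ⟨k + 1, by rw [← bdRead_chain, h, dtgt_rev]⟩

theorem facesE_subset_dtgt (d : X.Dart) : facesE d.1 ⊆ facesV (dtgt d) := by
  have := facesE_subset_dsrc (rev d)
  rwa [dsrc_rev] at this

/-- A point of the 1-skeleton is at distance less than one half from the 2-cell `F`, where edges
have length one. -/
def NearSkeleton (F : X.C) : X.NormalForm → Prop
  | .inl v => F ∈ facesV v
  | .inr (.inl p) => F ∈ facesE p.1 ∨ ((p.2 : ℝ) < 1 / 2 ∧ F ∈ facesV (X.src p.1)) ∨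
      (1 / 2 < (p.2 : ℝ) ∧ F ∈ facesV (X.tgt p.1))
  | .inr (.inr _) => False

/-- An open neighbourhood of the closed 2-cell `F`. In another 2-cell it consists of the points at
distance more than one half from the centre whose radial projection to the boundary is near `F`. -/
def nbhd (F : X.C) : Set X.Realization :=
  {x | NearSkeleton F (nf x) ∨ ∃ c z, nf x = .inr (.inr (c, z)) ∧
    (c = F ∨ ∃ (r : unitInterval) (t : ℝ), 1 / 2 < (r : ℝ) ∧ z = polar r t ∧
      NearSkeleton F (nfRead (bdRead c) (X.len c * t)))}

theorem nearSkeleton_nfEdge {F : X.C} {e : X.E} {t : unitInterval} :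
    NearSkeleton F (nfEdge e t) ↔ F ∈ facesE e ∨ ((t : ℝ) < 1 / 2 ∧ F ∈ facesV (X.src e)) ∨
      (1 / 2 < (t : ℝ) ∧ F ∈ facesV (X.tgt e)) := by
  have h1 : facesE e ⊆ facesV (X.src e) := facesE_subset_dsrc (e, true)
  have h2 : facesE e ⊆ facesV (X.tgt e) := facesE_subset_dtgt (e, true)
  unfold nfEdge
  split_ifs with h h'
  · subst h
    simp only [NearSkeleton, Set.Icc.coe_zero]
    have a : (0 : ℝ) < 1 / 2 := by norm_num
    have b : ¬ ((1 : ℝ) / 2 < 0) := by norm_num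
    simp only [a, b, true_and, false_and, or_false]
    exact ⟨Or.inr, fun h => h.elim (fun h => h1 h) id⟩
  · subst h'
    simp only [NearSkeleton, Set.Icc.coe_one]
    have a : ¬ (1 : ℝ) < 1 / 2 := by norm_num
    have b : ((1 : ℝ) / 2 < 1) := by norm_num
    simp only [a, b, true_and, false_and, false_or]
    exact ⟨Or.inr, fun h => h.elim (fun h => h2 h) id⟩
  · rfl

theorem nearSkeleton_nfDart {F : X.C} {d : X.Dart} {t : unitInterval} :
    NearSkeleton F (nfDart d t) ↔ F ∈ facesE d.1 ∨ ((t : ℝ) < 1 / 2 ∧ F ∈ facesV (dsrc d)) ∨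
      (1 / 2 < (t : ℝ) ∧ F ∈ facesV (dtgt d)) := by
  rw [nfDart, nearSkeleton_nfEdge]
  rcases d with ⟨e, _ | _⟩
  · have a : (1 - (t : ℝ) < 1 / 2) ↔ 1 / 2 < (t : ℝ) := by constructor <;> intro <;> linarith
    have b : (1 / 2 < 1 - (t : ℝ)) ↔ (t : ℝ) < 1 / 2 := by constructor <;> intro <;> linarith
    simp only [dsrc, dtgt, unitInterval.coe_symm_eq, Bool.false_eq_true, if_false, a, b]
    tauto
  · simp only [dsrc, dtgt, if_true]

/-- Along an edge path, the set of points near `F` is a union of open intervals: those of radius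
one half around the vertices of `F`, and those of radius one around the midpoints of the edges of
`F`. -/
theorem nearSkeleton_nfRead {F : X.C} {R : ℤ → X.Dart}
    (hR : ∀ k, dtgt (R k) = dsrc (R (k + 1))) {s : ℝ} :
    NearSkeleton F (nfRead R s) ↔ (∃ k : ℤ, F ∈ facesV (dsrc (R k)) ∧ |s - k| < 1 / 2) ∨
      ∃ k : ℤ, F ∈ facesE (R k).1 ∧ |s - (k + 1 / 2)| < 1 := by
  rw [nfRead, nearSkeleton_nfDart]
  have hfl := Int.floor_add_fract s
  have h0 := Int.fract_nonneg s
  have h1 := Int.fract_lt_one s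
  change _ ∨ (Int.fract s < 1 / 2 ∧ _) ∨ (1 / 2 < Int.fract s ∧ _) ↔ _
  constructor
  · rintro (h | ⟨ht, h⟩ | ⟨ht, h⟩)
    · refine Or.inr ⟨⌊s⌋, h, ?_⟩
      rw [abs_lt]; constructor <;> linarith
    · refine Or.inl ⟨⌊s⌋, h, ?_⟩
      rw [abs_lt]; constructor <;> linarith
    · refine Or.inl ⟨⌊s⌋ + 1, by rwa [← hR], ?_⟩
      push_cast
      rw [abs_lt]; constructor <;> linarith
  · rintro (⟨k, h, hk⟩ | ⟨k, h, hk⟩)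
    · rw [abs_lt] at hk
      have a : k < ⌊s⌋ + 2 := by
        have : (k : ℝ) < (⌊s⌋ + 2 : ℤ) := by push_cast; linarith
        exact_mod_cast this
      have b : ⌊s⌋ < k + 1 := by
        have : (⌊s⌋ : ℝ) < (k + 1 : ℤ) := by push_cast; linarith
        exact_mod_cast this
      obtain rfl | rfl : k = ⌊s⌋ ∨ k = ⌊s⌋ + 1 := by omega
      · exact Or.inr (Or.inl ⟨by linarith, h⟩)
      · refine Or.inr (Or.inr ⟨?_, by rwa [hR]⟩)
        push_cast at hk; linarith
    · rw [abs_lt] at hk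
      have a : k < ⌊s⌋ + 2 := by
        have : (k : ℝ) < (⌊s⌋ + 2 : ℤ) := by push_cast; linarith
        exact_mod_cast this
      have b : ⌊s⌋ < k + 2 := by
        have : (⌊s⌋ : ℝ) < (k + 2 : ℤ) := by push_cast; linarith
        exact_mod_cast this
      obtain rfl | hk' | rfl : k = ⌊s⌋ ∨ ⌊s⌋ = k + 1 ∨ k = ⌊s⌋ + 1 := by omega
      · exact Or.inl h
      · refine Or.inr (Or.inl ⟨?_, ?_⟩)
        · rw [hk'] at hfl; push_cast at hfl; linarith
        · rw [hk', ← hR]; exact facesE_subset_dtgt _ h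
      · refine Or.inr (Or.inr ⟨?_, ?_⟩)
        · push_cast at hk; linarith
        · rw [hR]; exact facesE_subset_dsrc _ h

theorem isOpen_nearSkeleton_nfRead (F : X.C) {R : ℤ → X.Dart}
    (hR : ∀ k, dtgt (R k) = dsrc (R (k + 1))) : IsOpen {s : ℝ | NearSkeleton F (nfRead R s)} := by
  simp only [nearSkeleton_nfRead hR]
  have : {s : ℝ | (∃ k : ℤ, F ∈ facesV (dsrc (R k)) ∧ |s - k| < 1 / 2) ∨
      ∃ k : ℤ, F ∈ facesE (R k).1 ∧ |s - (k + 1 / 2)| < 1} =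
      (⋃ k ∈ {k : ℤ | F ∈ facesV (dsrc (R k))}, {s : ℝ | |s - k| < 1 / 2}) ∪
      ⋃ k ∈ {k : ℤ | F ∈ facesE (R k).1}, {s : ℝ | |s - (k + 1 / 2)| < 1} := by
    ext s; simp
  rw [this]
  refine IsOpen.union (isOpen_biUnion fun k _ => ?_) (isOpen_biUnion fun k _ => ?_)
  · exact isOpen_lt (by fun_prop) continuous_const
  · exact isOpen_lt (by fun_prop) continuous_const

theorem nearSkeleton_self (F : X.C) (s : ℝ) : NearSkeleton F (nfRead (bdRead F) s) :=
  nearSkeleton_nfDart.2 (Or.inl (mem_facesE_of_reads _ _))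

theorem facePt_polar_mem_nbhd {F c : X.C} {r : unitInterval} {t : ℝ} :
    facePt c (polar r t) ∈ nbhd F ↔ c = F ∨ (1 / 2 < (r : ℝ) ∧
      NearSkeleton F (nfRead (bdRead c) (X.len c * t))) := by
  by_cases hr : (r : ℝ) < 1
  · have h : nf (facePt c (polar r t)) = .inr (.inr (c, polar r t)) := by
      rw [nf_facePt, nfFace_of_lt]; rwa [norm_polar]
    simp only [nbhd, Set.mem_ofPred_eq, h, NearSkeleton, false_or, Sum.inr.injEq, Prod.mk.injEq]
    constructor
    · rintro ⟨c', z, ⟨rfl, rfl⟩, h | ⟨r', t', hr', hz, hn⟩⟩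
      · exact Or.inl h
      · obtain ⟨rfl, h0 | ⟨m, rfl⟩⟩ := polar_eq_iff.1 hz
        · rw [h0] at hr'; norm_num at hr'
        · rw [nfRead_bdRead_periodic]
          exact Or.inr ⟨hr', hn⟩
    · rintro (h | ⟨h1, h2⟩)
      · exact ⟨c, _, ⟨rfl, rfl⟩, Or.inl h⟩
      · exact ⟨c, _, ⟨rfl, rfl⟩, Or.inr ⟨r, t, h1, rfl, h2⟩⟩
  · obtain rfl : r = 1 := Subtype.ext (le_antisymm r.2.2 (not_lt.1 hr))
    have h : nf (facePt c (polar 1 t)) = nfRead (bdRead c) (X.len c * t) := by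
      rw [nf_facePt, nfFace_polar_one]
    simp only [nbhd, Set.mem_ofPred_eq, h]
    constructor
    · rintro (h | ⟨c', z, hz, -⟩)
      · exact Or.inr ⟨by norm_num, h⟩
      · exact absurd hz (nfRead_ne_face _ _ _)
    · rintro (rfl | ⟨-, h⟩)
      · exact Or.inl (nearSkeleton_self _ _)
      · exact Or.inl h

theorem isOpen_nbhd (F : X.C) : IsOpen (nbhd F) := by
  refine isOpen_coinduced.2 (isOpen_sum_iff.2 ⟨isOpen_discrete _, isOpen_sum_iff.2
    ⟨isOpen_sigma_iff.2 fun e => ?_, isOpen_sigma_iff.2 fun c => ?_⟩⟩)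
  · have h : ∀ t : unitInterval, edgePt e t ∈ nbhd F ↔ NearSkeleton F (nfEdge e t) := by
      intro t
      simp only [nbhd, Set.mem_ofPred_eq, nf_edgePt]
      refine or_iff_left ?_
      rintro ⟨c, z, h, -⟩
      unfold nfEdge at h
      split_ifs at h
      simp at h
    change IsOpen {t : unitInterval | edgePt e t ∈ nbhd F}
    simp only [h, nearSkeleton_nfEdge]
    refine isOpen_const.union (IsOpen.union (IsOpen.and ?_ isOpen_const)
      (IsOpen.and ?_ isOpen_const))
    · exact isOpen_lt continuous_subtype_val continuous_const
    · exact isOpen_lt continuous_const continuous_subtype_val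
  · change IsOpen {z : Disc | facePt c z ∈ nbhd F}
    rw [← isQuotientMap_polar.isCoinducing.isOpen_preimage]
    change IsOpen {p : unitInterval × unitInterval | facePt c (polar p.1 p.2) ∈ nbhd F}
    simp only [facePt_polar_mem_nbhd]
    refine isOpen_const.union (IsOpen.and ?_ ?_)
    · exact isOpen_lt continuous_const (continuous_subtype_val.comp continuous_fst)
    · refine (isOpen_nearSkeleton_nfRead F (bdRead_chain c)).preimage
        (f := fun p : unitInterval × unitInterval => (X.len c : ℝ) * (p.2 : ℝ)) ?_
      fun_prop

theorem facePt_mem_nbhd (F : X.C) (z : Disc) : facePt F z ∈ nbhd F := by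
  obtain ⟨r, t, -, -, rfl⟩ := exists_polar z
  exact facePt_polar_mem_nbhd.2 (Or.inl rfl)

/-- The 2-cells whose neighbourhoods contain a given point have a common vertex. Unless the point is
close to the centre of a 2-cell, and is in the neighbourhood of this one only, the vertex nearest to
the radial projection of the point will do. -/
theorem exists_common_vertex (hX : X.FaceCovered) (x : X.Realization) :
    ∃ v, ∀ F, x ∈ nbhd F → F ∈ facesV v := by
  obtain ⟨⟨c, z⟩, rfl⟩ := (isQuotientMap_facePt hX).surjective x
  obtain ⟨r, t, -, -, rfl⟩ := exists_polar z
  simp only [facePt_polar_mem_nbhd]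
  generalize hs : (X.len c : ℝ) * t = s
  by_cases hr : 1 / 2 < (r : ℝ)
  swap
  · exact ⟨dsrc (bdRead c 0), fun F hF => by
      obtain rfl := hF.resolve_right fun h => hr h.1
      exact mem_facesV_of_reads _ _⟩
  have key : ∀ F, (c = F ∨ (1 / 2 < (r : ℝ) ∧ NearSkeleton F (nfRead (bdRead c) s))) →
      NearSkeleton F (nfRead (bdRead c) s) := by
    rintro F (rfl | h)
    · exact nearSkeleton_self _ _
    · exact h.2
  by_cases ht : 1 / 2 < Int.fract s
  · refine ⟨dtgt (bdRead c ⌊s⌋), fun F hF => ?_⟩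
    rcases nearSkeleton_nfDart.1 (key F hF) with h | h | h
    · exact facesE_subset_dtgt _ h
    · have := h.1; linarith
    · exact h.2
  · refine ⟨dsrc (bdRead c ⌊s⌋), fun F hF => ?_⟩
    rcases nearSkeleton_nfDart.1 (key F hF) with h | h | h
    · exact facesE_subset_dsrc _ h
    · exact h.2
    · exact absurd h.1 ht

theorem exists_mem_nbhd (hX : X.FaceCovered) (x : X.Realization) : ∃ F, x ∈ nbhd F := by
  obtain ⟨⟨c, z⟩, rfl⟩ := (isQuotientMap_facePt hX).surjective x
  exact ⟨c, facePt_mem_nbhd c z⟩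

/-- A cocycle on the pairs of 2-cells that meet, with the cocycle condition at each vertex, is a
coboundary if the complex is simply connected. -/
theorem exists_face_section [SimplyConnectedSpace X.Realization] (hX : X.FaceCovered)
    {T : X.C → Type*} (g : ∀ F G, T F → T G) (hself : ∀ F t, g F F t = t)
    (hcomp : ∀ (v : X.V) (F G H), F ∈ facesV v → G ∈ facesV v → H ∈ facesV v →
      ∀ t, g G H (g F G t) = g F H t) (F₀ : X.C) (t₀ : T F₀) :
    ∃ s : ∀ F, T F, s F₀ = t₀ ∧ ∀ v F G, F ∈ facesV v → G ∈ facesV v → s G = g F G (s F) := by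
  have : LocallyPathConnectedSpace Disc :=
    (convex_closedBall (0 : ℂ) 1).locallyPathConnectedSpace
  have : LocallyPathConnectedSpace unitInterval :=
    (convex_Icc (0 : ℝ) 1).locallyPathConnectedSpace
  have : LocallyPathConnectedSpace X.Realization := inferInstance
  have : PreconnectedSpace Disc :=
    isPreconnected_iff_preconnectedSpace.1 (convex_closedBall (0 : ℂ) 1).isPreconnected
  obtain ⟨s, h1, h2, h3⟩ := exists_section_of_cocycle (T := T) (U := nbhd) isOpen_nbhd
    (exists_mem_nbhd hX) (fun F => ⟨_, facePt_mem_nbhd F 0⟩) g hself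
    (by
      intro F G H x hF hG hH t
      obtain ⟨v, hv⟩ := exists_common_vertex hX x
      exact hcomp v F G H (hv F hF) (hv G hG) (hv H hH) t) (facePt_mem_nbhd F₀ 0) t₀
  refine ⟨fun F => s F (facePt F 0), h3, ?_⟩
  have hv : ∀ (v : X.V) (F : X.C), F ∈ facesV v → ∃ z, facePt F z = vertexPt v := by
    intro v F hF
    obtain ⟨k, rfl⟩ := mem_facesV.1 hF
    exact ⟨_, (facePt_polar_one F k).trans (readPt_intCast _ _)⟩
  have hs : ∀ F z, s F (facePt F z) = s F (facePt F 0) := by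
    intro F z
    refine h1 F (Set.range (facePt F)) ?_ ?_ _ ⟨z, rfl⟩ _ ⟨0, rfl⟩
    · rintro _ ⟨w, rfl⟩; exact facePt_mem_nbhd F w
    · exact isPreconnected_range (continuous_facePt F)
  intro v F G hF hG
  obtain ⟨z, hz⟩ := hv v F hF
  obtain ⟨w, hw⟩ := hv v G hG
  beta_reduce
  rw [← hs F z, ← hs G w, hw, ← hz]
  refine h2 F G _ (facePt_mem_nbhd F z) ?_
  rw [hz, ← hw]
  exact facePt_mem_nbhd G w

theorem rel_of_common_vertex [PreconnectedSpace X.Realization] (hX : X.FaceCovered)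
    {r : X.C → X.C → Prop} (hr : Equivalence r)
    (hv : ∀ v F G, F ∈ facesV v → G ∈ facesV v → r F G) (F G : X.C) : r F G := by
  refine rel_of_open_cover isOpen_nbhd (exists_mem_nbhd hX) (fun F => ⟨_, facePt_mem_nbhd F 0⟩) hr
    ?_ F G
  rintro F G ⟨x, hF, hG⟩
  obtain ⟨v, h⟩ := exists_common_vertex hX x
  exact hv v F G (h F hF) (h G hG)

theorem faceCovered_of_preconnected [PreconnectedSpace X.Realization] (hne : Nonempty X.C)
    (he : ∀ e : X.E, (facesE e).Nonempty) : X.FaceCovered := by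
  have hedge : ∀ e : X.E, ∃ c k, (bdRead c k).1 = e := fun e => by
    obtain ⟨F, hF⟩ := he e
    obtain ⟨k, hk⟩ := mem_facesE.1 hF
    exact ⟨F, k, hk⟩
  refine ⟨fun v => ?_, hedge⟩
  by_contra hv
  -- The point `v` would be isolated.
  have hno : ∀ d : X.Dart, dsrc d ≠ v := by
    rintro d rfl
    obtain ⟨F, hF⟩ := he d.1
    obtain ⟨k, hk⟩ := mem_facesV.1 (facesE_subset_dsrc d hF)
    exact hv ⟨F, k, hk⟩
  let A : Set X.Realization := {x | nf x = .inl v}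
  have hE : ∀ e t, edgePt e t ∉ A := by
    intro e t h
    change nfEdge e t = _ at h
    unfold nfEdge at h
    split_ifs at h
    · exact hno (e, true) (Sum.inl_injective h)
    · exact hno (e, false) (Sum.inl_injective h)
  have hF : ∀ c z, facePt c z ∉ A := by
    intro c z h
    change nfFace c z = _ at h
    unfold nfFace at h
    split_ifs at h
    exact hE _ _ h
  have hclopen : IsClopen A := by
    constructor
    · refine ⟨isOpen_coinduced.2 (isOpen_sum_iff.2 ⟨isOpen_discrete _, isOpen_sum_iff.2
        ⟨isOpen_sigma_iff.2 fun e => ?_, isOpen_sigma_iff.2 fun c => ?_⟩⟩)⟩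
      · convert! isOpen_univ
        exact Set.eq_univ_of_forall fun t => hE e t
      · convert! isOpen_univ
        exact Set.eq_univ_of_forall fun t => hF c t
    · refine isOpen_coinduced.2 (isOpen_sum_iff.2 ⟨isOpen_discrete _, isOpen_sum_iff.2
        ⟨isOpen_sigma_iff.2 fun e => ?_, isOpen_sigma_iff.2 fun c => ?_⟩⟩)
      · convert! isOpen_empty
        exact Set.eq_empty_of_forall_notMem fun t => hE e t
      · convert! isOpen_empty
        exact Set.eq_empty_of_forall_notMem fun t => hF c t
  have huniv := hclopen.eq_univ ⟨vertexPt v, rfl⟩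
  obtain ⟨c⟩ := hne
  exact hF c 0 (huniv ▸ Set.mem_univ _)

/-! ### Vertices, links and faces -/

/-- A branch vertex: a vertex of valence at least three. -/
def Branch (v : X.V) : Prop := 3 ≤ valence v

theorem corner_eq_cast (c : X.C) (k : ZMod (X.len c)) : ∃ m : ℤ, k = (m : ZMod (X.len c)) :=
  ⟨k.val, by simp⟩

theorem mem_facesV_iff_corner {v : X.V} {G : X.C} :
    G ∈ facesV v ↔ ∃ k, (⟨G, k⟩ : X.Corner) ∈ linkEdges v := by
  rw [mem_facesV]
  constructor
  · rintro ⟨k, hk⟩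
    exact ⟨k, hk⟩
  · rintro ⟨k, hk⟩
    obtain ⟨m, rfl⟩ := corner_eq_cast G k
    exact ⟨m, hk⟩

theorem mem_facesE_iff_corner {d : X.Dart} {G : X.C} :
    G ∈ facesE d.1 ↔
      ∃ k, (⟨G, k⟩ : X.Corner) ∈ linkEdges (dsrc d) ∧ d ∈ cornerEnds (⟨G, k⟩ : X.Corner) := by
  rw [mem_facesE]
  constructor
  · rintro ⟨k, hk⟩
    rcases eq_or_eq_rev_of_fst_eq hk with rfl | h
    · exact ⟨k, rfl, Sym2.mem_mk_right _ _⟩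
    · refine ⟨((k + 1 : ℤ) : ZMod _), ?_, ?_⟩
      · change dsrc (bdRead G (k + 1)) = _
        rw [← bdRead_chain, h, dtgt_rev]
      · have : d = rev (bdRead G k) := by rw [h, rev_rev]
        rw [cornerEnds, Sym2.mem_iff]
        left
        simpa [bdRead] using this
  · rintro ⟨k, hk, hd⟩
    obtain ⟨m, rfl⟩ := corner_eq_cast G k
    rw [cornerEnds, Sym2.mem_iff] at hd
    rcases hd with rfl | rfl
    · exact ⟨m - 1, by simp [bdRead]⟩
    · exact ⟨m, rfl⟩

/-- The star of a vertex whose link is a cycle of length four through corners of `A`, `B`, `C`,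
`D`; the darts `p`, `q`, `r`, `s` are listed so that `p` comes just before `A`. -/
structure Star4 (v : X.V) (A B C D : X.C) (p q r s : X.Dart) : Prop where
  darts : linkVertices v = {p, q, r, s}
  faces : facesV v = {A, B, C, D}
  faces_p : facesE p.1 = {D, A}
  faces_q : facesE q.1 = {A, B}
  faces_r : facesE r.1 = {B, C}
  faces_s : facesE s.1 = {C, D}
  corner_unique : ∀ G k k', dsrc (X.att G k) = v → dsrc (X.att G k') = v → k = k'

/-- The star of a vertex whose link consists of two cycles of length two, through corners of
`A`, `B` and of `C`, `D`, with one common vertex `s`. -/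
structure Star3 (v : X.V) (A B C D : X.C) (s p q : X.Dart) : Prop where
  darts : linkVertices v = {s, p, q}
  faces : facesV v = {A, B, C, D}
  faces_s : facesE s.1 = {A, B, C, D}
  faces_p : facesE p.1 = {A, B}
  faces_q : facesE q.1 = {C, D}
  corner_unique : ∀ G k k', dsrc (X.att G k) = v → dsrc (X.att G k') = v → k = k'

theorem exists_star4 {v : X.V} {A B C D : X.C} (h : LinkIsCycle v ![A, B, C, D])
    (hAB : A ≠ B) (hAC : A ≠ C) (hAD : A ≠ D) (hBC : B ≠ C) (hBD : B ≠ D) (hCD : C ≠ D) :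
    ∃ p q r s, Star4 v A B C D p q r s := by
  obtain ⟨d, x, hc, hd, hx⟩ := h
  have hmem : ∀ G k, (⟨G, k⟩ : X.Corner) ∈ linkEdges v ↔
      ∃ j, x j = ⟨G, k⟩ := fun G k => by rw [← hx]; rfl
  have hcell := hc.cells
  have hE : ∀ j G, G ∈ facesE (d j).1 ↔ ∃ i, ![A, B, C, D] i = G ∧ (d j = d i ∨ d j = d (i + 1)) := by
    intro j G
    rw [mem_facesE_iff_corner, show dsrc (d j) = v from hc.vertices_mem j]
    constructor
    · rintro ⟨k, hk, hjk⟩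
      obtain ⟨i, hi⟩ := (hmem G k).1 hk
      rw [← hi, hc.ends, Sym2.mem_iff] at hjk
      exact ⟨i, by rw [← hcell, hi], hjk⟩
    · rintro ⟨i, rfl, hi⟩
      rw [← hcell]
      exact ⟨(x i).2, hc.edges_mem i, by
        change d j ∈ cornerEnds (x i)
        rw [hc.ends, Sym2.mem_iff]; exact hi⟩
  have hE' : ∀ j G, G ∈ facesE (d j).1 ↔ ∃ i, ![A, B, C, D] i = G ∧ (j = i ∨ j = i + 1) := by
    intro j G
    rw [hE]
    simp only [hc.vertices_inj.eq_iff]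
  refine ⟨d 0, d 1, d 2, d 3, ?_, ?_, ?_, ?_, ?_, ?_, ?_⟩
  · rw [← hd]
    ext y
    simp only [Set.mem_range, Fin.exists_fin_succ, Set.mem_insert_iff, Set.mem_singleton_iff]
    simp [eq_comm]
  · ext G
    rw [mem_facesV_iff_corner]
    simp only [hmem]
    constructor
    · rintro ⟨k, j, hj⟩
      have : G = ![A, B, C, D] j := by rw [← hcell, hj]
      rw [this]
      fin_cases j <;> simp
    · have : ∀ j, ∃ k i, x i = ⟨![A, B, C, D] j, k⟩ := by
        intro j; rw [← hcell]; exact ⟨(x j).2, j, rfl⟩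
      rintro (rfl | rfl | rfl | rfl)
      exacts [this 0, this 1, this 2, this 3]
  · ext G; rw [hE']; simp [Fin.exists_fin_succ, eq_comm]; tauto
  · ext G; rw [hE']; simp [Fin.exists_fin_succ, eq_comm]
  · ext G; rw [hE']; simp [Fin.exists_fin_succ, eq_comm]
  · ext G; rw [hE']; simp [Fin.exists_fin_succ, eq_comm]
  · intro G k k' hk hk'
    obtain ⟨j, hj⟩ := (hmem G k).1 hk
    obtain ⟨j', hj'⟩ := (hmem G k').1 hk'
    have h1 : ![A, B, C, D] j = ![A, B, C, D] j' := by rw [← hcell, ← hcell, hj, hj']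
    have h2 : j = j' := by
      fin_cases j <;> fin_cases j' <;> simp at h1 <;> first | rfl | (exfalso; tauto)
    subst h2
    rw [hj] at hj'
    simpa using hj'

theorem exists_star3 {v : X.V} {A B C D : X.C} (h : LinkIsTwoBigons v A B C D)
    (hv : valence v = 3)
    (hAB : A ≠ B) (hAC : A ≠ C) (hAD : A ≠ D) (hBC : B ≠ C) (hBD : B ≠ D) (hCD : C ≠ D) :
    ∃ s p q, Star3 v A B C D s p q := by
  obtain ⟨d, x, d', x', hc, hc', hd, hx⟩ := h
  have hmem : ∀ G k, (⟨G, k⟩ : X.Corner) ∈ linkEdges v ↔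
      (∃ j, x j = ⟨G, k⟩) ∨ ∃ j, x' j = ⟨G, k⟩ := fun G k => by rw [← hx]; rfl
  have hends : ∀ j y, y ∈ cornerEnds (x j) ↔ y = d 0 ∨ y = d 1 := by
    intro j y
    rw [hc.ends, Sym2.mem_iff]
    fin_cases j
    · simp
    · simp; tauto
  have hends' : ∀ j y, y ∈ cornerEnds (x' j) ↔ y = d' 0 ∨ y = d' 1 := by
    intro j y
    rw [hc'.ends, Sym2.mem_iff]
    fin_cases j
    · simp
    · simp; tauto
  have hcA : (x 0).1 = A := hc.cells 0
  have hcB : (x 1).1 = B := hc.cells 1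
  have hcC : (x' 0).1 = C := hc'.cells 0
  have hcD : (x' 1).1 = D := hc'.cells 1
  have hL : ∀ y, y ∈ linkVertices v ↔ y = d 0 ∨ y = d 1 ∨ y = d' 0 ∨ y = d' 1 := by
    intro y
    rw [← hd]
    simp only [Set.mem_union, Set.mem_range, Fin.exists_fin_two, eq_comm (a := y), or_assoc]
  have hE : ∀ y, dsrc y = v → ∀ G, G ∈ facesE y.1 ↔
      ((G = A ∨ G = B) ∧ (y = d 0 ∨ y = d 1)) ∨ ((G = C ∨ G = D) ∧ (y = d' 0 ∨ y = d' 1)) := by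
    intro y hy G
    rw [mem_facesE_iff_corner, hy]
    constructor
    · rintro ⟨k, hk, hjk⟩
      rcases (hmem G k).1 hk with ⟨i, hi⟩ | ⟨i, hi⟩
      · left
        rw [← hi, hends] at hjk
        refine ⟨?_, hjk⟩
        rw [← hcA, ← hcB]
        fin_cases i
        · left; exact (congrArg Sigma.fst hi).symm
        · right; exact (congrArg Sigma.fst hi).symm
      · right
        rw [← hi, hends'] at hjk
        refine ⟨?_, hjk⟩
        rw [← hcC, ← hcD]
        fin_cases i
        · left; exact (congrArg Sigma.fst hi).symm
        · right; exact (congrArg Sigma.fst hi).symm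
    · rintro (⟨rfl | rfl, h⟩ | ⟨rfl | rfl, h⟩)
      · rw [← hcA]; exact ⟨(x 0).2, hc.edges_mem 0, (hends 0 y).2 h⟩
      · rw [← hcB]; exact ⟨(x 1).2, hc.edges_mem 1, (hends 1 y).2 h⟩
      · rw [← hcC]; exact ⟨(x' 0).2, hc'.edges_mem 0, (hends' 0 y).2 h⟩
      · rw [← hcD]; exact ⟨(x' 1).2, hc'.edges_mem 1, (hends' 1 y).2 h⟩
  have hV : facesV v = {A, B, C, D} := by
    ext G
    rw [mem_facesV_iff_corner]
    simp only [hmem, Set.mem_insert_iff, Set.mem_singleton_iff]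
    constructor
    · rintro ⟨k, ⟨j, hj⟩ | ⟨j, hj⟩⟩
      · rw [← hcA, ← hcB]
        fin_cases j
        · left; exact (congrArg Sigma.fst hj).symm
        · right; left; exact (congrArg Sigma.fst hj).symm
      · rw [← hcC, ← hcD]
        fin_cases j
        · right; right; left; exact (congrArg Sigma.fst hj).symm
        · right; right; right; exact (congrArg Sigma.fst hj).symm
    · rintro (rfl | rfl | rfl | rfl)
      · rw [← hcA]; exact ⟨(x 0).2, Or.inl ⟨0, rfl⟩⟩
      · rw [← hcB]; exact ⟨(x 1).2, Or.inl ⟨1, rfl⟩⟩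
      · rw [← hcC]; exact ⟨(x' 0).2, Or.inr ⟨0, rfl⟩⟩
      · rw [← hcD]; exact ⟨(x' 1).2, Or.inr ⟨1, rfl⟩⟩
  have hU : ∀ G k k', dsrc (X.att G k) = v → dsrc (X.att G k') = v → k = k' := by
    intro G k k' hk hk'
    have key : ∀ y y' : X.Corner, y ∈ linkEdges v → y' ∈ linkEdges v → y.1 = y'.1 → y = y' := by
      intro y y' hy hy' hyy
      have e : ∀ y ∈ linkEdges v, y = x 0 ∨ y = x 1 ∨ y = x' 0 ∨ y = x' 1 := by
        intro y hy
        rw [← hx] at hy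
        simpa only [Set.mem_union, Set.mem_range, Fin.exists_fin_two, eq_comm (b := y),
          or_assoc] using hy
      rcases e y hy with rfl | rfl | rfl | rfl <;> rcases e y' hy' with rfl | rfl | rfl | rfl <;>
        first
        | rfl
        | (exfalso; simp only [hcA, hcB, hcC, hcD] at hyy; tauto)
    have := key ⟨G, k⟩ ⟨G, k'⟩ hk hk' rfl
    simpa using this
  have h01 : d 0 ≠ d 1 := hc.vertices_inj.ne (by decide)
  have h01' : d' 0 ≠ d' 1 := hc'.vertices_inj.ne (by decide)
  have hv0 : dsrc (d 0) = v := hc.vertices_mem 0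
  have hv1 : dsrc (d 1) = v := hc.vertices_mem 1
  have hv0' : dsrc (d' 0) = v := hc'.vertices_mem 0
  have hv1' : dsrc (d' 1) = v := hc'.vertices_mem 1
  -- The two cycles have exactly one common vertex because there are three vertices in all.
  have main : ∀ s p t q : X.Dart, s ≠ p → t ≠ q → s = t → p ≠ q →
      (∀ y, (y = d 0 ∨ y = d 1) ↔ (y = s ∨ y = p)) →
      (∀ y, (y = d' 0 ∨ y = d' 1) ↔ (y = t ∨ y = q)) → Star3 v A B C D s p q := by
    rintro s p t q hsp hsq rfl hpq h1 h2
    have hs : dsrc s = v := by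
      rcases (h1 s).2 (Or.inl rfl) with h | h <;> rw [h] <;> assumption
    have hp : dsrc p = v := by
      rcases (h1 p).2 (Or.inr rfl) with h | h <;> rw [h] <;> assumption
    have hq : dsrc q = v := by
      rcases (h2 q).2 (Or.inr rfl) with h | h <;> rw [h] <;> assumption
    refine ⟨?_, hV, ?_, ?_, ?_, hU⟩
    · ext y
      rw [hL, ← or_assoc, h1, h2]
      simp only [Set.mem_insert_iff, Set.mem_singleton_iff]
      tauto
    · ext G
      rw [hE s hs, h1, h2]
      simp only [Set.mem_insert_iff, Set.mem_singleton_iff]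
      tauto
    · ext G
      rw [hE p hp, h1, h2]
      simp only [Set.mem_insert_iff, Set.mem_singleton_iff]
      have := hsp.symm
      tauto
    · ext G
      rw [hE q hq, h1, h2]
      simp only [Set.mem_insert_iff, Set.mem_singleton_iff]
      have := hsq.symm
      have := hpq.symm
      tauto
  have hset : linkVertices v = {d 0, d 1, d' 0, d' 1} := by
    ext y; rw [hL]; simp
  have hcard : (linkVertices v).encard = 3 := hv
  have two : ∀ a b : X.Dart, ({a, b} : Set X.Dart).encard ≤ 2 := fun a b =>
    (Set.encard_insert_le _ _).trans (by rw [Set.encard_singleton]; norm_num)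
  have hne3 : ¬ (3 : ℕ∞) ≤ 2 := by decide
  by_cases h00 : d 0 = d' 0
  · by_cases h11 : d 1 = d' 1
    · exfalso
      have : linkVertices v = {d 0, d 1} := by
        rw [hset, ← h00, ← h11]; ext y; simp
      rw [this] at hcard
      exact hne3 (hcard ▸ two _ _)
    · exact ⟨_, _, _, main (d 0) (d 1) (d' 0) (d' 1) h01 h01' h00 h11 (fun _ => Iff.rfl)
        fun _ => Iff.rfl⟩
  · by_cases h11 : d 1 = d' 1
    · exact ⟨_, _, _, main (d 1) (d 0) (d' 1) (d' 0) h01.symm h01'.symm h11 h00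
        (fun _ => or_comm) fun _ => or_comm⟩
    · by_cases h01'' : d 0 = d' 1
      · by_cases h10 : d 1 = d' 0
        · exfalso
          have : linkVertices v = {d 0, d 1} := by
            rw [hset, ← h01'', ← h10]; ext y; simp; tauto
          rw [this] at hcard
          exact hne3 (hcard ▸ two _ _)
        · exact ⟨_, _, _, main (d 0) (d 1) (d' 1) (d' 0) h01 h01'.symm h01'' h10
            (fun _ => Iff.rfl) fun _ => or_comm⟩
      · by_cases h10 : d 1 = d' 0
        · exact ⟨_, _, _, main (d 1) (d 0) (d' 0) (d' 1) h01.symm h01' h10 h01''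
            (fun _ => or_comm) fun _ => Iff.rfl⟩
        · exfalso
          rw [hset, Set.encard_insert_of_notMem (by simp [*]),
            Set.encard_insert_of_notMem (by simp [*]), Set.encard_pair h01'] at hcard
          exact absurd hcard (by decide)

/-! ### Local structure of a quasi-flat complex -/

theorem mem_closedCell_vert {v : X.V} {F : X.C} : Cell.vert v ∈ closedCell F ↔ F ∈ facesV v :=
  Iff.rfl

theorem mem_closedCell_edge {e : X.E} {F : X.C} : Cell.edge e ∈ closedCell F ↔ F ∈ facesE e :=
  Iff.rfl

theorem mem_bdry_vert {v : X.V} {F : X.C} : Cell.vert v ∈ bdry F ↔ F ∈ facesV v := by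
  rw [← mem_closedCell_vert, closedCell, Set.mem_insert_iff]
  simp

theorem exists_common_vertex_of_inter_nonempty {F G : X.C} (hne : G ≠ F)
    (h : (closedCell F ∩ closedCell G).Nonempty) : ∃ v, F ∈ facesV v ∧ G ∈ facesV v := by
  obtain ⟨x, hF, hG⟩ := h
  cases x with
  | vert v => exact ⟨v, hF, hG⟩
  | edge e => exact ⟨_, facesE_subset_dsrc (e, true) hF, facesE_subset_dsrc (e, true) hG⟩
  | face c =>
    simp [closedCell, bdry] at hF hG
    exact absurd (hG.symm.trans hF) hne

/-- The faces that contain the edges next to a vertex of valence two are the same. -/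
theorem facesE_of_not_branch {v : X.V} (hv : ¬ Branch v) {d : X.Dart}
    (hd : dsrc d = v) : facesE d.1 = facesV v := by
  apply Set.Subset.antisymm
  · rw [← hd]; exact facesE_subset_dsrc d
  intro G hG
  obtain ⟨k, hk⟩ := mem_facesV.1 hG
  have h1 : dsrc (rev (bdRead G (k - 1))) = v := by
    rw [dsrc_rev, bdRead_chain, sub_add_cancel, hk]
  have hne' : rev (bdRead G (k - 1)) ≠ bdRead G k := by
    have := bdRead_imm G (k - 1)
    rw [sub_add_cancel] at this
    exact this.symm
  by_contra hG'
  have hd1 : d ≠ rev (bdRead G (k - 1)) := by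
    rintro rfl
    exact hG' (mem_facesE_of_reads G (k - 1))
  have hd2 : d ≠ bdRead G k := by
    rintro rfl
    exact hG' (mem_facesE_of_reads G k)
  apply hv
  have hsub : ({d, rev (bdRead G (k - 1)), bdRead G k} : Set X.Dart) ⊆ {d | dsrc d = v} := by
    rintro x (rfl | rfl | rfl)
    exacts [hd, h1, hk]
  refine le_trans ?_ (Set.encard_le_encard hsub)
  rw [Set.encard_insert_of_notMem (by simp [hd1, hd2]), Set.encard_pair hne']
  norm_num

theorem eq_or_eq_of_not_branch {v : X.V} (hv : ¬ Branch v) {d₁ d₂ d : X.Dart}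
    (h₁ : dsrc d₁ = v) (h₂ : dsrc d₂ = v) (hne : d₁ ≠ d₂) (hd : dsrc d = v) : d = d₁ ∨ d = d₂ := by
  by_contra hcon
  push Not at hcon
  apply hv
  have hsub : ({d, d₁, d₂} : Set X.Dart) ⊆ {d | dsrc d = v} := by
    rintro x (rfl | rfl | rfl)
    exacts [hd, h₁, h₂]
  refine le_trans ?_ (Set.encard_le_encard hsub)
  rw [Set.encard_insert_of_notMem (by simp [hcon.1, hcon.2]), Set.encard_pair hne]
  norm_num

theorem facesE_bdRead_succ {F : X.C} {k : ℤ} (hv : ¬ Branch (dsrc (bdRead F (k + 1)))) :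
    facesE (bdRead F (k + 1)).1 = facesE (bdRead F k).1 ∧
      facesV (dsrc (bdRead F (k + 1))) = facesE (bdRead F k).1 := by
  have h1 := facesE_of_not_branch hv rfl
  have h2 := facesE_of_not_branch hv (d := rev (bdRead F k)) (by rw [dsrc_rev, bdRead_chain])
  rw [rev_fst] at h2
  exact ⟨h1.trans h2.symm, h2.symm⟩

theorem facesE_bdRead_add {F : X.C} {k : ℤ} {m : ℕ}
    (hv : ∀ i : ℕ, i < m → ¬ Branch (dsrc (bdRead F (k + i + 1)))) :
    ∀ i : ℕ, i ≤ m → facesE (bdRead F (k + i)).1 = facesE (bdRead F k).1 := by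
  intro i
  induction i with
  | zero => intro _; simp
  | succ i ih =>
    intro hi
    rw [← ih (by omega), ← (facesE_bdRead_succ (hv i (by omega))).1]
    push_cast
    rw [add_assoc]

/-- Two 2-cells are adjacent if they are the only ones along some edge. -/
def Adj (A B : X.C) : Prop := A ≠ B ∧ ∃ e : X.E, facesE e = {A, B}

theorem Adj.symm {A B : X.C} (h : Adj A B) : Adj B A :=
  ⟨h.1.symm, h.2.imp fun _ he => he.trans (Set.pair_comm _ _)⟩

/-- At the branch vertex `v` there are exactly the four 2-cells `A`, `B`, `C`, `D`, and cyclically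
consecutive ones are adjacent, opposite ones are not. -/
structure Crossing (v : X.V) (A B C D : X.C) : Prop where
  branch : Branch v
  faces : facesV v = {A, B, C, D}
  adj_AB : Adj A B
  adj_BC : Adj B C
  adj_CD : Adj C D
  adj_DA : Adj D A
  ne_AC : A ≠ C
  ne_BD : B ≠ D
  not_adj_AC : ¬ Adj A C
  not_adj_BD : ¬ Adj B D

theorem Crossing.rotate {v : X.V} {A B C D : X.C} (h : Crossing v A B C D) :
    Crossing v B C D A where
  branch := h.branch
  faces := by rw [h.faces]; ext; simp; tauto
  adj_AB := h.adj_BC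
  adj_BC := h.adj_CD
  adj_CD := h.adj_DA
  adj_DA := h.adj_AB
  ne_AC := h.ne_BD
  ne_BD := h.ne_AC.symm
  not_adj_AC := h.not_adj_BD
  not_adj_BD := fun h' => h.not_adj_AC h'.symm

theorem Crossing.reflect {v : X.V} {A B C D : X.C} (h : Crossing v A B C D) :
    Crossing v A D C B where
  branch := h.branch
  faces := by rw [h.faces]; ext; simp; tauto
  adj_AB := h.adj_DA.symm
  adj_BC := h.adj_CD.symm
  adj_CD := h.adj_BC.symm
  adj_DA := h.adj_AB.symm
  ne_AC := h.ne_AC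
  ne_BD := h.ne_BD.symm
  not_adj_AC := h.not_adj_AC
  not_adj_BD := fun h' => h.not_adj_BD h'.symm

/-- The 2-cell opposite to `A` is the only one not adjacent to `A`. -/
theorem Crossing.unique {v : X.V} {A B C D B' C' D' : X.C} (hc : Crossing v A B C D)
    (hc' : Crossing v A B' C' D') : C = C' ∧ (B = B' ∧ D = D' ∨ B = D' ∧ D = B') := by
  have hset := hc.faces.symm.trans hc'.faces
  have hC : C ∈ ({A, B', C', D'} : Set X.C) := by rw [← hset]; simp
  have hB : B ∈ ({A, B', C', D'} : Set X.C) := by rw [← hset]; simp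
  have hD : D ∈ ({A, B', C', D'} : Set X.C) := by rw [← hset]; simp
  have hCC : C = C' := by
    rcases hC with hC | hC | hC | hC
    · exact absurd hC.symm hc.ne_AC
    · exact absurd (hC ▸ hc'.adj_AB) hc.not_adj_AC
    · exact hC
    · exact absurd ((Set.mem_singleton_iff.1 hC) ▸ hc'.adj_DA.symm) hc.not_adj_AC
  have hne := hc.ne_BD
  have h1 := hc.adj_AB.1
  have h2 := hc.adj_BC.1
  have h3 := hc.adj_CD.1
  have h4 := hc.adj_DA.1
  subst hCC
  simp only [Set.mem_insert_iff, Set.mem_singleton_iff] at hB hD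
  refine ⟨rfl, ?_⟩
  rcases hB with rfl | rfl | rfl | rfl <;> rcases hD with rfl | rfl | rfl | rfl <;> tauto

/-- The set of labels of the diagonal neighbours. -/
def evens : Finset (ZMod 8) := {0, 2, 4, 6}

theorem mem_evens_iff {i : ZMod 8} : i ∈ ({2, 4, 6, 8} : Set (ZMod 8)) ↔ i ∈ evens := by
  revert i; decide

theorem zmod8_sub_one_ne (i : ZMod 8) : i - 1 ≠ i := by revert i; decide

theorem zmod8_ne_add_one (i : ZMod 8) : i ≠ i + 1 := by revert i; decide

theorem zmod8_sub_one_ne_add_one (i : ZMod 8) : i - 1 ≠ i + 1 := by revert i; decide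

theorem evens_ne_sub_one {i j : ZMod 8} (hi : i ∈ evens) (hj : j ∈ evens) : i ≠ j - 1 := by
  revert i j; decide

theorem evens_ne_add_one {i j : ZMod 8} (hi : i ∈ evens) (hj : j ∈ evens) : i ≠ j + 1 := by
  revert i j; decide

namespace QuasiFlatAt

variable {F : X.C} {N : ZMod 8 → X.C} (h : QuasiFlatAt F N)
include h

theorem ne (i : ZMod 8) : N i ≠ F := ((h.neighbours (N i)).1 ⟨i, rfl⟩).1

theorem exists_vertex (i : ZMod 8) : ∃ v, F ∈ facesV v ∧ N i ∈ facesV v :=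
  exists_common_vertex_of_inter_nonempty (h.ne i) ((h.neighbours (N i)).1 ⟨i, rfl⟩).2

/-- The star of a branch vertex of `F`. -/
theorem star {v : X.V} (hF : F ∈ facesV v) (hb : Branch v) :
    ∃ i ∈ evens, ∃ A B, (A = N (i - 1) ∧ B = N (i + 1) ∨ A = N (i + 1) ∧ B = N (i - 1)) ∧
      ((closedCell F ∩ closedCell (N i) = {.vert v} ∧
          ∃ p q r s, Star4 v A (N i) B F p q r s) ∨
        ∃ v', IsArc (closedCell F ∩ closedCell (N i)) v v' ∧ Branch v' ∧
          (∃ s p q, Star3 v F A (N i) B s p q) ∧ ∃ s p q, Star3 v' F B (N i) A s p q) := by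
  have hinj := h.injective
  have h1 : ∀ i : ZMod 8, N (i - 1) ≠ N i := fun i => hinj.ne (zmod8_sub_one_ne i)
  have h2 : ∀ i : ZMod 8, N i ≠ N (i + 1) := fun i => hinj.ne (zmod8_ne_add_one i)
  have h3 : ∀ i : ZMod 8, N (i - 1) ≠ N (i + 1) := fun i => hinj.ne (zmod8_sub_one_ne_add_one i)
  rcases h.links v (mem_bdry_vert.2 hF) hb with ⟨-, i, hi, hint, hl⟩ |
      ⟨hv, v', hv', i, hi, harc, ⟨hl, hl'⟩ | ⟨hl, hl'⟩⟩
  · exact ⟨i, mem_evens_iff.1 hi, _, _, Or.inl ⟨rfl, rfl⟩, Or.inl ⟨hint, exists_star4 hl (h1 i)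
      (h3 i) (h.ne _) (h2 i) (h.ne _) (h.ne _)⟩⟩
  · exact ⟨i, mem_evens_iff.1 hi, _, _, Or.inl ⟨rfl, rfl⟩, Or.inr ⟨v', harc, hv'.ge,
      exists_star3 hl hv (h.ne _).symm (h.ne _).symm (h.ne _).symm (h1 i) (h3 i) (h2 i),
      exists_star3 hl' hv' (h.ne _).symm (h.ne _).symm (h.ne _).symm (h2 i).symm (h3 i).symm
        (h1 i).symm⟩⟩
  · exact ⟨i, mem_evens_iff.1 hi, _, _, Or.inr ⟨rfl, rfl⟩, Or.inr ⟨v', harc, hv'.ge,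
      exists_star3 hl hv (h.ne _).symm (h.ne _).symm (h.ne _).symm (h2 i).symm (h3 i).symm
        (h1 i).symm,
      exists_star3 hl' hv' (h.ne _).symm (h.ne _).symm (h.ne _).symm (h1 i) (h3 i) (h2 i)⟩⟩

/-- An edge of `F` and `N i` belongs to further 2-cells, since `F ∩ N i` is contained in
`N (i - 1)`. -/
theorem not_adj_even {i : ZMod 8} (hi : i ∈ evens) : ¬ Adj F (N i) := by
  rintro ⟨-, e, he⟩
  have hd := h.diagonal i (mem_evens_iff.2 hi)
  have hmem : Cell.edge e ∈ closedCell F ∩ closedCell (N i) := by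
    constructor <;> rw [mem_closedCell_edge, he] <;> simp
  rw [hd] at hmem
  have h1 : N (i - 1) ∈ facesE e := hmem.1
  rw [he] at h1
  rcases h1 with h1 | h1
  · exact h.ne _ h1
  · exact absurd (h.injective h1) (zmod8_sub_one_ne i)

/-- An edge of `N (i - 1)` and `N (i + 1)` belongs to further 2-cells, since the intersection of
these two is contained in `F`. -/
theorem not_adj_around {i : ZMod 8} (hi : i ∈ evens) : ¬ Adj (N (i - 1)) (N (i + 1)) := by
  rintro ⟨-, e, he⟩
  have hd := h.diagonal i (mem_evens_iff.2 hi)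
  have hmem : Cell.edge e ∈ closedCell (N (i - 1)) ∩ closedCell (N (i + 1)) := by
    constructor <;> rw [mem_closedCell_edge, he] <;> simp
  rw [← hd] at hmem
  have h1 : F ∈ facesE e := hmem.1
  rw [he] at h1
  rcases h1 with h1 | h1
  · exact h.ne _ h1.symm
  · exact h.ne _ (Set.mem_singleton_iff.1 h1).symm

/-- Four 2-cells around a vertex of valence four share the edges there in cyclic order. At a vertex
of valence three, two of the four adjacencies are seen only at the other end of the arc. -/
theorem crossing_of_star {v : X.V} (hb : Branch v) {i : ZMod 8} (hi : i ∈ evens) {A B : X.C}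
    (hAB : A = N (i - 1) ∧ B = N (i + 1) ∨ A = N (i + 1) ∧ B = N (i - 1))
    (hstar : (∃ p q r s, Star4 v A (N i) B F p q r s) ∨ ∃ v',
      (∃ s p q, Star3 v F A (N i) B s p q) ∧ ∃ s p q, Star3 v' F B (N i) A s p q) :
    Crossing v F A (N i) B := by
  have h1 := h.injective.ne (zmod8_sub_one_ne i)
  have h2 := h.injective.ne (zmod8_ne_add_one i)
  have h3 := h.injective.ne (zmod8_sub_one_ne_add_one i)
  have hFi := (h.ne i).symm
  have hn1 := h.not_adj_even hi
  have hn2 := h.not_adj_around hi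
  have hAB' : A ≠ B ∧ ¬ Adj A B ∧ A ≠ N i ∧ N i ≠ B ∧ F ≠ A ∧ B ≠ F := by
    rcases hAB with ⟨rfl, rfl⟩ | ⟨rfl, rfl⟩
    · exact ⟨h3, hn2, h1, h2, (h.ne _).symm, h.ne _⟩
    · exact ⟨h3.symm, fun h' => hn2 h'.symm, h2.symm, h1.symm, (h.ne _).symm, h.ne _⟩
  obtain ⟨a1, a2, a3, a4, a5, a6⟩ := hAB'
  rcases hstar with ⟨p, q, r, s, st⟩ | ⟨v', ⟨s, p, q, st⟩, s', p', q', st'⟩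
  · exact ⟨hb, by rw [st.faces]; ext; simp; tauto, ⟨a5, _, st.faces_p⟩, ⟨a3, _, st.faces_q⟩,
      ⟨a4, _, st.faces_r⟩, ⟨a6, _, st.faces_s⟩, hFi, a1, hn1, a2⟩
  · exact ⟨hb, st.faces, ⟨a5, _, st.faces_p⟩, ⟨a3, _, st'.faces_q.trans (Set.pair_comm _ _)⟩,
      ⟨a4, _, st.faces_q⟩, ⟨a6, _, st'.faces_p.trans (Set.pair_comm _ _)⟩, hFi, a1, hn1, a2⟩

theorem crossing {v : X.V} (hF : F ∈ facesV v) (hb : Branch v) :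
    ∃ i ∈ evens, Crossing v F (N (i - 1)) (N i) (N (i + 1)) := by
  obtain ⟨i, hi, A, B, hAB, hstar⟩ := h.star hF hb
  have hs := h.crossing_of_star hb hi hAB
    (hstar.imp And.right fun ⟨v', _, _, h1, h2⟩ => ⟨v', h1, h2⟩)
  refine ⟨i, hi, ?_⟩
  rcases hAB with ⟨rfl, rfl⟩ | ⟨rfl, rfl⟩
  · exact hs
  · exact hs.reflect

theorem corner_unique {v : X.V} (hF : F ∈ facesV v) (hb : Branch v) (G : X.C)
    (k k' : ZMod (X.len G)) (hk : dsrc (X.att G k) = v) (hk' : dsrc (X.att G k') = v) :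
    k = k' := by
  obtain ⟨i, -, A, B, -, ⟨-, p, q, r, s, st⟩ | ⟨v', -, -, ⟨s, p, q, st⟩, -⟩⟩ := h.star hF hb
  · exact st.corner_unique G k k' hk hk'
  · exact st.corner_unique G k k' hk hk'

/-- If all vertices of `∂F` had valence two, then `∂F` would lie in all neighbours of `F`. -/
theorem exists_branch : ∃ k : ℤ, Branch (dsrc (bdRead F k)) := by
  by_contra! hno
  have hE : ∀ k : ℤ, facesE (bdRead F k).1 = facesE (bdRead F 0).1 := by
    intro k
    induction k using Int.induction_on with
    | zero => rfl
    | succ k ih => rw [(facesE_bdRead_succ (hno _)).1, ih]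
    | pred k ih =>
      rw [← ih]
      have := (facesE_bdRead_succ (F := F) (k := -k - 1) (hno _)).1
      rw [← this]; simp
  have hV : ∀ k : ℤ, facesV (dsrc (bdRead F k)) = facesE (bdRead F 0).1 := by
    intro k
    have := (facesE_bdRead_succ (F := F) (k := k - 1) (hno _)).2
    rw [sub_add_cancel] at this
    rw [this, hE]
  have hN : ∀ i, N i ∈ facesV (dsrc (bdRead F 0)) := by
    intro i
    obtain ⟨v, hF, hN⟩ := h.exists_vertex i
    obtain ⟨k, rfl⟩ := mem_facesV.1 hF
    rw [hV] at hN ⊢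
    exact hN
  have h5 := h.fivefold 1 2 3 4 (by decide) (by decide) (by decide) (by decide) (by decide)
    (by decide)
  have : Cell.vert (dsrc (bdRead F 0)) ∈ (∅ : Set X.Cell) := by
    rw [← h5]
    exact ⟨⟨⟨⟨mem_facesV_of_reads F 0, hN 1⟩, hN 2⟩, hN 3⟩, hN 4⟩
  exact this

theorem exists_next_branch (k : ℤ) : ∃ m : ℕ, Branch (dsrc (bdRead F (k + m + 1))) ∧
    ∀ i < m, ¬ Branch (dsrc (bdRead F (k + i + 1))) := by
  classical
  obtain ⟨j, hj⟩ := h.exists_branch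
  have hex : ∃ m : ℕ, Branch (dsrc (bdRead F (k + m + 1))) := by
    have hn : (0 : ℤ) < X.len F := by exact_mod_cast X.len_pos F
    refine ⟨((j - k - 1) % X.len F).toNat, ?_⟩
    have h1 : (((j - k - 1) % X.len F).toNat : ℤ) = (j - k - 1) % X.len F :=
      Int.toNat_of_nonneg (Int.emod_nonneg _ hn.ne')
    have h2 : k + (j - k - 1) % X.len F + 1 = j + (-((j - k - 1) / X.len F)) * X.len F := by
      have := Int.emod_def (j - k - 1) (X.len F)
      rw [this]; ring
    rw [h1, h2, bdRead_add_len]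
    exact hj
  exact ⟨Nat.find hex, Nat.find_spec hex, fun i hi => Nat.find_min hex hi⟩

/-- Every neighbour meets `F` in a branch vertex: from a common vertex of valence two, follow `∂F`
to the next branch vertex. -/
theorem exists_branch_mem (i : ZMod 8) : ∃ v, Branch v ∧ F ∈ facesV v ∧ N i ∈ facesV v := by
  obtain ⟨v, hF, hN⟩ := h.exists_vertex i
  by_cases hb : Branch v
  · exact ⟨v, hb, hF, hN⟩
  obtain ⟨k, rfl⟩ := mem_facesV.1 hF
  rw [← facesE_of_not_branch hb rfl] at hN
  obtain ⟨m, hm, hlt⟩ := h.exists_next_branch k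
  refine ⟨_, hm, mem_facesV_of_reads _ _, ?_⟩
  rw [← bdRead_chain]
  apply facesE_subset_dtgt
  rwa [facesE_bdRead_add hlt m le_rfl]

theorem exists_crossing {i : ZMod 8} (hi : i ∈ evens) :
    ∃ v, Crossing v F (N (i - 1)) (N i) (N (i + 1)) := by
  obtain ⟨v, hb, hF, hN⟩ := h.exists_branch_mem i
  obtain ⟨j, hj, hc⟩ := h.crossing hF hb
  rw [hc.faces] at hN
  have hji : j = i := by
    rcases hN with hN | hN | hN | hN
    · exact absurd hN (h.ne i)
    · exact absurd (h.injective hN) (evens_ne_sub_one hi hj)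
    · exact (h.injective hN).symm
    · exact absurd (h.injective hN) (evens_ne_add_one hi hj)
  subst hji
  exact ⟨v, hc⟩

theorem crossing_complete {v : X.V} {A B D : X.C} (hc : Crossing v F A B D) :
    ∃ i ∈ evens, B = N i ∧
      (A = N (i - 1) ∧ D = N (i + 1) ∨ A = N (i + 1) ∧ D = N (i - 1)) := by
  have hF : F ∈ facesV v := by rw [hc.faces]; simp
  obtain ⟨i, hi, hc'⟩ := h.crossing hF hc.branch
  exact ⟨i, hi, hc.unique hc'⟩

/-- The boundary of `F` is embedded. There is only one corner of `F` at a branch vertex, and if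
`∂F` passes twice through a vertex of valence two, then both passages can be followed to the same
branch vertex. -/
theorem dsrc_injective {k k' : ℤ} (hkk : dsrc (bdRead F k) = dsrc (bdRead F k')) :
    (k : ZMod (X.len F)) = k' := by
  have hbranch : ∀ a b : ℤ, Branch (dsrc (bdRead F a)) → dsrc (bdRead F a) = dsrc (bdRead F b) →
      (a : ZMod (X.len F)) = b := fun a b hb hab =>
    h.corner_unique (mem_facesV_of_reads F a) hb F _ _ rfl hab.symm
  by_cases hb : Branch (dsrc (bdRead F k))
  · exact hbranch _ _ hb hkk
  obtain ⟨m, hm, hlt⟩ := h.exists_next_branch k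
  have two : ∀ a b : ℤ, ¬ Branch (dsrc (bdRead F a)) → ∀ d, dsrc d = dsrc (bdRead F a) →
      dsrc (bdRead F a) = dsrc (bdRead F b) → d = bdRead F b ∨ d = rev (bdRead F (b - 1)) := by
    intro a b hb d hd hab
    refine eq_or_eq_of_not_branch hb hab.symm ?_ ?_ hd
    · rw [dsrc_rev, bdRead_chain, sub_add_cancel, hab]
    · have := bdRead_imm F (b - 1)
      rwa [sub_add_cancel] at this
  rcases two k k' hb _ rfl hkk with h0 | h0
  · have hind : ∀ i : ℕ, i ≤ m → bdRead F (k + i) = bdRead F (k' + i) := by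
      intro i
      induction i with
      | zero => intro _; simpa using h0
      | succ i ih =>
        intro hi
        have ih' := ih (by omega)
        have hsrc : dsrc (bdRead F (k + i + 1)) = dsrc (bdRead F (k' + i + 1)) := by
          rw [← bdRead_chain, ← bdRead_chain, ih']
        push_cast
        rw [← add_assoc, ← add_assoc]
        rcases two _ _ (hlt i (by omega)) _ rfl hsrc with h1 | h1
        · exact h1
        · rw [add_sub_cancel_right, ← ih'] at h1
          exact absurd h1 (bdRead_imm F _)
    have hsrc : dsrc (bdRead F (k + m + 1)) = dsrc (bdRead F (k' + m + 1)) := by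
      rw [← bdRead_chain, ← bdRead_chain, hind m le_rfl]
    have := hbranch _ _ hm hsrc
    push_cast at this
    linear_combination this
  · -- The two passages are in opposite senses, and `∂F` would turn back at the branch vertex.
    exfalso
    have hind : ∀ i : ℕ, i ≤ m → bdRead F (k + i) = rev (bdRead F (k' - 1 - i)) := by
      intro i
      induction i with
      | zero => intro _; simpa using h0
      | succ i ih =>
        intro hi
        have ih' := ih (by omega)
        have hsrc : dsrc (bdRead F (k + i + 1)) = dsrc (bdRead F (k' - 1 - i)) := by
          rw [← bdRead_chain, ih', dtgt_rev]
        push_cast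
        rw [← add_assoc]
        rcases two _ _ (hlt i (by omega)) _ rfl hsrc with h1 | h1
        · rw [← rev_rev (bdRead F (k' - 1 - i)), ← ih'] at h1
          exact absurd h1 (bdRead_imm F _)
        · rw [h1]; congr 2; ring
    have hsrc : dsrc (bdRead F (k + m + 1)) = dsrc (bdRead F (k' - 1 - m)) := by
      rw [← bdRead_chain, hind m le_rfl, dtgt_rev]
    have h1 := hbranch _ _ hm hsrc
    have h2 : bdRead F (k + m + 1) = bdRead F (k' - 1 - m) := congrArg (X.att F) h1
    apply bdRead_imm F (k + m)
    rw [h2, hind m le_rfl, rev_rev]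

end QuasiFlatAt

end TwoComplex

section SquareComplexes

open TwoComplex

/-! ### Complexes of squares in which the link of every vertex is a cycle of length four -/

/-- A relation that behaves like "`A`, `B`, `C`, `D` are the successive vertices of a square". -/
structure IsSquareRel {C : Type*} (Q : C → C → C → C → Prop) : Prop where
  rotate : ∀ {A B C D}, Q A B C D → Q B C D A
  reflect : ∀ {A B C D}, Q A B C D → Q A D C B
  ne_side : ∀ {A B C D}, Q A B C D → A ≠ B
  ne_diag : ∀ {A B C D}, Q A B C D → A ≠ C

/-- A frame at the vertex `F` of a square complex: its neighbours in the directions of the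
compass. Direction `1` is east, and the other directions follow anticlockwise, so that the squares
at `F` have their opposite vertices in the directions with even label. -/
structure IsFrame {C : Type*} (Q : C → C → C → C → Prop) (F : C) (N : ZMod 8 → C) : Prop where
  inj : Function.Injective N
  quad : ∀ i ∈ evens, Q F (N (i - 1)) (N i) (N (i + 1))
  complete : ∀ A B D, Q F A B D → ∃ i ∈ evens, B = N i ∧
    (A = N (i - 1) ∧ D = N (i + 1) ∨ A = N (i + 1) ∧ D = N (i - 1))

theorem evens_add {i j : ZMod 8} (hi : i ∈ evens) (hj : j ∈ evens) : i + j ∈ evens := by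
  revert i j; decide

theorem evens_sub {i j : ZMod 8} (hi : i ∈ evens) (hj : j ∈ evens) : i - j ∈ evens := by
  revert i j; decide

theorem evens_neg {i : ZMod 8} (hi : i ∈ evens) : -i ∈ evens := by
  revert i; decide

section Frames

variable {C : Type*} {Q : C → C → C → C → Prop}

namespace IsFrame

variable {F : C} {N N' : ZMod 8 → C}

theorem rotate (h : IsFrame Q F N) {j : ZMod 8} (hj : j ∈ evens) :
    IsFrame Q F fun i => N (i + j) where
  inj := fun a b hab => by simpa using h.inj hab
  quad := fun i hi => by
    have := h.quad (i + j) (evens_add hi hj)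
    rwa [show i + j - 1 = i - 1 + j by ring, show i + j + 1 = i + 1 + j by ring] at this
  complete := fun A B D hQ => by
    obtain ⟨i, hi, h1, h2⟩ := h.complete A B D hQ
    refine ⟨i - j, evens_sub hi hj, ?_⟩
    rw [show i - j + j = i by ring, show i - j - 1 + j = i - 1 by ring,
      show i - j + 1 + j = i + 1 by ring]
    exact ⟨h1, h2⟩

theorem reflect (hS : IsSquareRel Q) (h : IsFrame Q F N) : IsFrame Q F fun i => N (-i) where
  inj := fun a b hab => by simpa using h.inj hab
  quad := fun i hi => by
    have := hS.reflect (h.quad (-i) (evens_neg hi))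
    rwa [show -i - 1 = -(i + 1) by ring, show -i + 1 = -(i - 1) by ring] at this
  complete := fun A B D hQ => by
    obtain ⟨i, hi, h1, h2⟩ := h.complete A B D hQ
    refine ⟨-i, evens_neg hi, ?_⟩
    rw [neg_neg, show -(-i - 1) = i + 1 by ring, show -(-i + 1) = i - 1 by ring]
    exact ⟨h1, h2.symm⟩

theorem ne (hS : IsSquareRel Q) (h : IsFrame Q F N) (i : ZMod 8) : F ≠ N i := by
  by_cases hi : i ∈ evens
  · exact hS.ne_diag (h.quad i hi)
  · have : i + 1 ∈ evens := by revert i; decide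
    have h1 := hS.ne_side (h.quad _ this)
    rwa [add_sub_cancel_right] at h1

/-- Two consecutive members of a frame at `F` form a side of exactly two squares with `F`; the one
on the further side contains the next two members. -/
theorem eq_step (h : IsFrame Q F N) (h' : IsFrame Q F N') {i : ZMod 8} (hi : i ∈ evens)
    (h1 : N i = N' i) (h2 : N (i + 1) = N' (i + 1)) :
    N (i + 2) = N' (i + 2) ∧ N (i + 3) = N' (i + 3) := by
  have hi2 : i + 2 ∈ evens := evens_add hi (by decide)
  have hq := h.quad (i + 2) hi2
  rw [show i + 2 - 1 = i + 1 by ring, show i + 2 + 1 = i + 3 by ring] at hq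
  obtain ⟨j, hj, e1, ⟨e2, e3⟩ | ⟨e2, e3⟩⟩ := h'.complete _ _ _ hq
  · rw [h2] at e2
    obtain rfl : j = i + 2 := by
      have := h'.inj e2
      linear_combination -this
    exact ⟨e1, by rw [e3]; congr 1; ring⟩
  · rw [h2] at e2
    obtain rfl : j = i := by
      have := h'.inj e2
      linear_combination -this
    rw [← h1] at e1
    have := h.inj e1
    have : ∀ j : ZMod 8, j + 2 ≠ j := by decide
    exact absurd ‹j + 2 = j› (this j)

/-- A frame is determined by two of its consecutive neighbours. -/
theorem ext (h : IsFrame Q F N) (h' : IsFrame Q F N') {i : ZMod 8} (hi : i ∈ evens)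
    (h1 : N i = N' i) (h2 : N (i + 1) = N' (i + 1)) : N = N' := by
  have two : (2 : ZMod 8) ∈ evens := by decide
  obtain ⟨a1, a2⟩ := h.eq_step h' hi h1 h2
  rw [show i + 3 = i + 2 + 1 by ring] at a2
  obtain ⟨b1, b2⟩ := h.eq_step h' (evens_add hi two) a1 a2
  rw [show i + 2 + 3 = i + 2 + 2 + 1 by ring] at b2
  obtain ⟨c1, c2⟩ := h.eq_step h' (evens_add (evens_add hi two) two) b1 b2
  rw [show i + 2 + 2 + 3 = i + 2 + 2 + 2 + 1 by ring] at c2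
  funext j
  have : ∀ i j : ZMod 8, j = i ∨ j = i + 1 ∨ j = i + 2 ∨ j = i + 2 + 1 ∨ j = i + 2 + 2 ∨
    j = i + 2 + 2 + 1 ∨ j = i + 2 + 2 + 2 ∨ j = i + 2 + 2 + 2 + 1 := by decide
  rcases this i j with rfl | rfl | rfl | rfl | rfl | rfl | rfl | rfl <;> assumption

/-- The frame at the eastern neighbour that is parallel to a given frame: it contains the vertices
of the two common squares in the positions where they are seen from there. -/
theorem exists_east (hS : IsSquareRel Q) (hex : ∀ F, ∃ N, IsFrame Q F N) (h : IsFrame Q F N) :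
    ∃ M, IsFrame Q (N 1) M ∧ M 5 = F ∧ M 4 = N 3 ∧ M 3 = N 2 ∧ M 6 = N 7 ∧ M 7 = N 0 := by
  have q2 : Q (N 1) (N 2) (N 3) F := hS.rotate (h.quad 2 (by decide))
  have q0 : Q (N 1) (N 0) (N 7) F := by
    have : Q F (N 7) (N 0) (N 1) := h.quad 0 (by decide)
    exact hS.rotate (hS.reflect this)
  have h37 : N 3 ≠ N 7 := h.inj.ne (by decide)
  have norm : ∃ M, IsFrame Q (N 1) M ∧ ∃ i ∈ evens, N 3 = M i ∧ N 2 = M (i - 1) ∧ F = M (i + 1) := by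
    obtain ⟨M, hM⟩ := hex (N 1)
    obtain ⟨i, hi, e1, ⟨e2, e3⟩ | ⟨e2, e3⟩⟩ := hM.complete _ _ _ q2
    · exact ⟨M, hM, i, hi, e1, e2, e3⟩
    · refine ⟨_, hM.reflect hS, -i, evens_neg hi, ?_⟩
      rw [neg_neg, show -(-i - 1) = i + 1 by ring, show -(-i + 1) = i - 1 by ring]
      exact ⟨e1, e2, e3⟩
  obtain ⟨M₀, hM₀, i, hi, e1, e2, e3⟩ := norm
  have hM := hM₀.rotate (evens_sub hi (show (4 : ZMod 8) ∈ evens by decide))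
  have m5 : M₀ (5 + (i - 4)) = F := by rw [e3]; congr 1; ring
  have m4 : M₀ (4 + (i - 4)) = N 3 := by rw [e1]; congr 1; ring
  have m3 : M₀ (3 + (i - 4)) = N 2 := by rw [e2]; congr 1; ring
  refine ⟨_, hM, m5, m4, m3, ?_⟩
  -- Having placed the northern common square, find the southern one.
  obtain ⟨k, hk, f1, ⟨f2, f3⟩ | ⟨f2, f3⟩⟩ := hM.complete _ _ _ q0
  · rw [← m5] at f3
    obtain rfl : k = 4 := by
      have := hM.inj f3
      linear_combination -this
    exact absurd (m4.symm.trans f1.symm) h37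
  · rw [← m5] at f3
    obtain rfl : k = 6 := by
      have := hM.inj f3
      linear_combination -this
    exact ⟨f1.symm, f2.symm⟩

end IsFrame

variable (Q) in
/-- The vertices of a square complex together with a frame. -/
def Frame : Type _ := {p : C × (ZMod 8 → C) // IsFrame Q p.1 p.2}

namespace Frame

/-- The vertex at which the frame is placed. -/
def face (f : Frame Q) : C := f.1.1

/-- The neighbours in the directions of the compass. -/
def nbr (f : Frame Q) : ZMod 8 → C := f.1.2

theorem isFrame (f : Frame Q) : IsFrame Q f.face f.nbr := f.2

theorem ext {f g : Frame Q} (h : f.face = g.face) {i : ZMod 8} (hi : i ∈ evens)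
    (h1 : f.nbr i = g.nbr i) (h2 : f.nbr (i + 1) = g.nbr (i + 1)) : f = g := by
  have hf : IsFrame Q g.face f.nbr := h ▸ f.isFrame
  exact Subtype.ext (Prod.ext h (hf.ext g.isFrame hi h1 h2))

/-- The frame turned by the angle with label `j`. -/
def rot (j : ZMod 8) (hj : j ∈ evens) (f : Frame Q) : Frame Q :=
  ⟨(f.face, fun i => f.nbr (i + j)), f.isFrame.rotate hj⟩

end Frame

/-- A square complex in which every vertex has a frame. -/
structure IsSquareComplex (Q : C → C → C → C → Prop) : Prop extends IsSquareRel Q where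
  exists_frame : ∀ F, ∃ N, IsFrame Q F N

namespace Frame

variable (hQ : IsSquareComplex Q)

/-- The frame moved one step to the east by parallel transport. -/
noncomputable def step (f : Frame Q) : Frame Q :=
  ⟨(f.nbr 1, (f.isFrame.exists_east hQ.toIsSquareRel hQ.exists_frame).choose),
    (f.isFrame.exists_east hQ.toIsSquareRel hQ.exists_frame).choose_spec.1⟩

theorem step_spec (f : Frame Q) : (step hQ f).face = f.nbr 1 ∧ (step hQ f).nbr 5 = f.face ∧
    (step hQ f).nbr 4 = f.nbr 3 ∧ (step hQ f).nbr 3 = f.nbr 2 ∧ (step hQ f).nbr 6 = f.nbr 7 ∧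
    (step hQ f).nbr 7 = f.nbr 0 :=
  ⟨rfl, (f.isFrame.exists_east hQ.toIsSquareRel hQ.exists_frame).choose_spec.2⟩

/-- One step in the direction with label `j + 1`. -/
noncomputable def move (j : ZMod 8) (hj : j ∈ evens) (f : Frame Q) : Frame Q :=
  rot (-j) (evens_neg hj) (step hQ (rot j hj f))

theorem move_spec (j : ZMod 8) (hj : j ∈ evens) (f : Frame Q) :
    (move hQ j hj f).face = f.nbr (1 + j) ∧ (move hQ j hj f).nbr (5 + j) = f.face ∧
    (move hQ j hj f).nbr (4 + j) = f.nbr (3 + j) ∧ (move hQ j hj f).nbr (3 + j) = f.nbr (2 + j) ∧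
    (move hQ j hj f).nbr (6 + j) = f.nbr (7 + j) ∧
    (move hQ j hj f).nbr (7 + j) = f.nbr (0 + j) := by
  obtain ⟨h1, h2, h3, h4, h5, h6⟩ := step_spec hQ (rot j hj f)
  simp only [move, rot, face, nbr] at *
  simp only [add_neg_cancel_right]
  exact ⟨h1, h2, h3, h4, h5, h6⟩

/-- A step and the opposite step cancel: both frames have the old position and its neighbour on the
way in common. -/
theorem move_move_opp (j : ZMod 8) (hj : j ∈ evens) (hj' : j + 4 ∈ evens) (f : Frame Q) :
    move hQ (j + 4) hj' (move hQ j hj f) = f := by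
  obtain ⟨h1, h2, h3, h4, h5, h6⟩ := move_spec hQ j hj f
  obtain ⟨k1, k2, k3, k4, k5, k6⟩ := move_spec hQ (j + 4) hj' (move hQ j hj f)
  have e : ∀ a : ZMod 8, a + (j + 4) = a + 4 + j := fun a => by ring
  simp only [e] at k1 k2 k3 k4 k5 k6
  have c1 : (1 : ZMod 8) + 4 = 5 := by decide
  have c5 : (5 : ZMod 8) + 4 = 1 := by decide
  have c4 : (4 : ZMod 8) + 4 = 0 := by decide
  have c3 : (3 : ZMod 8) + 4 = 7 := by decide
  have c7 : (7 : ZMod 8) + 4 = 3 := by decide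
  have c2 : (2 : ZMod 8) + 4 = 6 := by decide
  rw [c1, h2] at k1
  rw [c5, h1] at k2
  rw [c4, c3, h6] at k3
  refine ext k1 (i := 0 + j) (by rwa [zero_add]) k3 ?_
  rw [show (0 : ZMod 8) + j + 1 = 1 + j by ring]
  exact k2

/-- Parallel transport around a square is trivial. -/
theorem move_comm (f : Frame Q) : move hQ 0 (by decide) (move hQ 2 (by decide) f) =
    move hQ 2 (by decide) (move hQ 0 (by decide) f) := by
  obtain ⟨a1, a2, a3, a4, a5, a6⟩ := move_spec hQ 2 (by decide) f
  obtain ⟨b1, b2, b3, b4, b5, b6⟩ := move_spec hQ 0 (by decide) (move hQ 2 (by decide) f)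
  obtain ⟨c1, c2, c3, c4, c5, c6⟩ := move_spec hQ 0 (by decide) f
  obtain ⟨d1, d2, d3, d4, d5, d6⟩ := move_spec hQ 2 (by decide) (move hQ 0 (by decide) f)
  have e1 : (6 : ZMod 8) + 2 = 0 := by decide
  have e2 : (7 : ZMod 8) + 2 = 1 := by decide
  have e3 : (5 : ZMod 8) + 2 = 7 := by decide
  have e4 : (1 : ZMod 8) + 2 = 3 := by decide
  have e5 : (4 : ZMod 8) + 2 = 6 := by decide
  have e6 : (3 : ZMod 8) + 2 = 5 := by decide
  have e7 : (2 : ZMod 8) + 2 = 4 := by decide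
  have e8 : (0 : ZMod 8) + 2 = 2 := by decide
  simp only [add_zero, e1, e2, e3, e4, e5, e6, e7, e8] at *
  refine ext (b1.trans (a6.trans (d1.trans c4).symm)) (i := 6) (by decide) ?_ ?_
  · exact b5.trans (a2.trans (d3.trans c2).symm)
  · change _ = (move hQ 2 _ _).nbr 7
    exact b6.trans (a5.trans (d2.trans c1).symm)

/-- One step to the east. -/
noncomputable def east : Equiv.Perm (Frame Q) where
  toFun := move hQ 0 (by decide)
  invFun := move hQ (0 + 4) (by decide)
  left_inv := move_move_opp hQ 0 _ _
  right_inv := move_move_opp hQ (0 + 4) (by decide) (by decide)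

/-- One step to the north. -/
noncomputable def north : Equiv.Perm (Frame Q) where
  toFun := move hQ 2 (by decide)
  invFun := move hQ (2 + 4) (by decide)
  left_inv := move_move_opp hQ 2 _ _
  right_inv := move_move_opp hQ (2 + 4) (by decide) (by decide)

theorem commute_east_north : Commute (east hQ) (north hQ) := by
  ext f : 1
  exact move_comm hQ f

/-- Parallel transport by a vector of the plane. -/
noncomputable def act (z : ℤ × ℤ) (f : Frame Q) : Frame Q := ((east hQ) ^ z.1 * (north hQ) ^ z.2) f

theorem act_zero (f : Frame Q) : act hQ 0 f = f := by simp [act]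

theorem act_add (z w : ℤ × ℤ) (f : Frame Q) : act hQ (z + w) f = act hQ z (act hQ w f) := by
  have h := (commute_east_north hQ).zpow_zpow w.1 z.2
  simp only [act, Prod.fst_add, Prod.snd_add, zpow_add, ← Equiv.Perm.mul_apply]
  congr 1
  calc _ = (east hQ) ^ z.1 * ((east hQ) ^ w.1 * (north hQ) ^ z.2) * (north hQ) ^ w.2 := by group
    _ = (east hQ) ^ z.1 * ((north hQ) ^ z.2 * (east hQ) ^ w.1) * (north hQ) ^ w.2 := by rw [h.eq]
    _ = _ := by group

/-- The vector to the neighbour in a direction of the compass. -/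
def dir : ZMod 8 → ℤ × ℤ := fun i =>
  (![(1, -1), (1, 0), (1, 1), (0, 1), (-1, 1), (-1, 0), (-1, -1), (0, -1)] : Fin 8 → ℤ × ℤ) i

theorem face_act_dir (f : Frame Q) (i : ZMod 8) : (act hQ (dir i) f).face = f.nbr i := by
  obtain ⟨a1, a2, a3, a4, a5, a6⟩ := move_spec hQ 0 (by decide) f
  obtain ⟨b1, b2, b3, b4, b5, b6⟩ := move_spec hQ 2 (by decide) f
  obtain ⟨c1, c2, c3, c4, c5, c6⟩ := move_spec hQ (0 + 4) (by decide) f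
  obtain ⟨d1, d2, d3, d4, d5, d6⟩ := move_spec hQ (2 + 4) (by decide) f
  have hE : ∀ g : Frame Q, act hQ (1, 0) g = move hQ 0 (by decide) g := fun g => by
    simp [act, east]
  have hN : ∀ g : Frame Q, act hQ (0, 1) g = move hQ 2 (by decide) g := fun g => by
    simp [act, north]
  have hW : ∀ g : Frame Q, act hQ (-1, 0) g = move hQ (0 + 4) (by decide) g := fun g => by
    simp [act]; rfl
  have hS : ∀ g : Frame Q, act hQ (0, -1) g = move hQ (2 + 4) (by decide) g := fun g => by
    simp [act]; rfl
  have e4 : (3 : ZMod 8) + (0 + 4) = 7 := by decide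
  have e5 : (7 : ZMod 8) + (0 + 4) = 3 := by decide
  have e6 : (2 : ZMod 8) + (0 + 4) = 6 := by decide
  have e7 : (0 : ZMod 8) + (0 + 4) = 4 := by decide
  rw [e4, e6] at c4
  rw [e5, e7] at c6
  simp only [add_zero] at a1 a4 a6
  have n3 : ∀ g : Frame Q, (move hQ 2 (by decide) g).face = g.nbr 3 := fun g =>
    (move_spec hQ 2 (by decide) g).1
  have n7 : ∀ g : Frame Q, (move hQ (2 + 4) (by decide) g).face = g.nbr 7 := fun g =>
    (move_spec hQ (2 + 4) (by decide) g).1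
  have split : ∀ a b : ℤ, act hQ (a, b) f = act hQ (0, b) (act hQ (a, 0) f) := fun a b => by
    rw [← act_add]; simp
  have key : ∀ j : Fin 8, (act hQ ((![(1, -1), (1, 0), (1, 1), (0, 1), (-1, 1), (-1, 0), (-1, -1),
      (0, -1)] : Fin 8 → ℤ × ℤ) j) f).face = f.nbr (j : ZMod 8) := by
    intro j
    fin_cases j
    · change (act hQ (1, -1) f).face = f.nbr 0
      rw [split, hE, hS, n7]
      exact a6
    · change (act hQ (1, 0) f).face = f.nbr 1
      rw [hE]; exact a1
    · change (act hQ (1, 1) f).face = f.nbr 2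
      rw [split, hE, hN, n3]
      exact a4
    · change (act hQ (0, 1) f).face = f.nbr 3
      rw [hN]; exact b1
    · change (act hQ (-1, 1) f).face = f.nbr 4
      rw [split, hW, hN, n3]
      exact c6
    · change (act hQ (-1, 0) f).face = f.nbr 5
      rw [hW]; exact c1
    · change (act hQ (-1, -1) f).face = f.nbr 6
      rw [split, hW, hS, n7]
      exact c4
    · change (act hQ (0, -1) f).face = f.nbr 7
      rw [hS]; exact d1
  exact key i

end Frame

end Frames

end SquareComplexes

namespace TwoComplex

open OneComplex

variable {X : TwoComplex.{u}}

/-! ### The developing map -/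

/-- The squares of the complex dual to `X`. -/
def DualSquare (A B C D : X.C) : Prop := ∃ v, Crossing v A B C D

theorem isSquareComplex_dualSquare (hq : ∀ F : X.C, ∃ N : ZMod 8 → X.C, QuasiFlatAt F N) :
    IsSquareComplex (DualSquare (X := X)) where
  rotate := fun ⟨v, h⟩ => ⟨v, h.rotate⟩
  reflect := fun ⟨v, h⟩ => ⟨v, h.reflect⟩
  ne_side := fun ⟨_, h⟩ => h.adj_AB.1
  ne_diag := fun ⟨_, h⟩ => h.ne_AC
  exists_frame := fun F => by
    obtain ⟨N, hN⟩ := hq F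
    exact ⟨N, hN.injective, fun i hi => hN.exists_crossing hi,
      fun A B D ⟨v, hv⟩ => hN.crossing_complete hv⟩

/-- The 2-cells at any vertex lie in one square of the dual complex. -/
theorem exists_dualSquare (hq : ∀ F : X.C, ∃ N : ZMod 8 → X.C, QuasiFlatAt F N) {v : X.V} {F : X.C}
    (hF : F ∈ facesV v) : ∃ A B D, DualSquare F A B D ∧ facesV v ⊆ {F, A, B, D} := by
  obtain ⟨N, hN⟩ := hq F
  by_cases hb : Branch v
  · obtain ⟨i, -, hc⟩ := hN.crossing hF hb
    exact ⟨_, _, _, ⟨v, hc⟩, hc.faces.subset⟩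
  · obtain ⟨k, rfl⟩ := mem_facesV.1 hF
    obtain ⟨m, hm, hlt⟩ := hN.exists_next_branch k
    obtain ⟨i, -, hc⟩ := hN.crossing (mem_facesV_of_reads F _) hm
    refine ⟨_, _, _, ⟨_, hc⟩, ?_⟩
    rw [← hc.faces, ← facesE_of_not_branch hb rfl, ← bdRead_chain,
      ← facesE_bdRead_add hlt m le_rfl]
    exact facesE_subset_dtgt _

/-- The vectors from a point of the plane to itself and to its eight neighbours. -/
def IsNear (δ : ℤ × ℤ) : Prop := δ = 0 ∨ ∃ i, δ = Frame.dir i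

/-- Differences of the corners of a unit square are among the nine vectors near zero. -/
theorem isNear_sub {i : ZMod 8} (hi : i ∈ evens) {δ δ' : ℤ × ℤ}
    (h : δ ∈ [0, Frame.dir (i - 1), Frame.dir i, Frame.dir (i + 1)])
    (h' : δ' ∈ [0, Frame.dir (i - 1), Frame.dir i, Frame.dir (i + 1)]) : IsNear (δ' - δ) := by
  have key : ∀ i ∈ evens, ∀ δ ∈ [0, Frame.dir (i - 1), Frame.dir i, Frame.dir (i + 1)],
      ∀ δ' ∈ [0, Frame.dir (i - 1), Frame.dir i, Frame.dir (i + 1)],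
      δ' - δ = 0 ∨ ∃ i, δ' - δ = Frame.dir i := by decide
  exact key i hi δ h δ' h'

theorem isNear_zero : IsNear 0 := Or.inl rfl

theorem isNear_dir (i : ZMod 8) : IsNear (Frame.dir i) := Or.inr ⟨i, rfl⟩

section Transport

variable (hQ : IsSquareComplex (DualSquare (X := X)))

/-- The vector from a 2-cell to one that meets it is well defined. -/
theorem act_near_injective {f : Frame (DualSquare (X := X))} {δ δ' : ℤ × ℤ} (h : IsNear δ)
    (h' : IsNear δ') (he : (Frame.act hQ δ f).face = (Frame.act hQ δ' f).face) : δ = δ' := by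
  rcases h with rfl | ⟨i, rfl⟩ <;> rcases h' with rfl | ⟨j, rfl⟩
  · rfl
  · rw [Frame.act_zero, Frame.face_act_dir] at he
    exact absurd he (f.isFrame.ne hQ.toIsSquareRel j)
  · rw [Frame.act_zero, Frame.face_act_dir] at he
    exact absurd he.symm (f.isFrame.ne hQ.toIsSquareRel i)
  · rw [Frame.face_act_dir, Frame.face_act_dir] at he
    rw [f.isFrame.inj he]

theorem exists_near_of_dualSquare (f : Frame (DualSquare (X := X))) {A B D : X.C}
    (h : DualSquare f.face A B D) : ∃ i ∈ evens, ∀ G ∈ ({f.face, A, B, D} : Set X.C),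
      ∃ δ ∈ [0, Frame.dir (i - 1), Frame.dir i, Frame.dir (i + 1)],
        (Frame.act hQ δ f).face = G := by
  obtain ⟨i, hi, h1, h2⟩ := f.isFrame.complete _ _ _ h
  refine ⟨i, hi, ?_⟩
  have a0 : ∃ δ ∈ [0, Frame.dir (i - 1), Frame.dir i, Frame.dir (i + 1)],
      (Frame.act hQ δ f).face = f.face := ⟨0, by simp, by rw [Frame.act_zero]⟩
  have a1 : ∃ δ ∈ [0, Frame.dir (i - 1), Frame.dir i, Frame.dir (i + 1)],
      (Frame.act hQ δ f).face = f.nbr (i - 1) :=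
    ⟨Frame.dir (i - 1), by simp, by rw [Frame.face_act_dir]⟩
  have a2 : ∃ δ ∈ [0, Frame.dir (i - 1), Frame.dir i, Frame.dir (i + 1)],
      (Frame.act hQ δ f).face = f.nbr i := ⟨Frame.dir i, by simp, by rw [Frame.face_act_dir]⟩
  have a3 : ∃ δ ∈ [0, Frame.dir (i - 1), Frame.dir i, Frame.dir (i + 1)],
      (Frame.act hQ δ f).face = f.nbr (i + 1) :=
    ⟨Frame.dir (i + 1), by simp, by rw [Frame.face_act_dir]⟩
  rcases h2 with ⟨h2, h3⟩ | ⟨h2, h3⟩ <;> subst h1 h2 h3 <;> rintro G (rfl | rfl | rfl | rfl) <;>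
    assumption

/-- The fibre over a 2-cell of the covering space that is trivialized by parallel transport: the
frames at the 2-cell, together with a position in the plane. -/
abbrev Fibre (F : X.C) : Type u := {p : Frame (DualSquare (X := X)) × (ℤ × ℤ) // p.1.face = F}

open scoped Classical in
/-- Parallel transport from a 2-cell to a 2-cell that meets it. If the two do not meet, the value
is irrelevant. -/
noncomputable def transport (F G : X.C) (p : Fibre F) : Fibre G :=
  if h : ∃ δ, IsNear δ ∧ (Frame.act hQ δ p.1.1).face = G then
    ⟨(Frame.act hQ h.choose p.1.1, p.1.2 + h.choose), h.choose_spec.2⟩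
  else ⟨(⟨(G, (hQ.exists_frame G).choose), (hQ.exists_frame G).choose_spec⟩, 0), rfl⟩

theorem transport_eq {F G : X.C} (p : Fibre F) {δ : ℤ × ℤ} (hδ : IsNear δ)
    (hG : (Frame.act hQ δ p.1.1).face = G) :
    (transport hQ F G p).1 = (Frame.act hQ δ p.1.1, p.1.2 + δ) := by
  have h : ∃ δ, IsNear δ ∧ (Frame.act hQ δ p.1.1).face = G := ⟨δ, hδ, hG⟩
  have : h.choose = δ :=
    act_near_injective hQ h.choose_spec.1 hδ (h.choose_spec.2.trans hG.symm)
  rw [transport, dif_pos h]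
  change (Frame.act hQ h.choose p.1.1, p.1.2 + h.choose) = _
  rw [this]

end Transport

/-- A simply connected quasi-flat complex has its 2-cells indexed by the points of the integer
lattice in such a way that the translates of the eight directions are frames. -/
theorem exists_development [SimplyConnectedSpace X.Realization] (hX : X.FaceCovered)
    (hne : Nonempty X.C) (hq : ∀ F : X.C, ∃ N : ZMod 8 → X.C, QuasiFlatAt F N) :
    ∃ ρ : ℤ × ℤ ≃ X.C, ∀ w, IsFrame DualSquare (ρ w) fun i => ρ (w + Frame.dir i) := by
  have hQ := isSquareComplex_dualSquare hq
  obtain ⟨F₀⟩ := hne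
  let f₀ : Frame (DualSquare (X := X)) :=
    ⟨(F₀, (hQ.exists_frame F₀).choose), (hQ.exists_frame F₀).choose_spec⟩
  have hloc : ∀ (v : X.V) (f : Frame (DualSquare (X := X))), f.face ∈ facesV v →
      ∃ i ∈ evens, ∀ G ∈ facesV v,
        ∃ δ ∈ [0, Frame.dir (i - 1), Frame.dir i, Frame.dir (i + 1)],
          (Frame.act hQ δ f).face = G := by
    intro v f hF
    obtain ⟨A, B, D, hsq, hsub⟩ := exists_dualSquare hq hF
    obtain ⟨i, hi, h⟩ := exists_near_of_dualSquare hQ f hsq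
    exact ⟨i, hi, fun G hG => h G (hsub hG)⟩
  have hnear : ∀ {i : ZMod 8} (_ : i ∈ evens) {δ : ℤ × ℤ},
      δ ∈ [0, Frame.dir (i - 1), Frame.dir i, Frame.dir (i + 1)] → IsNear δ := by
    intro i hi δ hδ
    simpa using isNear_sub hi (show (0 : ℤ × ℤ) ∈ _ by simp) hδ
  obtain ⟨s, hs0, hs⟩ := exists_face_section hX (T := Fibre) (transport hQ)
    (by
      intro F p
      apply Subtype.ext
      rw [transport_eq hQ p isNear_zero (by rw [Frame.act_zero]; exact p.2), Frame.act_zero,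
        add_zero])
    (by
      intro v F G H hF hG hH p
      obtain ⟨i, hi, h⟩ := hloc v p.1.1 (by rw [p.2]; exact hF)
      obtain ⟨δ, hδ, hδG⟩ := h G hG
      obtain ⟨δ', hδ', hδH⟩ := h H hH
      have e := transport_eq hQ p (hnear hi hδ) hδG
      have e' := transport_eq hQ p (hnear hi hδ') hδH
      have hact : Frame.act hQ (δ' - δ) (transport hQ F G p).1.1 = Frame.act hQ δ' p.1.1 := by
        rw [e, ← Frame.act_add, sub_add_cancel]
      apply Subtype.ext
      rw [transport_eq hQ (transport hQ F G p) (isNear_sub hi hδ hδ') (by rw [hact, hδH]), hact, e',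
        e]
      simp)
    F₀ ⟨(f₀, 0), rfl⟩
  -- The section `s` is parallel.
  have hstep : ∀ (F : X.C) (v : X.V) (δ : ℤ × ℤ), IsNear δ → F ∈ facesV v →
      (Frame.act hQ δ (s F).1.1).face ∈ facesV v →
      (s (Frame.act hQ δ (s F).1.1).face).1 = (Frame.act hQ δ (s F).1.1, (s F).1.2 + δ) := by
    intro F v δ hδ hF hG
    rw [hs v F _ hF hG]
    exact transport_eq hQ (s F) hδ rfl
  have hmeet : ∀ (f : Frame (DualSquare (X := X))) (i : ZMod 8), ∃ v, f.face ∈ facesV v ∧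
      (Frame.act hQ (Frame.dir i) f).face ∈ facesV v := by
    intro f i
    rw [Frame.face_act_dir]
    by_cases hi : i ∈ evens
    · obtain ⟨v, hv⟩ := f.isFrame.quad i hi
      exact ⟨v, by rw [hv.faces]; simp, by rw [hv.faces]; simp⟩
    · have : i + 1 ∈ evens := by revert i; decide
      obtain ⟨v, hv⟩ := f.isFrame.quad (i + 1) this
      rw [add_sub_cancel_right] at hv
      exact ⟨v, by rw [hv.faces]; simp, by rw [hv.faces]; simp⟩
  -- The value of `s` at `ρ w` has `w` as its second component, and so `ρ` is injective.
  let ρ : ℤ × ℤ → X.C := fun w => (Frame.act hQ w f₀).face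
  let P : ℤ × ℤ → Prop := fun w => (s (ρ w)).1 = (Frame.act hQ w f₀, w)
  have hP0 : P 0 := by
    have : ρ 0 = F₀ := by simp only [ρ, Frame.act_zero]; rfl
    simp only [P]
    rw [this, hs0, Frame.act_zero]
  have hPs : ∀ w i, P w → P (w + Frame.dir i) := by
    intro w i hw
    have hw1 : (s (ρ w)).1.1 = Frame.act hQ w f₀ := congrArg Prod.fst hw
    have hw2 : (s (ρ w)).1.2 = w := congrArg Prod.snd hw
    obtain ⟨v, hv1, hv2⟩ := hmeet (Frame.act hQ w f₀) i
    have h := hstep (ρ w) v (Frame.dir i) (isNear_dir i) hv1 (by rw [hw1]; exact hv2)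
    have e : Frame.act hQ (w + Frame.dir i) f₀ = Frame.act hQ (Frame.dir i) (s (ρ w)).1.1 := by
      rw [hw1, ← Frame.act_add, add_comm]
    change (s (Frame.act hQ (w + Frame.dir i) f₀).face).1 = _
    rw [e, h, hw2]
  have hP : ∀ w, P w := by
    have hP1 : ∀ a : ℤ, P (a, 0) := by
      intro a
      induction a using Int.induction_on with
      | zero => exact hP0
      | succ a ih =>
        have := hPs _ 1 ih
        simpa [Frame.dir] using this
      | pred a ih =>
        have := hPs _ 5 ih
        simpa [Frame.dir, sub_eq_add_neg] using this
    rintro ⟨a, b⟩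
    induction b using Int.induction_on with
    | zero => exact hP1 a
    | succ b ih =>
      have := hPs _ 3 ih
      simpa [Frame.dir] using this
    | pred b ih =>
      have := hPs _ 7 ih
      simpa [Frame.dir, sub_eq_add_neg] using this
  have hinj : Function.Injective ρ := by
    intro w w' h
    have h1 := hP w
    have h2 := hP w'
    simp only [P] at h1 h2
    have := congrArg (fun F => (s F).1.2) h
    simpa [h1, h2] using this
  -- All 2-cells that meet a 2-cell in the range of `ρ` are in the range.
  have hclosed : ∀ v F G, F ∈ facesV v → G ∈ facesV v → F ∈ Set.range ρ → G ∈ Set.range ρ := by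
    rintro v _ G hF hG ⟨w, rfl⟩
    obtain ⟨i, hi, h⟩ := hloc v (Frame.act hQ w f₀) hF
    obtain ⟨δ, -, hδ⟩ := h G hG
    exact ⟨δ + w, by simp only [ρ]; rw [Frame.act_add, hδ]⟩
  have hsurj : Function.Surjective ρ := by
    intro G
    have h := rel_of_common_vertex hX (r := fun F G => F ∈ Set.range ρ ↔ G ∈ Set.range ρ)
      ⟨fun _ => Iff.rfl, Iff.symm, Iff.trans⟩
      (fun v F G hF hG => ⟨hclosed v F G hF hG, hclosed v G F hG hF⟩) (ρ 0) G
    exact h.1 ⟨0, rfl⟩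
  refine ⟨Equiv.ofBijective ρ ⟨hinj, hsurj⟩, fun w => ?_⟩
  have hnbr : (Frame.act hQ w f₀).nbr = fun i => ρ (w + Frame.dir i) := by
    funext i
    simp only [ρ]
    rw [add_comm, Frame.act_add, Frame.face_act_dir]
  have := (Frame.act hQ w f₀).isFrame
  rw [hnbr] at this
  exact this

end TwoComplex

namespace OneComplex

variable {X : OneComplex.{u}}

theorem isWalk_append {v w : X.V} {P Q : List X.Dart} :
    IsWalk v (P ++ Q) w ↔ ∃ a, IsWalk v P a ∧ IsWalk a Q w := by
  induction P generalizing v with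
  | nil => simp [IsWalk]
  | cons d P ih => simp [IsWalk, ih, and_assoc]

theorem IsWalk.end_mem {v w : X.V} {P : List X.Dart} (h : IsWalk v P w) :
    w ∈ v :: P.map dtgt := by
  induction P generalizing v with
  | nil => simp only [IsWalk] at h; simp [h]
  | cons d P ih =>
    have := ih h.2
    simp only [List.map_cons, List.mem_cons] at this ⊢
    tauto

/-- An embedded path does not turn back at an interior vertex. -/
theorem exists_ne_rev_of_mem_path {v w a : X.V} {P : List X.Dart} (h : IsWalk v P w)
    (hn : (v :: P.map dtgt).Nodup) (ha : a ∈ v :: P.map dtgt) (hv : a ≠ v) (hw : a ≠ w) :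
    ∃ d ∈ P, ∃ d' ∈ P, dtgt d = a ∧ dsrc d' = a ∧ rev d ≠ d' := by
  obtain ⟨d, hd, rfl⟩ := List.mem_map.1 ((List.mem_cons.1 ha).resolve_left hv)
  obtain ⟨P₁, P₂, rfl⟩ := List.append_of_mem hd
  obtain ⟨b, h1, h2⟩ := isWalk_append.1 h
  cases P₂ with
  | nil => exact absurd h2.2 hw
  | cons d' P₃ =>
    refine ⟨d, by simp, d', by simp, rfl, h2.2.1, ?_⟩
    rintro rfl
    have hb : b ∈ v :: P₁.map dtgt := h1.end_mem
    rw [List.map_append, ← List.cons_append] at hn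
    refine List.disjoint_of_nodup_append hn hb ?_
    simp [h2.1]

end OneComplex

namespace TwoComplex

open OneComplex

variable {X : TwoComplex.{u}}

/-! ### The lattice labelling of the branch vertices -/

/-- The four octagons of the model around the vertical edge at `c`. -/
def around (c : ℤ × ℤ) : Set (ℤ × ℤ) := {c, (c.1 - 1, c.2), (c.1 - 1, c.2 - 1), (c.1, c.2 - 1)}

theorem around_injective : Function.Injective around := by
  intro c c' h
  have h1 : c ∈ around c' := h ▸ Or.inl rfl
  have h2 : c' ∈ around c := h ▸ Or.inl rfl
  rcases c with ⟨i, j⟩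
  rcases c' with ⟨i', j'⟩
  simp only [around, Set.mem_insert_iff, Set.mem_singleton_iff, Prod.mk.injEq] at h1 h2 ⊢
  omega

/-- The 2-cells around the branch vertex `v` are those with labels in `around c`. -/
def CrossAt (ρ : ℤ × ℤ ≃ X.C) (v : X.V) (c : ℤ × ℤ) : Prop :=
  Crossing v (ρ c) (ρ (c.1 - 1, c.2)) (ρ (c.1 - 1, c.2 - 1)) (ρ (c.1, c.2 - 1))

variable {ρ : ℤ × ℤ ≃ X.C}

theorem image_around (c : ℤ × ℤ) : ρ '' around c =
    {ρ c, ρ (c.1 - 1, c.2), ρ (c.1 - 1, c.2 - 1), ρ (c.1, c.2 - 1)} := by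
  simp [around, Set.image_insert_eq]

theorem CrossAt.faces {v : X.V} {c : ℤ × ℤ} (h : CrossAt ρ v c) : facesV v = ρ '' around c := by
  rw [image_around]
  exact Crossing.faces h

section

variable (hρ : ∀ w, IsFrame DualSquare (ρ w) fun i => ρ (w + Frame.dir i))
include hρ

/-- There is a branch vertex at each `c`: the square in the direction `6`, south-west, of the frame
at `ρ c`. -/
theorem exists_crossAt_vertex (c : ℤ × ℤ) : ∃ v, CrossAt ρ v c := by
  obtain ⟨v, hv⟩ := (hρ c).quad 6 (by decide)
  refine ⟨v, ?_⟩
  rcases c with ⟨i, j⟩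
  have e5 : Frame.dir (6 - 1) = (-1, 0) := rfl
  have e6 : Frame.dir 6 = (-1, -1) := rfl
  have e7 : Frame.dir (6 + 1) = (0, -1) := rfl
  rw [e5, e6, e7] at hv
  simpa [CrossAt, sub_eq_add_neg] using hv

/-- Every branch vertex has a position, which depends on the direction in which its square lies from
one of its 2-cells. -/
theorem exists_crossAt (hX : X.FaceCovered)
    (hq : ∀ F : X.C, ∃ N : ZMod 8 → X.C, QuasiFlatAt F N) {v : X.V} (hb : Branch v) :
    ∃ c, CrossAt ρ v c := by
  obtain ⟨F, k, hk⟩ := hX.vert v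
  obtain ⟨⟨i, j⟩, rfl⟩ := ρ.surjective F
  obtain ⟨N, hN⟩ := hq (ρ (i, j))
  obtain ⟨l, -, hc⟩ := hN.crossing (v := v) (mem_facesV.2 ⟨k, hk⟩) hb
  have key : ∀ A B D : X.C, Crossing v (ρ (i, j)) A B D →
      ∃ l ∈ evens, Crossing v (ρ (i, j)) (ρ ((i, j) + Frame.dir (l - 1)))
        (ρ ((i, j) + Frame.dir l)) (ρ ((i, j) + Frame.dir (l + 1))) := by
    intro A B D h
    obtain ⟨l, hl, h1, ⟨h2, h3⟩ | ⟨h2, h3⟩⟩ := (hρ (i, j)).complete A B D ⟨v, h⟩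
    · subst h1 h2 h3; exact ⟨l, hl, h⟩
    · subst h1 h2 h3; exact ⟨l, hl, h.reflect⟩
  obtain ⟨l, hl, h⟩ := key _ _ _ hc
  have hl' : l = 0 ∨ l = 2 ∨ l = 4 ∨ l = 6 := by simpa [evens, or_assoc] using hl
  have d0 : Frame.dir 0 = (1, -1) := rfl
  have d1 : Frame.dir 1 = (1, 0) := rfl
  have d2 : Frame.dir 2 = (1, 1) := rfl
  have d3 : Frame.dir 3 = (0, 1) := rfl
  have d4 : Frame.dir 4 = (-1, 1) := rfl
  have d5 : Frame.dir 5 = (-1, 0) := rfl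
  have d6 : Frame.dir 6 = (-1, -1) := rfl
  have d7 : Frame.dir 7 = (0, -1) := rfl
  rcases hl' with rfl | rfl | rfl | rfl
  · refine ⟨(i + 1, j), ?_⟩
    rw [show (0 : ZMod 8) - 1 = 7 by decide, zero_add, d0, d1, d7] at h
    simpa [CrossAt, sub_eq_add_neg] using h.rotate.rotate.rotate
  · refine ⟨(i + 1, j + 1), ?_⟩
    rw [show (2 : ZMod 8) - 1 = 1 by decide, show (2 : ZMod 8) + 1 = 3 by decide, d1, d2, d3] at h
    simpa [CrossAt, sub_eq_add_neg] using h.rotate.rotate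
  · refine ⟨(i, j + 1), ?_⟩
    rw [show (4 : ZMod 8) - 1 = 3 by decide, show (4 : ZMod 8) + 1 = 5 by decide, d3, d4, d5] at h
    simpa [CrossAt, sub_eq_add_neg] using h.rotate
  · refine ⟨(i, j), ?_⟩
    rw [show (6 : ZMod 8) - 1 = 5 by decide, show (6 : ZMod 8) + 1 = 7 by decide, d5, d6, d7] at h
    simpa [CrossAt, sub_eq_add_neg] using h

theorem crossAt_of_faces (hX : X.FaceCovered)
    (hq : ∀ F : X.C, ∃ N : ZMod 8 → X.C, QuasiFlatAt F N) {v : X.V} (hb : Branch v) {c : ℤ × ℤ}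
    (hc : facesV v = ρ '' around c) : CrossAt ρ v c := by
  obtain ⟨c', h⟩ := exists_crossAt hρ hX hq hb
  have : around c' = around c := ρ.injective.image_injective (h.faces.symm.trans hc)
  rwa [around_injective this] at h

end

/-- The branch vertices at the crossing `c` are `v₀` and `v₁`, which may coincide. The darts `dE`,
`dW` at `v₀` and `dN`, `dS` at `v₁` leave in the directions of the compass, and `z₀`, `z₁` lead
from `v₀` to `v₁` and back in case these are distinct. -/
structure CornerData (ρ : ℤ × ℤ ≃ X.C) (c : ℤ × ℤ) (v₀ v₁ : X.V) (dE dW dN dS z₀ z₁ : X.Dart) :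
    Prop where
  branch₀ : Branch v₀
  branch₁ : Branch v₁
  faces₀ : facesV v₀ = ρ '' around c
  faces₁ : facesV v₁ = ρ '' around c
  eq_or_eq : ∀ w, Branch w → facesV w = ρ '' around c → w = v₀ ∨ w = v₁
  src_E : dsrc dE = v₀
  src_W : dsrc dW = v₀
  src_N : dsrc dN = v₁
  src_S : dsrc dS = v₁
  faces_E : facesE dE.1 = {ρ c, ρ (c.1, c.2 - 1)}
  faces_W : facesE dW.1 = {ρ (c.1 - 1, c.2), ρ (c.1 - 1, c.2 - 1)}
  faces_N : facesE dN.1 = {ρ c, ρ (c.1 - 1, c.2)}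
  faces_S : facesE dS.1 = {ρ (c.1, c.2 - 1), ρ (c.1 - 1, c.2 - 1)}
  link_of_eq : v₀ = v₁ → linkVertices v₀ = {dE, dW, dN, dS}
  src_z₀ : v₀ ≠ v₁ → dsrc z₀ = v₀
  src_z₁ : v₀ ≠ v₁ → dsrc z₁ = v₁
  faces_z₀ : v₀ ≠ v₁ → facesE z₀.1 = ρ '' around c
  faces_z₁ : v₀ ≠ v₁ → facesE z₁.1 = ρ '' around c
  link₀ : v₀ ≠ v₁ → linkVertices v₀ = {dE, dW, z₀}
  link₁ : v₀ ≠ v₁ → linkVertices v₁ = {dN, dS, z₁}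

/-- The two branch vertices of a crossing with a vertical edge, and no others, have the given
2-cells around them. -/
theorem QuasiFlatAt.eq_or_eq_of_isArc {F : X.C} {N : ZMod 8 → X.C} (h : QuasiFlatAt F N)
    {v v' w : X.V} {G : X.C} (harc : IsArc (closedCell F ∩ closedCell G) v v') (hb : Branch w)
    (hF : F ∈ facesV w) (hG : G ∈ facesV w) (hopp : ∃ A B, Crossing w F A G B) :
    w = v ∨ w = v' := by
  obtain ⟨P, -, hP, hn, hK⟩ := harc
  have hw : Cell.vert w ∈ closedCell F ∩ closedCell G := ⟨hF, hG⟩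
  have hv : Cell.vert v ∈ closedCell F ∩ closedCell G := by
    rw [hK]; exact Or.inl ⟨v, by simp, rfl⟩
  have hw' := hw
  rw [hK] at hw'
  obtain ⟨a, ha, hwa⟩ := hw'.resolve_right (by rintro ⟨d, -, hd⟩; cases hd)
  obtain rfl : w = a := by simpa using hwa
  by_contra hcon
  push Not at hcon
  obtain ⟨d, hd, d', hd', h1, h2, hne⟩ := exists_ne_rev_of_mem_path hP hn ha hcon.1 hcon.2
  have hmem : ∀ d ∈ P, F ∈ facesE d.1 ∧ G ∈ facesE d.1 := by
    intro d hd
    have : Cell.edge d.1 ∈ closedCell F ∩ closedCell G := by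
      rw [hK]; exact Or.inr ⟨d, hd, rfl⟩
    exact this
  obtain ⟨A', B', hcr'⟩ := hopp
  obtain ⟨i, hi, A, B, hAB, hstar⟩ := h.star hF hb
  have hcr := h.crossing_of_star hb hi hAB
    (hstar.imp And.right fun ⟨v', _, _, h1, h2⟩ => ⟨v', h1, h2⟩)
  obtain ⟨rfl, -⟩ := hcr'.unique hcr
  rcases hstar with ⟨hint, -⟩ | ⟨-, -, -, ⟨s, p, q, st⟩, -⟩
  · rw [hint] at hv
    exact hcon.1 (by simpa using hv.symm)
  · have key : ∀ x, dsrc x = w → F ∈ facesE x.1 → N i ∈ facesE x.1 → x = s := by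
      intro x hx hxF hxG
      have hx' : x ∈ linkVertices w := hx
      rw [st.darts] at hx'
      rcases hx' with rfl | rfl | rfl
      · rfl
      · rw [st.faces_p] at hxG
        rcases hxG with e | e
        · exact absurd e.symm hcr.ne_AC
        · exact absurd e.symm hcr.adj_BC.1
      · rw [st.faces_q] at hxF
        rcases hxF with e | e
        · exact absurd e hcr.ne_AC
        · exact absurd e.symm hcr.adj_DA.1
    apply hne
    rw [key d' h2 (hmem d' hd').1 (hmem d' hd').2,
      key (rev d) (by rw [dsrc_rev, h1]) (hmem d hd).1 (hmem d hd).2]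

/-- The crossing at `c` is seen from the 2-cell `ρ c`, whose local conditions describe it as a
vertex or as an arc. The two cases within each are the two senses of rotation. -/
theorem exists_cornerData (hX : X.FaceCovered)
    (hρ : ∀ w, IsFrame DualSquare (ρ w) fun i => ρ (w + Frame.dir i))
    (hq : ∀ F : X.C, ∃ N : ZMod 8 → X.C, QuasiFlatAt F N) (c : ℤ × ℤ) :
    ∃ v₀ v₁ dE dW dN dS z₀ z₁, CornerData ρ c v₀ v₁ dE dW dN dS z₀ z₁ := by
  obtain ⟨v, hv⟩ := exists_crossAt_vertex hρ c
  have hvb : Branch v := Crossing.branch hv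
  obtain ⟨N, hN⟩ := hq (ρ c)
  have hF : ρ c ∈ facesV v := by rw [hv.faces]; exact ⟨c, Or.inl rfl, rfl⟩
  obtain ⟨i, hi, A, B, hAB, hstar⟩ := hN.star hF hvb
  have hcr := hN.crossing_of_star hvb hi hAB
    (hstar.imp And.right fun ⟨v', _, _, h1, h2⟩ => ⟨v', h1, h2⟩)
  obtain ⟨hSW, hWS⟩ := Crossing.unique hv hcr
  have hcross : ∀ w, Branch w → facesV w = ρ '' around c → CrossAt ρ w c := fun w hb hw =>
    crossAt_of_faces hρ hX hq hb hw
  have hmem : ∀ w, facesV w = ρ '' around c →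
      ρ c ∈ facesV w ∧ ρ (c.1 - 1, c.2 - 1) ∈ facesV w := by
    intro w hw
    rw [hw]
    exact ⟨⟨c, Or.inl rfl, rfl⟩, ⟨_, Or.inr (Or.inr (Or.inl rfl)), rfl⟩⟩
  rcases hstar with ⟨hint, hst⟩ | ⟨v', harc, hb', hst, hst'⟩
  · -- The crossing is a vertex of valence four.
    have huniq : ∀ w, Branch w → facesV w = ρ '' around c → w = v ∨ w = v := by
      intro w hb hw
      have : Cell.vert w ∈ closedCell (ρ c) ∩ closedCell (N i) := by
        rw [← hSW]; exact hmem w hw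
      rw [hint] at this
      left
      simpa using this
    obtain ⟨p, q, r, s, st⟩ := hst
    rcases hWS with ⟨hA, hB⟩ | ⟨hA, hB⟩
    · subst hA hB
      rw [← hSW] at st
      refine ⟨v, v, s, q, p, r, p, p, hvb, hvb, hv.faces, hv.faces, huniq, ?_, ?_, ?_, ?_,
        ?_, ?_, ?_, ?_, fun _ => ?_, fun h => absurd rfl h, fun h => absurd rfl h,
        fun h => absurd rfl h, fun h => absurd rfl h, fun h => absurd rfl h,
        fun h => absurd rfl h⟩
      · change s ∈ linkVertices v; rw [st.darts]; simp
      · change q ∈ linkVertices v; rw [st.darts]; simp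
      · change p ∈ linkVertices v; rw [st.darts]; simp
      · change r ∈ linkVertices v; rw [st.darts]; simp
      · rw [st.faces_s, Set.pair_comm]
      · exact st.faces_q
      · exact st.faces_p
      · rw [st.faces_r, Set.pair_comm]
      · rw [st.darts]; ext; simp; tauto
    · subst hA hB
      rw [← hSW] at st
      refine ⟨v, v, p, r, s, q, p, p, hvb, hvb, hv.faces, hv.faces, huniq, ?_, ?_, ?_, ?_,
        ?_, ?_, ?_, ?_, fun _ => ?_, fun h => absurd rfl h, fun h => absurd rfl h,
        fun h => absurd rfl h, fun h => absurd rfl h, fun h => absurd rfl h,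
        fun h => absurd rfl h⟩
      · change p ∈ linkVertices v; rw [st.darts]; simp
      · change r ∈ linkVertices v; rw [st.darts]; simp
      · change s ∈ linkVertices v; rw [st.darts]; simp
      · change q ∈ linkVertices v; rw [st.darts]; simp
      · exact st.faces_p
      · rw [st.faces_r, Set.pair_comm]
      · rw [st.faces_s, Set.pair_comm]
      · exact st.faces_q
      · rw [st.darts]; ext; simp; tauto
  · -- The crossing is an arc with two ends of valence three.
    have huniq : ∀ w, Branch w → facesV w = ρ '' around c → w = v ∨ w = v' := by
      intro w hb hw
      refine hN.eq_or_eq_of_isArc harc hb (hmem w hw).1 ?_ ?_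
      · rw [← hSW]; exact (hmem w hw).2
      · rw [← hSW]; exact ⟨_, _, hcross w hb hw⟩
    obtain ⟨s, p, q, st⟩ := hst
    obtain ⟨s', p', q', st'⟩ := hst'
    rcases hWS with ⟨hA, hB⟩ | ⟨hA, hB⟩
    · subst hA hB
      rw [← hSW] at st st'
      have hs : facesE s.1 = ρ '' around c := by rw [st.faces_s, image_around]
      have hs' : facesE s'.1 = ρ '' around c := by
        rw [st'.faces_s, image_around]; ext; simp; tauto
      refine ⟨v', v, p', q', p, q, s', s, hb', hvb, ?_, hv.faces, fun w h1 h2 => (huniq w h1 h2).symm,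
        ?_, ?_, ?_, ?_, st'.faces_p, ?_, st.faces_p, ?_, ?_, fun _ => ?_, fun _ => ?_,
        fun _ => hs', fun _ => hs, fun _ => ?_, fun _ => ?_⟩
      · rw [st'.faces, image_around]; ext; simp; tauto
      · change p' ∈ linkVertices v'; rw [st'.darts]; simp
      · change q' ∈ linkVertices v'; rw [st'.darts]; simp
      · change p ∈ linkVertices v; rw [st.darts]; simp
      · change q ∈ linkVertices v; rw [st.darts]; simp
      · rw [st'.faces_q, Set.pair_comm]
      · rw [st.faces_q, Set.pair_comm]
      · -- The links of the two ends are different.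
        rintro rfl
        exfalso
        have hp : p ∈ linkVertices v' := by rw [st.darts]; simp
        have hW := hv.adj_AB.1
        have hWSW := hv.adj_BC.1
        have hSWS := hv.adj_CD.1
        have hOSW := hv.ne_AC
        have hWS := hv.ne_BD
        have hSO := hv.adj_DA.1
        have hpS : ρ (c.1, c.2 - 1) ∉ facesE p.1 := by
          rw [st.faces_p]; simp only [Set.mem_insert_iff, Set.mem_singleton_iff]; tauto
        have hpO : ρ c ∈ facesE p.1 := by rw [st.faces_p]; simp
        rw [st'.darts] at hp
        rcases hp with rfl | rfl | rfl
        · apply hpS; rw [st'.faces_s]; simp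
        · apply hpS; rw [st'.faces_p]; simp
        · rw [st'.faces_q] at hpO
          simp only [Set.mem_insert_iff, Set.mem_singleton_iff] at hpO
          tauto
      · change s' ∈ linkVertices v'; rw [st'.darts]; simp
      · change s ∈ linkVertices v; rw [st.darts]; simp
      · rw [st'.darts]; ext; simp; tauto
      · rw [st.darts]; ext; simp; tauto
    · subst hA hB
      rw [← hSW] at st st'
      have hs : facesE s.1 = ρ '' around c := by
        rw [st.faces_s, image_around]; ext; simp; tauto
      have hs' : facesE s'.1 = ρ '' around c := by rw [st'.faces_s, image_around]
      refine ⟨v, v', p, q, p', q', s, s', hvb, hb', hv.faces, ?_, huniq,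
        ?_, ?_, ?_, ?_, st.faces_p, ?_, st'.faces_p, ?_, ?_, fun _ => ?_, fun _ => ?_,
        fun _ => hs, fun _ => hs', fun _ => ?_, fun _ => ?_⟩
      · rw [st'.faces, image_around]
      · change p ∈ linkVertices v; rw [st.darts]; simp
      · change q ∈ linkVertices v; rw [st.darts]; simp
      · change p' ∈ linkVertices v'; rw [st'.darts]; simp
      · change q' ∈ linkVertices v'; rw [st'.darts]; simp
      · rw [st.faces_q, Set.pair_comm]
      · rw [st'.faces_q, Set.pair_comm]
      · rintro rfl
        exfalso
        have hp : p ∈ linkVertices v := by rw [st.darts]; simp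
        have hW := hv.adj_AB.1
        have hWSW := hv.adj_BC.1
        have hSWS := hv.adj_CD.1
        have hOSW := hv.ne_AC
        have hWS := hv.ne_BD
        have hSO := hv.adj_DA.1
        have hpW : ρ (c.1 - 1, c.2) ∉ facesE p.1 := by
          rw [st.faces_p]; simp only [Set.mem_insert_iff, Set.mem_singleton_iff]; tauto
        have hpO : ρ c ∈ facesE p.1 := by rw [st.faces_p]; simp
        rw [st'.darts] at hp
        rcases hp with rfl | rfl | rfl
        · apply hpW; rw [st'.faces_s]; simp
        · apply hpW; rw [st'.faces_p]; simp
        · rw [st'.faces_q] at hpO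
          simp only [Set.mem_insert_iff, Set.mem_singleton_iff] at hpO
          tauto
      · change s ∈ linkVertices v; rw [st.darts]; simp
      · change s' ∈ linkVertices v'; rw [st'.darts]; simp
      · rw [st.darts]; ext; simp; tauto
      · rw [st'.darts]; ext; simp; tauto

/-! ### Boundary readings and lines between branch vertices -/

/-- A biinfinite edge path without backtracking. -/
structure IsRoute (R : ℤ → X.Dart) : Prop where
  chain : ∀ k, dtgt (R k) = dsrc (R (k + 1))
  imm : ∀ k, R (k + 1) ≠ rev (R k)

/-- The edge path `R` traversed backwards, starting with the side before `k₀`. -/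
def backward (R : ℤ → X.Dart) (k₀ k : ℤ) : X.Dart := rev (R (k₀ - 1 - k))

theorem IsRoute.backward {R : ℤ → X.Dart} (h : IsRoute R) (k₀ : ℤ) :
    IsRoute (backward R k₀) where
  chain k := by
    have := h.chain (k₀ - 1 - (k + 1))
    rw [show k₀ - 1 - (k + 1) + 1 = k₀ - 1 - k by ring] at this
    simp only [TwoComplex.backward, dtgt_rev, dsrc_rev, this]
  imm k := by
    have := h.imm (k₀ - 1 - (k + 1))
    rw [show k₀ - 1 - (k + 1) + 1 = k₀ - 1 - k by ring] at this
    simp only [TwoComplex.backward, rev_rev]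
    exact fun e => this e.symm

theorem IsRoute.dsrc_backward {R : ℤ → X.Dart} (h : IsRoute R) (k₀ k : ℤ) :
    dsrc (TwoComplex.backward R k₀ k) = dsrc (R (k₀ - k)) := by
  rw [TwoComplex.backward, dsrc_rev, h.chain]
  congr 2
  ring

theorem IsRoute.readPt_backward {R : ℤ → X.Dart} (h : IsRoute R) (k₀ : ℤ) (s : ℝ) :
    readPt (TwoComplex.backward R k₀) s = readPt R (k₀ - s) := by
  by_cases hs : Int.fract s = 0
  · obtain ⟨m, rfl⟩ : ∃ m : ℤ, s = m := ⟨⌊s⌋, by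
      have := Int.floor_add_fract s
      rw [hs, add_zero] at this
      exact this.symm⟩
    rw [← Int.cast_sub, readPt_intCast, readPt_intCast, h.dsrc_backward]
  · have h0 : 0 < Int.fract s := lt_of_le_of_ne (Int.fract_nonneg s) (Ne.symm hs)
    have h1 := Int.fract_lt_one s
    have hfl : ⌊(k₀ : ℝ) - s⌋ = k₀ - 1 - ⌊s⌋ := by
      rw [Int.floor_eq_iff]
      push_cast
      have := Int.floor_add_fract s
      constructor <;> linarith
    have hfr : Int.fract ((k₀ : ℝ) - s) = 1 - Int.fract s := by
      rw [Int.fract, hfl]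
      push_cast
      have := Int.floor_add_fract s
      linarith
    rw [readPt, TwoComplex.backward, dartPt_rev, readPt, hfl]
    congr 1
    apply Subtype.ext
    simp [hfr]

theorem isRoute_bdRead (F : X.C) : IsRoute (bdRead F) := ⟨bdRead_chain F, bdRead_imm F⟩

theorem IsRoute.shift {R : ℤ → X.Dart} (h : IsRoute R) (a : ℤ) : IsRoute fun k => R (a + k) where
  chain k := by rw [h.chain, add_assoc]
  imm k := by rw [← add_assoc]; exact h.imm _

/-- `R` is the boundary path of `F`, read in either direction from any vertex. -/
def IsReading (F : X.C) (R : ℤ → X.Dart) : Prop :=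
  ∃ k₀ : ℤ, (R = fun k => bdRead F (k₀ + k)) ∨ R = backward (bdRead F) k₀

theorem exists_isReading {F : X.C} {d : X.Dart} (hd : F ∈ facesE d.1) :
    ∃ R, IsReading F R ∧ R 0 = d := by
  obtain ⟨k, hk⟩ := mem_facesE.1 hd
  rcases eq_or_eq_rev_of_fst_eq hk with h | h
  · exact ⟨fun j => bdRead F (k + j), ⟨k, Or.inl rfl⟩, by simp [h]⟩
  · exact ⟨backward (bdRead F) (k + 1), ⟨k + 1, Or.inr rfl⟩, by simp [backward, h]⟩

namespace IsReading

variable {F : X.C} {R : ℤ → X.Dart}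

theorem isRoute (h : IsReading F R) : IsRoute R := by
  obtain ⟨k₀, rfl | rfl⟩ := h
  · exact (isRoute_bdRead F).shift k₀
  · exact (isRoute_bdRead F).backward k₀

theorem mem (h : IsReading F R) (k : ℤ) : F ∈ facesE (R k).1 := by
  obtain ⟨k₀, rfl | rfl⟩ := h
  · exact mem_facesE_of_reads F _
  · rw [backward, rev_fst]; exact mem_facesE_of_reads F _

theorem add_len (h : IsReading F R) (k : ℤ) : R (k + X.len F) = R k := by
  obtain ⟨k₀, rfl | rfl⟩ := h
  · have := bdRead_add_len F (k₀ + k) 1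
    simpa [add_assoc] using this
  · have := bdRead_add_len F (k₀ - 1 - k) (-1)
    simp only [backward]
    rw [← this]
    congr 2
    ring

theorem dvd_of_dsrc_eq (h : IsReading F R) {N : ZMod 8 → X.C} (hN : QuasiFlatAt F N) {k k' : ℤ}
    (hkk : dsrc (R k) = dsrc (R k')) : (X.len F : ℤ) ∣ k' - k := by
  rw [← ZMod.intCast_eq_intCast_iff_dvd_sub]
  obtain ⟨k₀, rfl | rfl⟩ := h
  · have := hN.dsrc_injective hkk
    push_cast at this
    exact add_left_cancel this
  · rw [(isRoute_bdRead F).dsrc_backward, (isRoute_bdRead F).dsrc_backward] at hkk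
    have := hN.dsrc_injective hkk
    push_cast at this
    exact sub_right_injective this

theorem ne_rev (h : IsReading F R) {N : ZMod 8 → X.C} (hN : QuasiFlatAt F N) (k k' : ℤ) :
    R k ≠ rev (R k') := by
  intro e
  have h1 : dsrc (R k) = dsrc (R (k' + 1)) := by rw [e, dsrc_rev, h.isRoute.chain]
  obtain ⟨m, hm⟩ := h.dvd_of_dsrc_eq hN h1
  have hper : ∀ (j : ℕ) (k : ℤ), R (k + j * X.len F) = R k := by
    intro j
    induction j with
    | zero => simp
    | succ j ih =>
      intro k
      rw [← ih k, ← h.add_len (k + j * X.len F)]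
      congr 1
      push_cast
      ring
  have h2 : R (k' + 1) = R k := by
    rcases Int.eq_nat_or_neg m with ⟨j, rfl | rfl⟩
    · rw [← hper j k]; congr 1; linarith
    · rw [← hper j (k' + 1)]; congr 1; linarith
  exact h.isRoute.imm k' (h2.trans e)

end IsReading

/-- The path `R` runs from the branch vertex at time `a` to that at time `a + m` without passing
through a branch vertex. -/
structure IsRun (R : ℤ → X.Dart) (a : ℤ) (m : ℕ) : Prop where
  pos : 0 < m
  branch : Branch (dsrc (R (a + m)))
  not_branch : ∀ k : ℕ, 0 < k → k < m → ¬ Branch (dsrc (R (a + k)))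

theorem IsReading.exists_isRun {F : X.C} {R : ℤ → X.Dart} (h : IsReading F R) {a : ℤ}
    (hb : Branch (dsrc (R a))) : ∃ m ≤ X.len F, IsRun R a m := by
  classical
  have hex : ∃ m : ℕ, 0 < m ∧ Branch (dsrc (R (a + m))) :=
    ⟨X.len F, X.len_pos F, by rwa [h.add_len]⟩
  refine ⟨Nat.find hex, Nat.find_min' hex ⟨X.len_pos F, by rwa [h.add_len]⟩,
    (Nat.find_spec hex).1, (Nat.find_spec hex).2, fun k hk hlt hbk => ?_⟩
  exact Nat.find_min hex hlt ⟨hk, hbk⟩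

/-- There is only one way to continue an edge path through a vertex that is not a branch
vertex. -/
theorem IsRun.eq_of_eq {R R' : ℤ → X.Dart} {a b : ℤ} {m : ℕ} (h : IsRun R a m) (hR : IsRoute R)
    (hR' : IsRoute R') (h0 : R' b = R a) : ∀ k : ℕ, k < m → R' (b + k) = R (a + k) := by
  intro k
  induction k with
  | zero => intro _; simpa using h0
  | succ k ih =>
    intro hk
    have ih := ih (by omega)
    have hv := h.not_branch (k + 1) (by omega) hk
    push_cast at hv ⊢
    rw [← add_assoc] at hv ⊢
    rw [← add_assoc]
    have h1 : dsrc (rev (R (a + k))) = dsrc (R (a + k + 1)) := by rw [dsrc_rev, hR.chain]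
    have h2 : dsrc (R' (b + k + 1)) = dsrc (R (a + k + 1)) := by
      rw [← hR'.chain, ih, hR.chain]
    rcases eq_or_eq_of_not_branch hv rfl h1 (hR.imm _) h2 with e | e
    · exact e
    · rw [← ih] at e
      exact absurd e (hR'.imm _)

theorem IsRun.dsrc_eq_of_eq {R R' : ℤ → X.Dart} {a b : ℤ} {m : ℕ} (h : IsRun R a m)
    (hR : IsRoute R) (hR' : IsRoute R') (h0 : R' b = R a) {k : ℕ} (hk : k ≤ m) :
    dsrc (R' (b + k)) = dsrc (R (a + k)) := by
  rcases Nat.eq_zero_or_pos k with rfl | hpos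
  · simpa using congrArg dsrc h0
  · have h1 := h.eq_of_eq hR hR' h0 (k - 1) (by omega)
    have h2 := hR.chain (a + (k - 1 : ℕ))
    have h3 := hR'.chain (b + (k - 1 : ℕ))
    have e : ∀ x : ℤ, x + (k - 1 : ℕ) + 1 = x + k := fun x => by
      rw [Nat.cast_sub hpos]; push_cast; ring
    rw [e] at h2 h3
    rw [← h2, ← h3, h1]

theorem IsRun.readPt_eq_of_eq {R R' : ℤ → X.Dart} {a b : ℤ} {m : ℕ} (h : IsRun R a m)
    (hR : IsRoute R) (hR' : IsRoute R') (h0 : R' b = R a) {s : ℝ} (hs0 : 0 ≤ s) (hs : s ≤ m) :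
    readPt R' (b + s) = readPt R (a + s) := by
  obtain ⟨j, hj⟩ := Int.eq_ofNat_of_zero_le (Int.floor_nonneg.2 hs0)
  rcases hs.lt_or_eq with hlt | rfl
  · have hjm : j < m := by
      have : (j : ℝ) ≤ s := by
        have := Int.floor_le s
        rw [hj] at this
        exact_mod_cast this
      exact_mod_cast this.trans_lt hlt
    have := h.eq_of_eq hR hR' h0 j hjm
    rw [add_comm (b : ℝ), add_comm (a : ℝ), readPt_add, readPt_add, readPt, readPt, hj,
      add_comm (j : ℤ), add_comm (j : ℤ), this]
  · have e : ∀ c : ℤ, (c : ℝ) + (m : ℝ) = ((c + m : ℤ) : ℝ) := fun c => by push_cast; rfl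
    rw [e, e, readPt_intCast, readPt_intCast, h.dsrc_eq_of_eq hR hR' h0 le_rfl]

theorem IsRun.faces {R : ℤ → X.Dart} {a : ℤ} {m : ℕ} (h : IsRun R a m) (hR : IsRoute R) :
    ∀ k : ℕ, k < m → facesE (R (a + k)).1 = facesE (R a).1 := by
  intro k
  induction k with
  | zero => intro _; simp
  | succ k ih =>
    intro hk
    rw [← ih (by omega)]
    have hv := h.not_branch (k + 1) (by omega) hk
    rw [facesE_of_not_branch hv rfl,
      ← facesE_of_not_branch hv (d := rev (R (a + k)))
        (by rw [dsrc_rev, hR.chain]; push_cast; rw [add_assoc]), rev_fst]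

theorem IsRun.backward {R : ℤ → X.Dart} {a : ℤ} {m : ℕ} (h : IsRun R a m) (hR : IsRoute R)
    (hb : Branch (dsrc (R a))) : IsRun (TwoComplex.backward R (a + m)) 0 m where
  pos := h.pos
  branch := by rw [hR.dsrc_backward]; simpa using hb
  not_branch k hk hlt := by
    rw [hR.dsrc_backward]
    have := h.not_branch (m - k) (by omega) (by omega)
    rw [Nat.cast_sub hlt.le] at this
    simpa [add_sub_assoc] using this

open Octagonal

/-! ### Labelling the branch vertices by the vertices of the model -/

/-- The octagons of the model that contain an edge. -/
def octagonsAt : Edge → Set (ℤ × ℤ)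
  | .x i j => {(i, j), (i, j - 1)}
  | .y i j => {(i, j), (i - 1, j)}
  | .z i j => around (i, j)

/-- An edge of the model is determined by the octagons that contain it. -/
theorem octagonsAt_injective : Function.Injective octagonsAt := by
  intro e e' h
  have key : ∀ c, c ∈ octagonsAt e ↔ c ∈ octagonsAt e' := fun c => by rw [h]
  rcases e with ⟨i, j⟩ | ⟨i, j⟩ | ⟨i, j⟩ <;> rcases e' with ⟨i', j'⟩ | ⟨i', j'⟩ | ⟨i', j'⟩ <;>
  · have h1 := key (i, j)
    have h2 := key (i, j - 1)
    have h3 := key (i - 1, j)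
    have h4 := key (i', j')
    have h5 := key (i', j' - 1)
    have h6 := key (i' - 1, j')
    simp only [octagonsAt, around, Set.mem_insert_iff, Set.mem_singleton_iff, Prod.mk.injEq] at *
    grind

/-- The edge is not one of the vertical edges in `S`. -/
def IsActive (S : Set (ℤ × ℤ)) : Edge → Prop
  | .x _ _ => True
  | .y _ _ => True
  | .z i j => (i, j) ∉ S

/-- The position in `ℤ × ℤ` of a vertex of the model. -/
def place (a : skeleton.V) : ℤ × ℤ := (a.1, a.2.1)

/-- The branch vertices of `X` are labelled through `vm` by the vertices of the model in which the
vertical edges in `S` are collapsed, and the darts at branch vertices through `fd` by the darts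
that are not collapsed, compatibly with the labelling `ρ` of the 2-cells. -/
structure IsLabelling (ρ : ℤ × ℤ ≃ X.C) (S : Set (ℤ × ℤ)) (vm : skeleton.V → X.V)
    (fd : skeleton.Dart → X.Dart) : Prop where
  branch : ∀ a, Branch (vm a)
  exists_vm : ∀ v, Branch v → ∃ a, vm a = v
  vm_eq : ∀ a b, vm a = vm b ↔ a = b ∨ place a = place b ∧ place a ∈ S
  dsrc_fd : ∀ δ : skeleton.Dart, IsActive S δ.1 → dsrc (fd δ) = vm (dsrc δ)
  faces_fd : ∀ δ : skeleton.Dart, IsActive S δ.1 → facesE (fd δ).1 = ρ '' octagonsAt δ.1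
  exists_fd : ∀ a d, dsrc d = vm a → ∃ δ : skeleton.Dart, IsActive S δ.1 ∧ fd δ = d ∧
    place (dsrc δ) = place a ∧ (place a ∉ S → dsrc δ = a)

theorem exists_isLabelling {ρ : ℤ × ℤ ≃ X.C} (hX : X.FaceCovered)
    (hρ : ∀ w, IsFrame DualSquare (ρ w) fun i => ρ (w + Frame.dir i))
    (hq : ∀ F : X.C, ∃ N : ZMod 8 → X.C, QuasiFlatAt F N) :
    ∃ S vm fd, IsLabelling ρ S vm fd := by
  choose v₀ v₁ dE dW dN dS z₀ z₁ h using exists_cornerData hX hρ hq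
  let vm : skeleton.V → X.V := fun a => if a.2.2 then v₁ (place a) else v₀ (place a)
  let fd : skeleton.Dart → X.Dart := fun δ => match δ with
    | (.x i j, true) => dE (i, j)
    | (.x i j, false) => dW (i + 1, j)
    | (.y i j, true) => dN (i, j)
    | (.y i j, false) => dS (i, j + 1)
    | (.z i j, true) => z₀ (i, j)
    | (.z i j, false) => z₁ (i, j)
  let S : Set (ℤ × ℤ) := {c | v₀ c = v₁ c}
  have hfaces : ∀ a, facesV (vm a) = ρ '' around (place a) := by
    rintro ⟨i, j, _ | _⟩
    · exact (h (i, j)).faces₀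
    · exact (h (i, j)).faces₁
  have hplace : ∀ a b, vm a = vm b → place a = place b := fun a b hab =>
    around_injective (ρ.injective.image_injective (by rw [← hfaces, hab, hfaces]))
  refine ⟨S, vm, fd, ?_, ?_, ?_, ?_, ?_, ?_⟩
  · rintro ⟨i, j, _ | _⟩
    · exact (h (i, j)).branch₀
    · exact (h (i, j)).branch₁
  · intro v hv
    obtain ⟨⟨i, j⟩, hc⟩ := exists_crossAt hρ hX hq hv
    rcases (h (i, j)).eq_or_eq v hv hc.faces with e | e
    · exact ⟨(i, j, false), e.symm⟩
    · exact ⟨(i, j, true), e.symm⟩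
  · intro a b
    constructor
    · intro hab
      have hp := hplace a b hab
      rcases a with ⟨i, j, s⟩
      rcases b with ⟨i', j', s'⟩
      obtain ⟨rfl, rfl⟩ : i = i' ∧ j = j' := by simpa [place] using hp
      rcases s with _ | _ <;> rcases s' with _ | _
      · exact Or.inl rfl
      · exact Or.inr ⟨rfl, hab⟩
      · exact Or.inr ⟨rfl, hab.symm⟩
      · exact Or.inl rfl
    · rintro (rfl | ⟨hp, hS⟩)
      · rfl
      · have hS' : v₀ (place a) = v₁ (place a) := hS
        have hva : ∀ b, place b = place a → vm b = v₀ (place a) := by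
          intro b hb
          change (if b.2.2 then v₁ (place b) else v₀ (place b)) = _
          rw [hb, hS', ite_self]
        rw [hva a rfl, hva b hp.symm]
  · rintro ⟨⟨i, j⟩ | ⟨i, j⟩ | ⟨i, j⟩, _ | _⟩ ha
    · exact (h (i + 1, j)).src_W
    · exact (h (i, j)).src_E
    · exact (h (i, j + 1)).src_S
    · exact (h (i, j)).src_N
    · exact (h (i, j)).src_z₁ ha
    · exact (h (i, j)).src_z₀ ha
  · rintro ⟨⟨i, j⟩ | ⟨i, j⟩ | ⟨i, j⟩, _ | _⟩ ha
    · have := (h (i + 1, j)).faces_W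
      simpa [octagonsAt, Set.image_pair, fd] using this
    · have := (h (i, j)).faces_E
      simpa [octagonsAt, Set.image_pair, fd] using this
    · have := (h (i, j + 1)).faces_S
      simpa [octagonsAt, Set.image_pair, fd] using this
    · have := (h (i, j)).faces_N
      simpa [octagonsAt, Set.image_pair, fd] using this
    · exact (h (i, j)).faces_z₁ ha
    · exact (h (i, j)).faces_z₀ ha
  · rintro ⟨i, j, s⟩ d hd
    have hEx : (fd (.x i j, true)) = dE (i, j) := rfl
    have hWx : (fd (.x (i - 1) j, false)) = dW (i, j) := by simp [fd]
    have hNx : (fd (.y i j, true)) = dN (i, j) := rfl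
    have hSx : (fd (.y i (j - 1), false)) = dS (i, j) := by simp [fd]
    have pE : dsrc (X := skeleton) (.x i j, true) = (i, j, false) := rfl
    have pW : dsrc (X := skeleton) (.x (i - 1) j, false) = (i, j, false) := by
      simp [dsrc, skeleton]
    have pN : dsrc (X := skeleton) (.y i j, true) = (i, j, true) := rfl
    have pS : dsrc (X := skeleton) (.y i (j - 1), false) = (i, j, true) := by
      simp [dsrc, skeleton]
    by_cases hS : v₀ (i, j) = v₁ (i, j)
    · have hd' : d ∈ linkVertices (v₀ (i, j)) := by
        rcases s with _ | _
        · exact hd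
        · exact hd.trans hS.symm
      have hSm : (i, j) ∈ S := hS
      rw [(h (i, j)).link_of_eq hS] at hd'
      rcases hd' with e | e | e | e
      · exact ⟨(.x i j, true), trivial, hEx.trans e.symm, by rw [pE]; rfl, fun hn => absurd hSm hn⟩
      · exact ⟨(.x (i - 1) j, false), trivial, hWx.trans e.symm, by rw [pW]; rfl, fun hn => absurd hSm hn⟩
      · exact ⟨(.y i j, true), trivial, hNx.trans e.symm, by rw [pN]; rfl, fun hn => absurd hSm hn⟩
      · exact ⟨(.y i (j - 1), false), trivial, hSx.trans e.symm, by rw [pS]; rfl, fun hn => absurd hSm hn⟩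
    · rcases s with _ | _
      · have hd' : d ∈ linkVertices (v₀ (i, j)) := hd
        rw [(h (i, j)).link₀ hS] at hd'
        rcases hd' with e | e | e
        · exact ⟨(.x i j, true), trivial, hEx.trans e.symm, by rw [pE], fun _ => pE⟩
        · exact ⟨(.x (i - 1) j, false), trivial, hWx.trans e.symm, by rw [pW], fun _ => pW⟩
        · exact ⟨(.z i j, true), hS, e.symm, rfl, fun _ => rfl⟩
      · have hd' : d ∈ linkVertices (v₁ (i, j)) := hd
        rw [(h (i, j)).link₁ hS] at hd'
        rcases hd' with e | e | e
        · exact ⟨(.y i j, true), trivial, hNx.trans e.symm, by rw [pN], fun _ => pN⟩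
        · exact ⟨(.y i (j - 1), false), trivial, hSx.trans e.symm, by rw [pS], fun _ => pS⟩
        · exact ⟨(.z i j, false), hS, e.symm, rfl, fun _ => rfl⟩

/-! ### The boundary of a 2-cell as a concatenation of eight lines -/

theorem IsReading.readPt_eq_facePt {F : X.C} {R : ℤ → X.Dart} (h : IsReading F R) :
    ∃ a ε : ℝ, (ε = 1 ∨ ε = -1) ∧ ∀ s, readPt R s = facePt F (polar 1 (a + ε * (s / X.len F))) := by
  obtain ⟨k₀, rfl | rfl⟩ := h
  · refine ⟨k₀ / X.len F, 1, Or.inl rfl, fun s => ?_⟩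
    rw [one_mul, ← add_div, facePt_polar_one, add_comm (k₀ : ℝ), readPt_add]
    simp only [add_comm]
  · refine ⟨k₀ / X.len F, -1, Or.inr rfl, fun s => ?_⟩
    rw [(isRoute_bdRead F).readPt_backward, ← facePt_polar_one]
    congr 2
    ring

theorem IsReading.continuous_readPt {F : X.C} {R : ℤ → X.Dart} (h : IsReading F R) :
    Continuous (readPt R) := by
  obtain ⟨a, ε, -, hR⟩ := h.readPt_eq_facePt
  rw [funext hR]
  refine (continuous_facePt F).comp (continuous_polar.comp (continuous_const.prodMk ?_))
  fun_prop

theorem IsRun.congr {R R' : ℤ → X.Dart} {a b : ℤ} {m : ℕ} (h : IsRun R a m) (hR : IsRoute R)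
    (hR' : IsRoute R') (h0 : R' b = R a) : IsRun R' b m where
  pos := h.pos
  branch := by rw [h.dsrc_eq_of_eq hR hR' h0 le_rfl]; exact h.branch
  not_branch k hk hlt := by
    rw [h.dsrc_eq_of_eq hR hR' h0 hlt.le]; exact h.not_branch k hk hlt

/-- The path `R` follows, for time `m`, the line of `X` that corresponds to the edge `e` of the
model; the time is zero if `e` is collapsed. -/
structure IsLine (S : Set (ℤ × ℤ)) (vm : skeleton.V → X.V) (fd : skeleton.Dart → X.Dart)
    (e : Edge) (R : ℤ → X.Dart) (m : ℕ) : Prop where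
  reading : ∃ F, IsReading F R ∧ m ≤ X.len F
  active : IsActive S e → R 0 = fd (e, true) ∧ IsRun R 0 m
  inactive : ¬ IsActive S e → m = 0 ∧ dsrc (R 0) = vm (skeleton.src e)

/-- The point at parameter `t ∈ [0, 1]` of a family of lines, along an oriented edge of the
model. -/
noncomputable def linePt (R : Edge → ℤ → X.Dart) (m : Edge → ℕ) (δ : skeleton.Dart) (t : ℝ) :
    X.Realization :=
  readPt (R δ.1) (m δ.1 * if δ.2 then t else 1 - t)

theorem octagonsAt_nonempty (e : Edge) : (octagonsAt e).Nonempty := by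
  rcases e with ⟨i, j⟩ | ⟨i, j⟩ | ⟨i, j⟩ <;> exact ⟨(i, j), Or.inl rfl⟩

theorem edge_eq_of_image_eq {ρ : ℤ × ℤ ≃ X.C} {e e' : Edge}
    (h : ρ '' octagonsAt e = ρ '' octagonsAt e') : e = e' :=
  octagonsAt_injective (ρ.injective.image_injective h)

section

variable {ρ : ℤ × ℤ ≃ X.C} {S : Set (ℤ × ℤ)} {vm : skeleton.V → X.V}
  {fd : skeleton.Dart → X.Dart} (hL : IsLabelling ρ S vm fd)
include hL

theorem IsLabelling.active_of_cell_mem {δ : skeleton.Dart} {c : ℤ × ℤ} (hδ : IsActive S δ.1)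
    (h : ρ c ∈ facesE (fd δ).1) : c ∈ octagonsAt δ.1 := by
  rw [hL.faces_fd δ hδ] at h
  obtain ⟨c', hc', e⟩ := h
  rwa [← ρ.injective e]

theorem IsLabelling.exists_isLine (e : Edge) (hE : ∀ v : X.V, (facesV v).Nonempty) :
    ∃ R m, IsLine S vm fd e R m := by
  by_cases he : IsActive S e
  · obtain ⟨c, hc⟩ := octagonsAt_nonempty e
    have hmem : ρ c ∈ facesE (fd (e, true)).1 := by
      rw [hL.faces_fd (e, true) he]; exact ⟨c, hc, rfl⟩
    obtain ⟨R, hR, hR0⟩ := exists_isReading hmem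
    have hb : Branch (dsrc (R 0)) := by
      rw [hR0, hL.dsrc_fd (e, true) he]; exact hL.branch _
    obtain ⟨m, hm, hrun⟩ := hR.exists_isRun hb
    exact ⟨R, m, ⟨_, hR, hm⟩, fun _ => ⟨hR0, hrun⟩, fun h => absurd he h⟩
  · obtain ⟨F, hF⟩ := hE (vm (skeleton.src e))
    obtain ⟨k, hk⟩ := mem_facesV.1 hF
    refine ⟨fun j => bdRead F (k + j), 0, ⟨F, ⟨k, Or.inl rfl⟩, Nat.zero_le _⟩,
      fun h => absurd h he, fun _ => ⟨rfl, by simpa using hk⟩⟩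

variable (hq : ∀ F : X.C, ∃ N : ZMod 8 → X.C, QuasiFlatAt F N)
include hq

/-- A line that starts with the dart of `δ` ends with that of the opposite dart. -/
theorem IsLabelling.rev_last {F : X.C} {R : ℤ → X.Dart} (hR : IsReading F R) {a : ℤ} {m : ℕ}
    (hrun : IsRun R a m) {δ : skeleton.Dart} (hδ : IsActive S δ.1) (h0 : R a = fd δ) :
    rev (R (a + m - 1)) = fd (rev δ) := by
  obtain ⟨N, hN⟩ := hq F
  have hpos := hrun.pos
  have hlast : R (a + m - 1) = R (a + (m - 1 : ℕ)) := by
    rw [Nat.cast_sub hpos, Nat.cast_one, add_sub_assoc]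
  have hsrc : dsrc (rev (R (a + m - 1))) = dsrc (R (a + m)) := by
    rw [dsrc_rev, hR.isRoute.chain, sub_add_cancel]
  obtain ⟨v, hv⟩ := hL.exists_vm _ hrun.branch
  obtain ⟨η, hη, hηd, -⟩ := hL.exists_fd v (rev (R (a + m - 1))) (hsrc.trans hv.symm)
  have hedge : η.1 = δ.1 := by
    apply edge_eq_of_image_eq (ρ := ρ)
    rw [← hL.faces_fd η hη, ← hL.faces_fd δ hδ, hηd, rev_fst, hlast,
      hrun.faces hR.isRoute _ (by omega), h0]
  rcases eq_or_eq_rev_of_fst_eq hedge with e | e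
  · -- Otherwise the path would turn back at the starting point.
    rw [e, ← h0] at hηd
    exact absurd hηd (hR.ne_rev hN _ _)
  · rw [← hηd, e]

theorem IsLabelling.dsrc_end {F : X.C} {R : ℤ → X.Dart} (hR : IsReading F R) {a : ℤ} {m : ℕ}
    (hrun : IsRun R a m) {δ : skeleton.Dart} (hδ : IsActive S δ.1) (h0 : R a = fd δ) :
    dsrc (R (a + m)) = vm (dtgt δ) := by
  have h := congrArg dsrc (hL.rev_last hq hR hrun hδ h0)
  rw [hL.dsrc_fd (rev δ) hδ, dsrc_rev, dsrc_rev, hR.isRoute.chain, sub_add_cancel] at h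
  exact h

variable {R : Edge → ℤ → X.Dart} {m : Edge → ℕ} (hline : ∀ e, IsLine S vm fd e (R e) (m e))
include hline

/-- Every boundary path that starts with the dart of `δ` follows the chosen line. -/
theorem IsLabelling.isRun_and_linePt {F : X.C} {Q : ℤ → X.Dart} (hQ : IsReading F Q) {a : ℤ}
    {δ : skeleton.Dart} (hδ : IsActive S δ.1) (h0 : Q a = fd δ) :
    IsRun Q a (m δ.1) ∧
      ∀ t : ℝ, 0 ≤ t → t ≤ 1 → readPt Q (a + m δ.1 * t) = linePt R m δ t := by
  obtain ⟨e, b⟩ := δ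
  obtain ⟨hR0, hrun⟩ := (hline e).active hδ
  obtain ⟨G, hG, -⟩ := (hline e).reading
  have hm : (0 : ℝ) ≤ m e := Nat.cast_nonneg _
  cases b with
  | true =>
    refine ⟨hrun.congr hG.isRoute hQ.isRoute (h0.trans hR0.symm), fun t ht0 ht1 => ?_⟩
    rw [hrun.readPt_eq_of_eq hG.isRoute hQ.isRoute (h0.trans hR0.symm)
      (mul_nonneg hm ht0) (mul_le_of_le_one_right hm ht1)]
    simp [linePt]
  | false =>
    have hb : Branch (dsrc (R e 0)) := by
      rw [hR0, hL.dsrc_fd (e, true) hδ]; exact hL.branch _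
    have hrun' := hrun.backward hG.isRoute hb
    have h0' : Q a = backward (R e) (0 + m e) 0 := by
      have := hL.rev_last hq hG hrun (δ := (e, true)) hδ hR0
      rw [h0, backward, show (0 + (m e : ℤ) - 1 - 0) = 0 + m e - 1 by ring, this]
      rfl
    refine ⟨hrun'.congr (hG.isRoute.backward _) hQ.isRoute h0', fun t ht0 ht1 => ?_⟩
    rw [hrun'.readPt_eq_of_eq (hG.isRoute.backward _) hQ.isRoute h0'
      (mul_nonneg hm ht0) (mul_le_of_le_one_right hm ht1), hG.isRoute.readPt_backward]
    simp only [linePt]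
    congr 1
    push_cast
    simp
    ring

/-- The path around a 2-cell turns from the side `δ` to the next side `δ'`, through the vertical
edge `ζ` unless this is collapsed. -/
theorem IsLabelling.next_side {c : ℤ × ℤ} {Q : ℤ → X.Dart} (hQ : IsReading (ρ c) Q) {a : ℤ}
    {δ ζ δ' : skeleton.Dart} (hδ : IsActive S δ.1) (h0 : Q a = fd δ)
    (hcorner : ∀ η : skeleton.Dart, place (dsrc η) = place (dtgt δ) → c ∈ octagonsAt η.1 →
      η = rev δ ∨ η = δ' ∨ η = ζ ∨ η = rev ζ)
    (hζ : dsrc ζ = dtgt δ) (hζ' : dtgt ζ = dsrc δ') (hne : dsrc ζ ≠ dtgt ζ)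
    (hplace : place (dsrc ζ) = place (dtgt ζ))
    (hact : IsActive S ζ.1 ↔ place (dsrc ζ) ∉ S) :
    (IsActive S ζ.1 → Q (a + m δ.1) = fd ζ) ∧ Q (a + m δ.1 + m ζ.1) = fd δ' ∧
      ∀ t : ℝ, 0 ≤ t → t ≤ 1 → readPt Q (a + m δ.1 + m ζ.1 * t) = linePt R m ζ t := by
  obtain ⟨hrun, -⟩ := hL.isRun_and_linePt hq hline hQ hδ h0
  have hend := hL.dsrc_end hq hQ hrun hδ h0
  have hlast := hL.rev_last hq hQ hrun hδ h0
  obtain ⟨η, hη, hηd, hηp, hηe⟩ := hL.exists_fd _ _ hend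
  have hηc : c ∈ octagonsAt η.1 := hL.active_of_cell_mem hη (by rw [hηd]; exact hQ.mem _)
  have hηδ : η ≠ rev δ := by
    rintro rfl
    rw [← hlast] at hηd
    have := hQ.isRoute.imm (a + m δ.1 - 1)
    rw [sub_add_cancel] at this
    exact this hηd.symm
  have hη4 := (hcorner η hηp hηc).resolve_left hηδ
  by_cases hζa : IsActive S ζ.1
  · have hS := hact.1 hζa
    have hηs : dsrc η = dsrc ζ := (hηe (hζ ▸ hS)).trans hζ.symm
    have hηζ : η = ζ := by
      rcases hη4 with rfl | rfl | rfl
      · exact absurd (hηs.symm.trans hζ'.symm) hne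
      · rfl
      · rw [dsrc_rev] at hηs; exact absurd hηs.symm hne
    subst hηζ
    obtain ⟨hrun', hpt⟩ := hL.isRun_and_linePt hq hline hQ hζa hηd.symm
    have hend' := hL.dsrc_end hq hQ hrun' hζa hηd.symm
    have hlast' := hL.rev_last hq hQ hrun' hζa hηd.symm
    refine ⟨fun _ => hηd.symm, ?_, fun t h1 h2 => ?_⟩
    · obtain ⟨θ, hθ, hθd, hθp, hθe⟩ := hL.exists_fd _ _ hend'
      have hθc : c ∈ octagonsAt θ.1 := hL.active_of_cell_mem hθ (by rw [hθd]; exact hQ.mem _)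
      have hθζ : θ ≠ rev η := by
        rintro rfl
        rw [← hlast'] at hθd
        have := hQ.isRoute.imm (a + m δ.1 + m η.1 - 1)
        rw [sub_add_cancel] at this
        exact this hθd.symm
      have hθs : dsrc θ = dtgt η := hθe (hplace ▸ hS)
      rcases hcorner θ (by rw [hθp, ← hplace, hζ]) hθc with rfl | rfl | rfl | rfl
      · rw [dsrc_rev, ← hζ] at hθs; exact absurd hθs hne
      · exact hθd.symm
      · exact absurd hθs hne
      · exact absurd rfl hθζ
    · rw [← hpt t h1 h2]; push_cast; rfl
  · have hm : m ζ.1 = 0 := ((hline ζ.1).inactive hζa).1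
    have hS : place (dsrc ζ) ∈ S := by by_contra h; exact hζa (hact.2 h)
    refine ⟨fun h => absurd h hζa, ?_, fun t h1 h2 => ?_⟩
    · rcases hη4 with rfl | rfl | rfl
      · rw [hm, Nat.cast_zero, add_zero]; exact hηd.symm
      · exact absurd hη hζa
      · exact absurd hη hζa
    · have e1 : (a : ℝ) + m δ.1 + m ζ.1 * t = ((a + m δ.1 : ℤ) : ℝ) := by rw [hm]; push_cast; ring
      have e2 : linePt R m ζ t = readPt (R ζ.1) ((0 : ℤ) : ℝ) := by simp [linePt, hm]
      rw [e1, e2, readPt_intCast, readPt_intCast, hend, ((hline ζ.1).inactive hζa).2]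
      congr 1
      rw [← hζ]
      obtain ⟨e, _ | _⟩ := ζ
      · exact (hL.vm_eq _ _).2 (Or.inr ⟨hplace, hS⟩)
      · rfl

end

/-- The vertical sides of an octagon are those with odd index. An edge of the octagon that has an
end in common with the side `k`, up to the vertical side `k + 1`, is one of the sides `k`, `k + 1`,
`k + 2`. -/
theorem octagon_corner (i j : ℤ) {k : Fin 8} (hk : k = 0 ∨ k = 2 ∨ k = 4 ∨ k = 6)
    (η : skeleton.Dart) (hp : place (dsrc η) = place (dtgt (octagon i j k)))
    (hη : (i, j) ∈ octagonsAt η.1) : η = rev (octagon i j k) ∨ η = octagon i j (k + 2) ∨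
      η = octagon i j (k + 1) ∨ η = rev (octagon i j (k + 1)) := by
  rcases hk with rfl | rfl | rfl | rfl <;>
  rcases η with ⟨⟨i', j'⟩ | ⟨i', j'⟩ | ⟨i', j'⟩, _ | _⟩ <;>
  · simp only [octagon, place, dsrc, dtgt, skeleton, octagonsAt, around, Set.mem_insert_iff,
      Set.mem_singleton_iff, Prod.mk.injEq, rev] at hp hη ⊢
    simp at hp hη ⊢
    omega

theorem octagon_chain (i j : ℤ) (k : Fin 8) :
    dsrc (octagon i j (k + 1)) = dtgt (octagon i j k) := by
  fin_cases k <;> simp [octagon, dtgt, dsrc, skeleton]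

theorem octagon_even (i j : ℤ) {k : Fin 8} (hk : k = 0 ∨ k = 2 ∨ k = 4 ∨ k = 6)
    (S : Set (ℤ × ℤ)) : IsActive S (octagon i j k).1 ∧
      dsrc (octagon i j (k + 1)) ≠ dtgt (octagon i j (k + 1)) ∧
      place (dsrc (octagon i j (k + 1))) = place (dtgt (octagon i j (k + 1))) ∧
      (IsActive S (octagon i j (k + 1)).1 ↔ place (dsrc (octagon i j (k + 1))) ∉ S) := by
  rcases hk with rfl | rfl | rfl | rfl <;>
    simp [octagon, dtgt, dsrc, skeleton, place, IsActive]

theorem octagon_edge_injective (i j : ℤ) :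
    Function.Injective fun k => ((octagon i j k).1 : Edge) := by
  intro k k'
  fin_cases k <;> fin_cases k' <;> simp [octagon] <;>
  · intro h
    injection h
    omega

section

variable {ρ : ℤ × ℤ ≃ X.C} {S : Set (ℤ × ℤ)} {vm : skeleton.V → X.V}
  {fd : skeleton.Dart → X.Dart} (hL : IsLabelling ρ S vm fd)
  (hq : ∀ F : X.C, ∃ N : ZMod 8 → X.C, QuasiFlatAt F N)
  {R : Edge → ℤ → X.Dart} {m : Edge → ℕ} (hline : ∀ e, IsLine S vm fd e (R e) (m e))
include hL hq hline

/-- The boundary path of a 2-cell passes through the eight lines that correspond to the sides of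
the octagon with the same label. -/
theorem IsLabelling.exists_reading (i j : ℤ) : ∃ (Q : ℤ → X.Dart) (M : ℕ → ℕ), IsReading (ρ (i, j)) Q ∧ M 0 = 0 ∧
    M 8 = X.len (ρ (i, j)) ∧ (∀ k : Fin 8, M (k + 1) = M k + m (octagon i j k).1) ∧
    ∀ (k : Fin 8) (t : ℝ), 0 ≤ t → t ≤ 1 →
      readPt Q (M k + m (octagon i j k).1 * t) = linePt R m (octagon i j k) t := by
  have hact0 : IsActive S (octagon i j 0).1 := trivial
  have hmem : ρ (i, j) ∈ facesE (fd (octagon i j 0)).1 := by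
    rw [hL.faces_fd _ hact0]; exact ⟨(i, j), Or.inl rfl, rfl⟩
  obtain ⟨Q, hQ, hQ0⟩ := exists_isReading hmem
  let M : ℕ → ℕ := fun k => ∑ l ∈ Finset.range k, m (octagon i j (Fin.ofNat 8 l)).1
  have hMs : ∀ k : Fin 8, M (k + 1) = M k + m (octagon i j k).1 := by
    intro k
    simp only [M, Finset.sum_range_succ, Fin.ofNat_val_eq_self]
  have hturn : ∀ k : Fin 8, (k = 0 ∨ k = 2 ∨ k = 4 ∨ k = 6) → Q (M k) = fd (octagon i j k) →
      (IsActive S (octagon i j (k + 1)).1 → Q (M (k + 1 : ℕ)) = fd (octagon i j (k + 1))) ∧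
      Q (M (k + 2 : ℕ)) = fd (octagon i j (k + 2)) ∧
      (∀ t : ℝ, 0 ≤ t → t ≤ 1 →
        readPt Q (M k + m (octagon i j k).1 * t) = linePt R m (octagon i j k) t) ∧
      ∀ t : ℝ, 0 ≤ t → t ≤ 1 → readPt Q (M (k + 1 : ℕ) + m (octagon i j (k + 1)).1 * t) =
        linePt R m (octagon i j (k + 1)) t := by
    intro k hk h0
    obtain ⟨ha, hne, hpl, hact⟩ := octagon_even i j hk S
    have hch := octagon_chain i j (k + 1)
    have h2 : k + 1 + 1 = k + 2 := by rw [add_assoc]; rfl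
    rw [h2] at hch
    have hv1 : ((k + 1 : Fin 8) : ℕ) = k + 1 := by
      rcases hk with rfl | rfl | rfl | rfl <;> rfl
    have hM2 : M (k + 2 : ℕ) = M k + m (octagon i j k).1 + m (octagon i j (k + 1)).1 := by
      have := hMs (k + 1)
      rw [hv1] at this
      rw [← hMs k, ← this]
    obtain ⟨h1, h2, h3⟩ := hL.next_side hq hline hQ ha h0
      (fun η hp hη => octagon_corner i j hk η hp hη) (octagon_chain i j k) hch.symm hne hpl hact
    refine ⟨fun h => ?_, ?_, (hL.isRun_and_linePt hq hline hQ ha h0).2, fun t ht0 ht1 => ?_⟩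
    · rw [← h1 h, hMs]; push_cast; rfl
    · rw [← h2, hM2]; push_cast; rfl
    · rw [← h3 t ht0 ht1, hMs]; push_cast; rfl
  obtain ⟨a1, a2, a3, a4⟩ := hturn 0 (by decide) (by simpa [M] using hQ0)
  obtain ⟨b1, b2, b3, b4⟩ := hturn 2 (by decide) a2
  obtain ⟨c1, c2, c3, c4⟩ := hturn 4 (by decide) b2
  obtain ⟨d1, d2, d3, d4⟩ := hturn 6 (by decide) c2
  have hpt : ∀ (k : Fin 8) (t : ℝ), 0 ≤ t → t ≤ 1 →
      readPt Q (M k + m (octagon i j k).1 * t) = linePt R m (octagon i j k) t := by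
    intro k
    fin_cases k
    exacts [a3, a4, b3, b4, c3, c4, d3, d4]
  have hstart : ∀ k : Fin 8, IsActive S (octagon i j k).1 → Q (M k) = fd (octagon i j k) := by
    intro k
    fin_cases k
    exacts [fun _ => by simpa [M] using hQ0, a1, fun _ => a2, b1, fun _ => b2, c1, fun _ => c2, d1]
  have hM0 : M 0 = 0 := by simp [M]
  refine ⟨Q, M, hQ, hM0, ?_, hMs, hpt⟩
  obtain ⟨N, hN⟩ := hq (ρ (i, j))
  have hmono : ∀ k : Fin 8, IsActive S (octagon i j k).1 → IsRun Q (M k) (m (octagon i j k).1) :=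
    fun k hk => (hL.isRun_and_linePt hq hline hQ hk (hstart k hk)).1
  -- The path is back at its starting point after the eighth line, and not earlier.
  have hback : Q (M 8) = Q 0 := by
    have : Q (M 8) = fd (octagon i j 0) := d2
    rw [this, hQ0]
  have hdvd := hQ.dvd_of_dsrc_eq hN (congrArg dsrc hback.symm)
  rw [sub_zero, Int.natCast_dvd_natCast] at hdvd
  have hM1 : 0 < M 1 := by
    have := hMs 0
    have h1 := (hmono 0 hact0).pos
    simp only [Fin.val_zero, zero_add, hM0] at this
    omega
  have hM18 : M 1 ≤ M 8 := Finset.sum_le_sum_of_subset (Finset.range_subset_range.2 (by norm_num))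
  refine le_antisymm ?_ (Nat.le_of_dvd (by omega) hdvd)
  by_contra hlt
  push Not at hlt
  obtain ⟨k, hk1, hk2⟩ : ∃ k : Fin 8, M k ≤ X.len (ρ (i, j)) ∧ X.len (ρ (i, j)) < M (k + 1) := by
    by_contra hcon
    push Not at hcon
    have : ∀ k : ℕ, k ≤ 8 → M k ≤ X.len (ρ (i, j)) := by
      intro k
      induction k with
      | zero => intro _; rw [hM0]; exact Nat.zero_le _
      | succ k ih => intro hk; exact hcon ⟨k, by omega⟩ (ih (by omega))
    have := this 8 le_rfl
    omega
  rw [hMs] at hk2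
  have hka : IsActive S (octagon i j k).1 := by
    by_contra h
    rw [((hline _).inactive h).1] at hk2
    omega
  have hper : Q (X.len (ρ (i, j))) = Q 0 := by simpa using hQ.add_len 0
  have hb0 : Branch (dsrc (Q 0)) := by
    rw [hQ0, hL.dsrc_fd _ hact0]; exact hL.branch _
  -- The branch vertex reached after one turn would be the start of a side other than the first.
  rcases hk1.lt_or_eq with hlt' | heq
  · refine (hmono k hka).not_branch (X.len (ρ (i, j)) - M k) (by omega) (by omega) ?_
    rw [Nat.cast_sub hk1, add_sub_cancel, hper]
    exact hb0
  · have h1 : fd (octagon i j k) = fd (octagon i j 0) := by rw [← hstart k hka, heq, hper, hQ0]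
    have h2 : (octagon i j k).1 = (octagon i j 0).1 := edge_eq_of_image_eq (ρ := ρ) (by
      rw [← hL.faces_fd _ hka, h1, hL.faces_fd _ hact0])
    rw [octagon_edge_injective i j h2] at heq
    simp only [Fin.val_zero, hM0] at heq
    exact (X.len_pos _).ne heq

end

/-! ### Points on the lines -/

/-- The point at parameter `t` of the edge `e` is identified with the vertex `a` in the model with
the vertical edges in `S` collapsed. -/
def IsEnd (S : Set (ℤ × ℤ)) (e : Edge) (t : ℝ) (a : skeleton.V) : Prop :=
  (t = 0 ∧ a = skeleton.src e) ∨ (t = 1 ∧ a = skeleton.tgt e) ∨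
    (¬ IsActive S e ∧ a = skeleton.src e)

/-- A line has no double points, being shorter than the boundary of a 2-cell. -/
theorem IsLine.dsrc_injOn {S : Set (ℤ × ℤ)} {vm : skeleton.V → X.V}
    {fd : skeleton.Dart → X.Dart} {e : Edge} {R : ℤ → X.Dart} {m : ℕ}
    (h : IsLine S vm fd e R m) (hq : ∀ F : X.C, ∃ N : ZMod 8 → X.C, QuasiFlatAt F N) {k k' : ℕ}
    (hk : k < m) (hk' : k' < m) (heq : dsrc (R k) = dsrc (R k')) : k = k' := by
  obtain ⟨F, hF, hm⟩ := h.reading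
  obtain ⟨N, hN⟩ := hq F
  have := Int.eq_zero_of_abs_lt_dvd (hF.dvd_of_dsrc_eq hN heq) (by rw [abs_lt]; omega)
  omega

section

variable {ρ : ℤ × ℤ ≃ X.C} {S : Set (ℤ × ℤ)} {vm : skeleton.V → X.V}
  {fd : skeleton.Dart → X.Dart} (hL : IsLabelling ρ S vm fd)
  (hq : ∀ F : X.C, ∃ N : ZMod 8 → X.C, QuasiFlatAt F N)
  {R : Edge → ℤ → X.Dart} {m : Edge → ℕ} (hline : ∀ e, IsLine S vm fd e (R e) (m e))
include hL hq hline

theorem IsLabelling.isEnd_or_not_branch {e : Edge} {t : ℝ} {k : ℕ} (hk : (k : ℝ) = m e * t)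
    (ht : t ≤ 1) : (∃ a, IsEnd S e t a ∧ dsrc (R e k) = vm a) ∨
      (0 < k ∧ k < m e ∧ IsActive S e ∧ ¬ Branch (dsrc (R e k))) := by
  by_cases he : IsActive S e
  · obtain ⟨h0, hrun⟩ := (hline e).active he
    obtain ⟨F, hF, -⟩ := (hline e).reading
    have hpos : (0 : ℝ) < m e := Nat.cast_pos.2 hrun.pos
    have hle : k ≤ m e := by
      have : (k : ℝ) ≤ m e := hk ▸ mul_le_of_le_one_right hpos.le ht
      exact_mod_cast this
    rcases Nat.eq_zero_or_pos k with rfl | hk0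
    · refine Or.inl ⟨_, Or.inl ⟨?_, rfl⟩, ?_⟩
      · rw [Nat.cast_zero] at hk
        exact (mul_eq_zero.1 hk.symm).resolve_left hpos.ne'
      · rw [Nat.cast_zero, h0]; exact hL.dsrc_fd (e, true) he
    rcases hle.lt_or_eq with hlt | rfl
    · exact Or.inr ⟨hk0, hlt, he, by simpa using hrun.not_branch k hk0 hlt⟩
    · refine Or.inl ⟨_, Or.inr (Or.inl ⟨?_, rfl⟩), ?_⟩
      · exact mul_left_cancel₀ hpos.ne' (by rw [← hk, mul_one])
      · have := hL.dsrc_end hq hF hrun (δ := (e, true)) he h0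
        rwa [zero_add] at this
  · obtain ⟨hm, h0⟩ := (hline e).inactive he
    rw [hm, Nat.cast_zero, zero_mul, Nat.cast_eq_zero] at hk
    subst hk
    exact Or.inl ⟨_, Or.inr (Or.inr ⟨he, rfl⟩), h0⟩

theorem IsLabelling.linePt_of_isEnd {e : Edge} {t : ℝ} {a : skeleton.V} (h : IsEnd S e t a) :
    linePt R m (e, true) t = vertexPt (vm a) := by
  have hpt : ∀ k : ℕ, (k : ℝ) = m e * t → linePt R m (e, true) t = vertexPt (dsrc (R e k)) := by
    intro k hk
    rw [← Int.cast_natCast] at hk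
    simp only [linePt, if_true]
    rw [← hk, readPt_intCast]
  by_cases he : IsActive S e
  · obtain ⟨h0, hrun⟩ := (hline e).active he
    obtain ⟨F, hF, -⟩ := (hline e).reading
    rcases h with ⟨rfl, rfl⟩ | ⟨rfl, rfl⟩ | ⟨hn, -⟩
    · rw [hpt 0 (by simp), Nat.cast_zero, h0, hL.dsrc_fd (e, true) he]; rfl
    · have := hL.dsrc_end hq hF hrun (δ := (e, true)) he h0
      rw [zero_add] at this
      rw [hpt (m e) (by simp), this]; rfl
    · exact absurd he hn
  · obtain ⟨hm, h0⟩ := (hline e).inactive he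
    rw [hpt 0 (by simp [hm]), Nat.cast_zero, h0]
    congr 1
    rw [hL.vm_eq]
    rcases e with ⟨i, j⟩ | ⟨i, j⟩ | ⟨i, j⟩
    · exact absurd trivial he
    · exact absurd trivial he
    · have hS : (i, j) ∈ S := not_not.1 he
      rcases h with ⟨-, rfl⟩ | ⟨-, rfl⟩ | ⟨-, rfl⟩
      · exact Or.inl rfl
      · exact Or.inr ⟨rfl, hS⟩
      · exact Or.inl rfl

/-- Distinct lines have no common points except for common end points. -/
theorem IsLabelling.eq_of_linePt_eq {e e' : Edge} {t t' : ℝ} (ht0 : 0 ≤ t) (ht1 : t ≤ 1)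
    (ht0' : 0 ≤ t') (ht1' : t' ≤ 1) (h : linePt R m (e, true) t = linePt R m (e', true) t') :
    (e = e' ∧ t = t') ∨ ∃ a a', IsEnd S e t a ∧ IsEnd S e' t' a' ∧ vm a = vm a' := by
  simp only [linePt, if_true] at h
  have hfloor : ∀ e t, 0 ≤ t → t ≤ 1 → ∃ k : ℕ, ⌊(m e : ℝ) * t⌋ = k ∧
      (Int.fract ((m e : ℝ) * t) = 0 → (k : ℝ) = m e * t) ∧
      (Int.fract ((m e : ℝ) * t) ≠ 0 → k < m e) := by
    intro e t h0 h1
    have hm : (0 : ℝ) ≤ m e := Nat.cast_nonneg _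
    obtain ⟨k, hk⟩ := Int.eq_ofNat_of_zero_le (Int.floor_nonneg.2 (mul_nonneg hm h0))
    have hadd := Int.floor_add_fract ((m e : ℝ) * t)
    have hnn := Int.fract_nonneg ((m e : ℝ) * t)
    rw [hk] at hadd
    refine ⟨k, hk, fun hf => ?_, fun hf => ?_⟩
    · rw [hf, add_zero] at hadd
      exact_mod_cast hadd
    · have h2 : (k : ℝ) < m e := by
        have h3 := lt_of_le_of_ne hnn (Ne.symm hf)
        have h4 := mul_le_of_le_one_right hm h1
        have h5 : (((k : ℕ) : ℤ) : ℝ) = k := Int.cast_natCast k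
        have h6 : (((k : ℕ) : ℤ) : ℝ) + Int.fract ((m e : ℝ) * t) = m e * t := hadd
        rw [h5] at h6
        linarith
      exact_mod_cast h2
  obtain ⟨k, hk, hk0, hklt⟩ := hfloor e t ht0 ht1
  obtain ⟨k', hk', hk0', hklt'⟩ := hfloor e' t' ht0' ht1'
  have hfaces : ∀ e (k : ℕ), IsActive S e → k < m e →
      facesE (R e k).1 = ρ '' octagonsAt e := by
    intro e k he hlt
    obtain ⟨h0, hrun⟩ := (hline e).active he
    obtain ⟨F, hF, -⟩ := (hline e).reading
    have := hrun.faces hF.isRoute k hlt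
    rw [zero_add] at this
    rw [this, h0, hL.faces_fd (e, true) he]
  have hactive : ∀ e, 0 < m e → IsActive S e := by
    intro e hpos
    by_contra he
    rw [((hline e).inactive he).1] at hpos
    exact lt_irrefl _ hpos
  have hcancel : 0 < m e → (m e : ℝ) * t = m e * t' → t = t' := fun hpos he =>
    mul_left_cancel₀ (Nat.cast_pos.2 hpos).ne' he
  rcases readPt_eq_readPt h with ⟨hf, hf', hv⟩ | ⟨hf, hf', hd⟩
  · rw [hk, hk'] at hv
    rcases hL.isEnd_or_not_branch hq hline (hk0 hf) ht1 with ⟨a, ha, hav⟩ | ⟨-, hlt, hact, hb⟩ <;>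
    rcases hL.isEnd_or_not_branch hq hline (hk0' hf') ht1' with
      ⟨a', ha', hav'⟩ | ⟨-, hlt', hact', hb'⟩
    · exact Or.inr ⟨a, a', ha, ha', by rw [← hav, hv, hav']⟩
    · exact absurd (by rw [← hv, hav]; exact hL.branch a) hb'
    · exact absurd (by rw [hv, hav']; exact hL.branch a') hb
    · left
      have he : e = e' := edge_eq_of_image_eq (ρ := ρ) (by
        rw [← hfaces e k hact hlt, ← hfaces e' k' hact' hlt', facesE_of_not_branch hb rfl, hv,
          facesE_of_not_branch hb' rfl])
      subst he
      obtain rfl := (hline e).dsrc_injOn hq hlt hlt' hv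
      exact ⟨rfl, hcancel (by omega) (by rw [← hk0 hf, ← hk0' hf'])⟩
  · left
    have hlt := hklt hf
    have hlt' := hklt' hf'
    have hedge : (R e k).1 = (R e' k').1 := by
      rw [hk, hk'] at hd
      rcases hd with ⟨hd, -⟩ | ⟨hd, -⟩
      · rw [hd]
      · rw [hd, rev_fst]
    have he : e = e' := edge_eq_of_image_eq (ρ := ρ) (by
      rw [← hfaces e k (hactive e (by omega)) hlt, hedge,
        hfaces e' k' (hactive e' (by omega)) hlt'])
    subst he
    refine ⟨rfl, hcancel (by omega) ?_⟩
    rw [hk, hk'] at hd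
    rcases hd with ⟨hd, hfr⟩ | ⟨hd, -⟩
    · obtain rfl := (hline e).dsrc_injOn hq hlt hlt' (congrArg dsrc hd)
      rw [← Int.floor_add_fract ((m e : ℝ) * t), ← Int.floor_add_fract ((m e : ℝ) * t'), hk, hk',
        hfr]
    · obtain ⟨F, hF, -⟩ := (hline e).reading
      obtain ⟨N, hN⟩ := hq F
      exact absurd hd (hF.ne_rev hN _ _)

end

/-! ### The homeomorphism with the model -/

/-- Rotations and reflections of the disc. -/
theorem exists_disc_isometry (a : ℝ) {ε : ℝ} (hε : ε = 1 ∨ ε = -1) :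
    ∃ g : Disc → Disc, Continuous g ∧ (∀ z, ‖(g z : ℂ)‖ = ‖(z : ℂ)‖) ∧ Function.Bijective g ∧
      ∀ t, g (polar 1 t) = polar 1 (a + ε * t) := by
  let rot : ℝ → Disc → Disc := fun a z => ⟨(Circle.exp (2 * Real.pi * a) : ℂ) * z, by
    have := z.2
    rw [mem_closedBall_zero_iff] at this ⊢
    rwa [norm_mul, Circle.norm_coe, one_mul]⟩
  let conj : Disc → Disc := fun z => ⟨starRingEnd ℂ z, by
    have := z.2
    rw [mem_closedBall_zero_iff] at this ⊢
    rwa [RCLike.norm_conj]⟩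
  have hrotc : Continuous (rot a) := by simp only [rot]; fun_prop
  have hrotn : ∀ z, ‖(rot a z : ℂ)‖ = ‖(z : ℂ)‖ := fun z => by
    simp only [rot, norm_mul, Circle.norm_coe, one_mul]
  have hrr : ∀ a b, a + b = 0 → ∀ z, rot a (rot b z) = z := fun a b hab z => by
    apply Subtype.ext
    simp only [rot]
    rw [← mul_assoc, ← Circle.coe_mul, ← Circle.exp_add, ← mul_add, hab]
    simp
  have hrotb : Function.Bijective (rot a) := Function.bijective_iff_has_inverse.2
    ⟨rot (-a), hrr _ _ (by ring), hrr _ _ (by ring)⟩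
  have hrotp : ∀ t, rot a (polar 1 t) = polar 1 (a + t) := fun t => by
    apply Subtype.ext
    simp only [rot, polar_coe]
    rw [mul_add, Circle.exp_add, Circle.coe_mul]
    simp
  rcases hε with rfl | rfl
  · exact ⟨rot a, hrotc, hrotn, hrotb, fun t => by rw [hrotp, one_mul]⟩
  · have hcc : ∀ z, conj (conj z) = z := fun z => Subtype.ext (by simp [conj])
    have hconjp : ∀ t, conj (polar 1 t) = polar 1 (-t) := fun t => by
      apply Subtype.ext
      simp only [conj, polar_coe]
      rw [mul_neg, Circle.exp_neg, Circle.coe_inv_eq_conj]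
      simp
    refine ⟨rot a ∘ conj, hrotc.comp ?_, fun z => ?_,
      hrotb.comp (Function.bijective_iff_has_inverse.2 ⟨conj, hcc, hcc⟩), fun t => ?_⟩
    · simp only [conj]
      exact (Complex.continuous_conj.comp continuous_subtype_val).subtype_mk _
    · rw [Function.comp_apply, hrotn]
      exact RCLike.norm_conj _
    · rw [Function.comp_apply, hconjp, hrotp, neg_one_mul]

/-- Piecewise linear interpolation of a monotone sequence. -/
theorem exists_interpolation (M : ℕ → ℝ) (N : ℕ) (hM : ∀ k < N, M k ≤ M (k + 1)) :
    ∃ L : ℝ → ℝ, Continuous L ∧ Monotone L ∧ ∀ k < N, ∀ t, 0 ≤ t → t ≤ 1 →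
      L (k + t) = M k + (M (k + 1) - M k) * t := by
  let cl : ℝ → ℝ := fun y => max 0 (min 1 y)
  refine ⟨fun x => M 0 + ∑ l ∈ Finset.range N, (M (l + 1) - M l) * cl (x - l), ?_, ?_, ?_⟩
  · simp only [cl]; fun_prop
  · intro x y hxy
    refine add_le_add_right (Finset.sum_le_sum fun l hl => ?_) _
    refine mul_le_mul_of_nonneg_left ?_ (sub_nonneg.2 (hM l (Finset.mem_range.1 hl)))
    exact max_le_max le_rfl (min_le_min le_rfl (by linarith))
  · intro k hk t h0 h1
    dsimp only
    have key : ∀ n, k + 1 ≤ n → ∑ l ∈ Finset.range n, (M (l + 1) - M l) * cl (k + t - l) =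
        M k - M 0 + (M (k + 1) - M k) * t := by
      intro n hn
      induction n, hn using Nat.le_induction with
      | base =>
        rw [Finset.sum_range_succ]
        have h2 : cl (k + t - k) = t := by
          simp only [cl]
          rw [add_sub_cancel_left, min_eq_right h1, max_eq_right h0]
        have h3 : ∀ l ∈ Finset.range k, (M (l + 1) - M l) * cl (k + t - l) = M (l + 1) - M l := by
          intro l hl
          have hl' : (l : ℝ) + 1 ≤ k := by exact_mod_cast Finset.mem_range.1 hl
          simp only [cl]
          rw [min_eq_left (by linarith), max_eq_right zero_le_one, mul_one]
        rw [h2, Finset.sum_congr rfl h3, Finset.sum_range_sub]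
      | succ n hn ih =>
        rw [Finset.sum_range_succ, ih]
        have hn' : (k : ℝ) + 1 ≤ n := by exact_mod_cast hn
        simp only [cl]
        rw [min_eq_right (by linarith), max_eq_left (by linarith), mul_zero, add_zero]
    rw [key N hk]
    ring

section

variable {ρ : ℤ × ℤ ≃ X.C} {S : Set (ℤ × ℤ)} {vm : skeleton.V → X.V}
  {fd : skeleton.Dart → X.Dart} (hL : IsLabelling ρ S vm fd)
  (hq : ∀ F : X.C, ∃ N : ZMod 8 → X.C, QuasiFlatAt F N)
  {R : Edge → ℤ → X.Dart} {m : Edge → ℕ} (hline : ∀ e, IsLine S vm fd e (R e) (m e))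
include hL hq hline

/-- The disc of an octagon is mapped to that of the 2-cell with the same label, in such a way that
the sides of the octagon are mapped to the corresponding lines. -/
theorem IsLabelling.exists_cell_map (c : ℤ × ℤ) : ∃ h : Disc → Disc, Continuous h ∧
    (∀ z, ‖(h z : ℂ)‖ = ‖(z : ℂ)‖) ∧ (∀ z w : Disc, ‖(z : ℂ)‖ < 1 → h z = h w → z = w) ∧
    Function.Surjective h ∧ ∀ (k : Fin 8) (t : ℝ), 0 ≤ t → t ≤ 1 →
      facePt (ρ c) (h (polar 1 ((k + t) / 8))) = linePt R m (octagon c.1 c.2 k) t := by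
  obtain ⟨Q, M, hQ, hM0, hM8, hMs, hpt⟩ := hL.exists_reading hq hline c.1 c.2
  obtain ⟨a, ε, hε, hQf⟩ := hQ.readPt_eq_facePt
  obtain ⟨g, hgc, hgn, hgb, hgp⟩ := exists_disc_isometry a hε
  obtain ⟨L, hLc, hLm, hLp⟩ := exists_interpolation (fun k => (M k : ℝ)) 8 (fun k hk => by
    have := hMs ⟨k, hk⟩
    dsimp only at this ⊢
    rw [this]
    push_cast
    exact le_add_of_nonneg_right (Nat.cast_nonneg _))
  have hn : (0 : ℝ) < X.len (ρ (c.1, c.2)) := Nat.cast_pos.2 (X.len_pos _)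
  have hL0 : L 0 = 0 := by
    have := hLp 0 (by norm_num) 0 le_rfl zero_le_one
    simpa [hM0] using this
  have hL8 : L 8 = X.len (ρ (c.1, c.2)) := by
    have := hLp 7 (by norm_num) 1 zero_le_one le_rfl
    norm_num at this
    rw [this, hM8]
  obtain ⟨h, hc, hnorm, hinj, hsurj, hbd⟩ := exists_disc_map
    (l := fun x => L (8 * x) / X.len (ρ (c.1, c.2)))
    (by fun_prop) (fun x y hxy => div_le_div_of_nonneg_right (hLm (by linarith)) hn.le)
    (by simp [hL0]) (by simp [hL8, hn.ne'])
  refine ⟨g ∘ h, hgc.comp hc, fun z => by rw [Function.comp_apply, hgn, hnorm],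
    fun z w hz hzw => hinj z w hz (hgb.1 hzw), hgb.2.comp hsurj, fun k t h0 h1 => ?_⟩
  have hk8 : (k : ℝ) ≤ 7 := by
    have := k.2
    exact_mod_cast (show (k : ℕ) ≤ 7 by omega)
  have hk0 : (0 : ℝ) ≤ k := Nat.cast_nonneg _
  rw [Function.comp_apply, hbd _ (by positivity) (by linarith), hgp, ← hQf,
    mul_div_cancel₀ _ (by norm_num : (8 : ℝ) ≠ 0), hLp k k.2 t h0 h1, ← hpt k t h0 h1, hMs]
  push_cast
  rw [add_sub_cancel_left]

end

/-- A disjoint union of quotient maps is a quotient map. -/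
theorem isQuotientMap_sigmaMap {ι κ : Type*} {A : ι → Type*} {B : κ → Type*}
    [∀ i, TopologicalSpace (A i)] [∀ k, TopologicalSpace (B k)] (f : ι ≃ κ)
    {g : ∀ i, A i → B (f i)} (hg : ∀ i, IsQuotientMap (g i)) :
    IsQuotientMap (Sigma.map f g) := by
  refine (isQuotientMap_iff _).2 ⟨isCoinducing_iff.2 fun s => ?_, ?_⟩
  · rw [isOpen_sigma_iff, isOpen_sigma_iff]
    constructor
    · intro h k
      obtain ⟨i, rfl⟩ := f.surjective k
      exact (hg i).isOpen_preimage.1 (h i)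
    · intro h i
      exact (h (f i)).preimage (hg i).continuous
  · rintro ⟨k, b⟩
    obtain ⟨i, rfl⟩ := f.surjective k
    obtain ⟨a, rfl⟩ := (hg i).surjective b
    exact ⟨⟨i, a⟩, rfl⟩

/-- A 2-complex with labelled branch vertices is homeomorphic to the model with some of the
vertical edges collapsed. -/
theorem IsLabelling.nonempty_homeomorph {ρ : ℤ × ℤ ≃ X.C} {S : Set (ℤ × ℤ)}
    {vm : skeleton.V → X.V} {fd : skeleton.Dart → X.Dart} (hL : IsLabelling ρ S vm fd)
    (hX : X.FaceCovered) (hq : ∀ F : X.C, ∃ N : ZMod 8 → X.C, QuasiFlatAt F N) :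
    Nonempty (X.Realization ≃ₜ Collapse S) := by
  have hV : ∀ v : X.V, (facesV v).Nonempty := fun v => by
    obtain ⟨F, k, hk⟩ := hX.vert v
    exact ⟨F, mem_facesV.2 ⟨k, hk⟩⟩
  choose R m hline using fun e => hL.exists_isLine e hV
  choose h hc hnorm hinj hsurj hbd using hL.exists_cell_map hq hline
  have hsrc : ∀ e : Edge, linePt R m (e, true) 0 = vertexPt (vm (skeleton.src e)) := fun e =>
    hL.linePt_of_isEnd hq hline (Or.inl ⟨rfl, rfl⟩)
  have htgt : ∀ e : Edge, linePt R m (e, true) 1 = vertexPt (vm (skeleton.tgt e)) := fun e =>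
    hL.linePt_of_isEnd hq hline (Or.inr (Or.inl ⟨rfl, rfl⟩))
  let Φ₀ : model.PreRealization → X.Realization := fun x => match x with
    | .inl ⟨a, _⟩ => vertexPt (vm a)
    | .inr (.inl ⟨e, t⟩) => linePt R m (e, true) t
    | .inr (.inr ⟨c, z⟩) => facePt (ρ c) (h c z)
  have hglue : ∀ x y, model.Glue x y → Φ₀ x = Φ₀ y := by
    rintro x y (e | e | ⟨c, k, t⟩)
    · exact hsrc e
    · exact htgt e
    · change facePt (ρ c) (h c (discPt (2 * Real.pi * ((k.val : ℝ) + t) / (8 : ℕ)))) =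
        linePt R m ((octagon c.1 c.2 k).1, true)
          (if (octagon c.1 c.2 k).2 then t else unitInterval.symm t : unitInterval)
      have hdisc : discPt (2 * Real.pi * ((k.val : ℝ) + t) / (8 : ℕ)) =
          polar 1 ((k.val + t) / 8) := by
        rw [polar_one_eq_discPt]
        congr 1
        push_cast
        ring
      rw [hdisc]
      refine (hbd c k t t.2.1 t.2.2).trans ?_
      rcases octagon c.1 c.2 k with ⟨e, _ | _⟩ <;> simp [linePt]
  let Φ₁ : model.Realization → X.Realization := Quot.lift Φ₀ hglue
  have hcoll : ∀ x y : model.Realization,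
      (∃ p ∈ S, x ∈ verticalEdge p ∧ y ∈ verticalEdge p) → Φ₁ x = Φ₁ y := by
    rintro x y ⟨p, hp, ⟨t, rfl⟩, ⟨t', rfl⟩⟩
    have : ∀ t : unitInterval, Φ₁ (edgePt (X := model) (Edge.z p.1 p.2) t) =
        vertexPt (vm (skeleton.src (Edge.z p.1 p.2))) := fun t =>
      hL.linePt_of_isEnd hq hline (Or.inr (Or.inr ⟨fun hn => hn hp, rfl⟩))
    rw [this, this]
  let Φ : Collapse S → X.Realization := Quot.lift Φ₁ hcoll
  have hR : ∀ e, ∃ F, IsReading F (R e) := fun e =>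
    let ⟨F, hF, _⟩ := (hline e).reading
    ⟨F, hF⟩
  have hΦc : Continuous Φ := by
    refine continuous_quot_lift _ (continuous_quot_lift _ ?_)
    refine continuous_sum_dom.2 ⟨?_, continuous_sum_dom.2 ⟨?_, ?_⟩⟩
    · exact continuous_sigma_iff.2 fun a => continuous_const
    · refine continuous_sigma_iff.2 fun e => ?_
      obtain ⟨F, hF⟩ := hR e
      exact hF.continuous_readPt.comp (continuous_const.mul continuous_subtype_val)
    · exact continuous_sigma_iff.2 fun c => (continuous_facePt (ρ c)).comp (hc c)
  let π : model.PreRealization → Collapse S := fun x => Quot.mk _ (Quot.mk _ x)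
  have hπ : Continuous π := continuous_quot_mk.comp continuous_quot_mk
  -- On the disjoint union of the discs, `Φ` is a composition of quotient maps.
  have hΦq : IsQuotientMap Φ := by
    have h1 : IsQuotientMap (Φ ∘ fun p : Σ _ : ℤ × ℤ, Disc => π (.inr (.inr p))) := by
      refine (isQuotientMap_facePt hX).comp (isQuotientMap_sigmaMap ρ (g := h) fun c => ?_)
      exact (hc c).isClosedMap.isQuotientMap (hc c) (hsurj c)
    exact IsQuotientMap.of_comp (hπ.comp (continuous_inr.comp continuous_inr)) hΦc h1
  -- Points on the boundary of an octagon lie on edges.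
  have hrep : ∀ u : Collapse S, (∃ (c : ℤ × ℤ) (z : Disc), ‖(z : ℂ)‖ < 1 ∧
      u = π (.inr (.inr ⟨c, z⟩))) ∨ ∃ (e : Edge) (t : unitInterval), u = π (.inr (.inl ⟨e, t⟩)) := by
    rintro ⟨⟨⟨⟨i, j, _ | _⟩, ⟨⟩⟩ | ⟨e, t⟩ | ⟨c, z⟩⟩⟩
    · exact Or.inr ⟨.x i j, 0,
        congrArg (Quot.mk _) (Quot.sound (Glue.src (X := model) (Edge.x i j))).symm⟩
    · exact Or.inr ⟨.y i j, 0,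
        congrArg (Quot.mk _) (Quot.sound (Glue.src (X := model) (Edge.y i j))).symm⟩
    · exact Or.inr ⟨e, t, rfl⟩
    · obtain ⟨r, t, ht0, ht1, rfl⟩ := exists_polar z
      rcases r.2.2.lt_or_eq with hr | hr
      · exact Or.inl ⟨c, _, by rwa [norm_polar], rfl⟩
      · right
        obtain rfl : r = 1 := Subtype.ext hr
        obtain ⟨k, hk⟩ := Int.eq_ofNat_of_zero_le (Int.floor_nonneg.2 (by positivity : 0 ≤ 8 * t))
        have hadd := Int.floor_add_fract (8 * t)
        have hfr := Int.fract_nonneg (8 * t)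
        rw [hk] at hadd
        replace hadd : (k : ℝ) + Int.fract (8 * t) = 8 * t := by exact_mod_cast hadd
        have hk8 : k < 8 := by
          have : (k : ℝ) < 8 := by linarith
          exact_mod_cast this
        have hglue := Glue.att (X := model) c (⟨k, hk8⟩ : Fin 8)
          ⟨Int.fract (8 * t), hfr, (Int.fract_lt_one _).le⟩
        refine ⟨_, _, congrArg (Quot.mk _) (Eq.trans ?_ (Quot.sound hglue))⟩
        have hdisc : polar 1 t =
            discPt (2 * Real.pi * ((k : ℝ) + Int.fract (8 * t)) / (8 : ℕ)) := by
          rw [polar_one_eq_discPt, hadd]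
          congr 1
          push_cast
          ring
        rw [hdisc]
        rfl
  have hvm : ∀ a a' : skeleton.V, vm a = vm a' → π (.inl ⟨a, ()⟩) = π (.inl ⟨a', ()⟩) := by
    intro a a' haa
    rcases (hL.vm_eq a a').1 haa with rfl | ⟨hp, hS⟩
    · rfl
    · have hmem : ∀ a, vertexPt (X := model) a ∈ verticalEdge (place a) := by
        rintro ⟨i, j, _ | _⟩
        · exact ⟨0, Quot.sound (Glue.src (X := model) (Edge.z i j))⟩
        · exact ⟨1, Quot.sound (Glue.tgt (X := model) (Edge.z i j))⟩
      exact Quot.sound ⟨place a, hS, hmem a, hp ▸ hmem a'⟩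
  have hend : ∀ (e : Edge) (t : unitInterval) (a : skeleton.V), IsEnd S e t a →
      π (.inr (.inl ⟨e, t⟩)) = π (.inl ⟨a, ()⟩) := by
    rintro e t a (⟨ht, rfl⟩ | ⟨ht, rfl⟩ | ⟨he, rfl⟩)
    · obtain rfl : t = 0 := Subtype.ext ht
      exact congrArg (Quot.mk _) (Quot.sound (Glue.src (X := model) e))
    · obtain rfl : t = 1 := Subtype.ext ht
      exact congrArg (Quot.mk _) (Quot.sound (Glue.tgt (X := model) e))
    · rcases e with ⟨i, j⟩ | ⟨i, j⟩ | ⟨i, j⟩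
      · exact absurd trivial he
      · exact absurd trivial he
      · exact Quot.sound ⟨(i, j), not_not.1 he, ⟨t, rfl⟩, 0,
          Quot.sound (Glue.src (X := model) (Edge.z i j))⟩
  have hne : ∀ (c : ℤ × ℤ) (z : Disc) (e : Edge) (t : ℝ), ‖(z : ℂ)‖ < 1 →
      facePt (ρ c) (h c z) ≠ linePt R m (e, true) t := by
    intro c z e t hz heq
    obtain ⟨F, hF⟩ := hR e
    obtain ⟨a, ε, -, hQ⟩ := hF.readPt_eq_facePt
    rw [linePt, hQ] at heq
    have h1 := (facePt_eq_facePt (by rwa [hnorm]) heq).2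
    have h2 := hnorm c z
    rw [h1, norm_polar] at h2
    exact hz.ne h2.symm
  have hΦi : Function.Injective Φ := by
    intro u u' huu
    rcases hrep u with ⟨c, z, hz, rfl⟩ | ⟨e, t, rfl⟩ <;>
    rcases hrep u' with ⟨c', z', hz', rfl⟩ | ⟨e', t', rfl⟩
    · have huu : facePt (ρ c) (h c z) = facePt (ρ c') (h c' z') := huu
      obtain ⟨h1, h2⟩ := facePt_eq_facePt (by rwa [hnorm]) huu
      obtain rfl := ρ.injective h1
      rw [hinj c z z' hz h2]
    · exact absurd huu (hne c z e' t' hz)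
    · exact absurd huu.symm (hne c' z' e t hz')
    · rcases hL.eq_of_linePt_eq hq hline t.2.1 t.2.2 t'.2.1 t'.2.2 huu with
        ⟨rfl, ht⟩ | ⟨a, a', ha, ha', haa⟩
      · rw [Subtype.ext ht]
      · rw [hend e t a ha, hend e' t' a' ha', hvm a a' haa]
  exact ⟨(IsHomeomorph.homeomorph Φ (isHomeomorph_iff_isQuotientMap_injective.2
    ⟨hΦq, hΦi⟩)).symm⟩

end TwoComplex

theorem mainTheorem9 (X : TwoComplex.{u}) (hne : Nonempty X.C)
    (hsc : SimplyConnectedSpace X.Realization)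
    (hC : X.SatisfiesC 4) (hT : X.SatisfiesT 4)
    (hedge : ∀ e : X.E, ∃ G G' : X.C, G ≠ G' ∧
      TwoComplex.Cell.edge e ∈ TwoComplex.closedCell G ∧
      TwoComplex.Cell.edge e ∈ TwoComplex.closedCell G')
    (hqf : ∀ F : X.C, ∃ N : ZMod 8 → X.C, TwoComplex.QuasiFlatAt F N) :
    X.IsQuasiFlatPlane := by
  have hX : X.FaceCovered := TwoComplex.faceCovered_of_preconnected hne fun e => by
    obtain ⟨G, -, -, hG, -⟩ := hedge e
    exact ⟨G, hG⟩
  obtain ⟨ρ, hρ⟩ := TwoComplex.exists_development hX hne hqf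
  obtain ⟨S, vm, fd, hL⟩ := TwoComplex.exists_isLabelling hX hρ hqf
  exact ⟨hC, hT, S, hL.nonempty_homeomorph hX hqf⟩
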